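/- Let $w=(w_1,w_2,w_3)$ be positive integers with $\gcd(w_1,w_2,w_3)=1$, and let $\mathbb C^*$ act on $\mathbb C^3$ by $t\cdot x=(t^{w_1}x_1,t^{w_2}x_2,t^{w_3}x_3)$. Let $f\in\mathbb R[x_1,x_2,x_3]$ be a nonzero polynomial that is weighted homogeneous with respect to $w$, let $X=\{x\in\mathbb C^3: f(x)=0\}$ and $X(\mathbb R)=\{x\in\mathbb R^3: f(x)=0\}$, and assume that $0$ is an isolated singular point of $X$. Let $M=(X-\{0\})/\mathbb C^*$ with the quotient topology and let $\pi\colon X-\{0\}\to M$ be the projection. Put $\varphi(z)=(z_1^{w_1},z_2^{w_2},z_3^{w_3})$, $X'=\varphi^{-1}(X)$, $M'=\{[z]\in\mathbb CP^2: z\in X'\}$, $F=\{[z]\in M': z_1z_2z_3=0\}$, and let $\phi\colon M'\to M$ be the map with $\phi([z])=\pi(\varphi(z))$ for $z\in X'-\{0\}$. Equip $M-\phi(F)$ with the holomorphic structure for which $\phi\colon M'-F\to M-\phi(F)$ is locally biholomorphic (such a structure exists), where $M'-F$ carries its structure of complex submanifold of $\mathbb CP^2$. Then there is an involution $j\colon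 M\to M$, induced by complex conjugation, i.e. $j(\pi(x))=\pi(\overline x)$ for all $x\in X-\{0\}$, such that: 1. $j$ maps $M-\phi(F)$ to itself and its restriction $M-\phi(F)\to M-\phi(F)$ is antiholomorphic. The fixed point set of $j$ on $M$ is exactly $\pi(X(\mathbb R)-\{0\})$. In particular, if $X(\mathbb R)\cap\{x_1x_2x_3=0\}\subseteq\{0\}$, then $\pi(X(\mathbb R)-\{0\})=\{m\in M-\phi(F): j(m)=m\}$. 2. If $M-\pi(X(\mathbb R)-\{0\})$ is disconnected, then it has exactly two connected components $M_1$ and $M_2$, and these are exchanged by $j$: $M_1=j(M_2)$ and $M_2=j(M_1)$. -/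

import Mathlib

open Set Topology MvPolynomial
open scoped Manifold ContDiff LinearAlgebra.Projectivization ComplexConjugate

noncomputable section

namespace WeightedSurface

/-! ### Algebraic surfaces in `ℂ³` -/

/-- The complex surface `X = {x ∈ ℂ³ : f x = 0}` defined by a real polynomial `f`. -/
def surface (f : MvPolynomial (Fin 3) ℝ) : Set (Fin 3 → ℂ) := {x | aeval x f = 0}

/-- The real part `X(ℝ) = {x ∈ ℝ³ : f x = 0}`. -/
def realSurface (f : MvPolynomial (Fin 3) ℝ) : Set (Fin 3 → ℝ) := {x | eval x f = 0}

/-- `x` is a singular point of the algebraic surface `X ⊆ ℂ³` (with its reduced structure):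
the Jacobian matrix at `x` of the polynomials vanishing on `X` has rank smaller than
`3 - dim X = 1`, i.e. all the gradients are zero. -/
def IsSingularPoint (X : Set (Fin 3 → ℂ)) (x : Fin 3 → ℂ) : Prop :=
  x ∈ X ∧ ∀ g ∈ vanishingIdeal ℂ X, ∀ i, eval x (pderiv i g) = 0

/-- `x` is an isolated singular point of the algebraic surface `X ⊆ ℂ³`. -/
def IsIsolatedSingularPoint (X : Set (Fin 3 → ℂ)) (x : Fin 3 → ℂ) : Prop :=
  IsSingularPoint X x ∧ ∀ᶠ y in 𝓝[≠] x, ¬ IsSingularPoint X y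

/-! ### The orbit space `M = (X - {0}) / ℂ*` -/

/-- The set `X - {0}`. -/
abbrev Punctured (X : Set (Fin 3 → ℂ)) : Type := {x : Fin 3 → ℂ // x ∈ X ∧ x ≠ 0}

/-- The weighted action `t • x = (t ^ w₁ x₁, t ^ w₂ x₂, t ^ w₃ x₃)` of `ℂ*` on `ℂ³`. -/
def weightedAction (w : Fin 3 → ℕ+) (t : ℂˣ) (x : Fin 3 → ℂ) : Fin 3 → ℂ :=
  fun i => (t : ℂ) ^ (w i : ℕ) * x i

/-- Two points of `X - {0}` are related if they lie on the same orbit of the weighted action. -/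
def orbitSetoid (w : Fin 3 → ℕ+) (X : Set (Fin 3 → ℂ)) : Setoid (Punctured X) where
  r x y := ∃ t : ℂˣ, y.1 = weightedAction w t x.1
  iseqv :=
    { refl := fun x => ⟨1, by funext i; simp [weightedAction]⟩
      symm := by
        rintro x y ⟨t, h⟩
        refine ⟨t⁻¹, ?_⟩
        funext i
        have ht : (t : ℂ) ^ (w i : ℕ) ≠ 0 := pow_ne_zero _ t.ne_zero
        simp [h, weightedAction, ht]
      trans := by
        rintro x y z ⟨t, h⟩ ⟨s, h'⟩
        refine ⟨s * t, ?_⟩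
        funext i
        simp [h, h', weightedAction, mul_pow, mul_assoc] }

/-- The orbit space `M = (X - {0}) / ℂ*`, with the quotient topology. -/
def OrbitSpace (w : Fin 3 → ℕ+) (X : Set (Fin 3 → ℂ)) : Type := Quotient (orbitSetoid w X)

instance (w : Fin 3 → ℕ+) (X : Set (Fin 3 → ℂ)) : TopologicalSpace (OrbitSpace w X) :=
  inferInstanceAs (TopologicalSpace (Quotient (orbitSetoid w X)))

/-- The projection `π : X - {0} → M`. -/
def orbitProj (w : Fin 3 → ℕ+) (X : Set (Fin 3 → ℂ)) (x : Punctured X) : OrbitSpace w X :=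
  Quotient.mk (orbitSetoid w X) x

/-- The set `π(X(ℝ) - {0}) ⊆ M`. -/
def realOrbits (w : Fin 3 → ℕ+) (f : MvPolynomial (Fin 3) ℝ) : Set (OrbitSpace w (surface f)) :=
  orbitProj w (surface f) ''
    {x | ∃ y ∈ realSurface f, y ≠ 0 ∧ x.1 = fun i => (y i : ℂ)}

/-- Complex conjugation as a map `X - {0} → X - {0}`, where `X` is defined by a real
polynomial. -/
def conjPunctured (f : MvPolynomial (Fin 3) ℝ) (x : Punctured (surface f)) :
    Punctured (surface f) :=
  ⟨fun i => conj (x.1 i), by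
    have h : aeval (fun i => conj (x.1 i)) f = conj (aeval x.1 f) := by
      have := MvPolynomial.comp_aeval_apply (φ := Complex.conjAe.toAlgHom) x.1 f
      simpa using this.symm
    show aeval _ f = 0
    rw [h, show aeval x.1 f = 0 from x.2.1, map_zero], by
    intro h
    apply x.2.2
    funext i
    simpa using congrFun h i⟩

/-! ### The homogeneous modification and the projective curve `M'` -/

/-- The map `φ(z) = (z₁ ^ w₁, z₂ ^ w₂, z₃ ^ w₃)`. -/
def powMap (w : Fin 3 → ℕ+) (z : Fin 3 → ℂ) : Fin 3 → ℂ := fun i => z i ^ (w i : ℕ)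

lemma powMap_ne_zero (w : Fin 3 → ℕ+) {z : Fin 3 → ℂ} (hz : z ≠ 0) : powMap w z ≠ 0 := by
  intro h
  apply hz
  funext i
  exact pow_eq_zero_iff (w i).ne_zero |>.1 (congrFun h i)

/-- The homogeneous modification `X' = φ⁻¹(X)`. -/
def modification (w : Fin 3 → ℕ+) (X : Set (Fin 3 → ℂ)) : Set (Fin 3 → ℂ) := powMap w ⁻¹' X

/-- The complex projective plane, with the quotient topology. -/
abbrev CP2 : Type := ℙ ℂ (Fin 3 → ℂ)

instance : TopologicalSpace CP2 :=
  inferInstanceAs (TopologicalSpace (Quotient (projectivizationSetoid ℂ (Fin 3 → ℂ))))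

/-- The projective curve `M' = {[z] ∈ ℂP² : z ∈ X'}`. -/
def curve (w : Fin 3 → ℕ+) (X : Set (Fin 3 → ℂ)) : Set CP2 :=
  {p | ∃ (z : Fin 3 → ℂ) (hz : z ≠ 0), Projectivization.mk ℂ z hz = p ∧ z ∈ modification w X}

/-- The branched covering `ϕ : M' → M`, `ϕ [z] = π (φ z)`; see `cover_mk`. -/
def cover (w : Fin 3 → ℕ+) (X : Set (Fin 3 → ℂ)) (p : curve w X) : OrbitSpace w X :=
  orbitProj w X ⟨powMap w p.2.choose,
    p.2.choose_spec.choose_spec.2, powMap_ne_zero w p.2.choose_spec.choose⟩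

lemma orbitProj_powMap_eq (w : Fin 3 → ℕ+) (X : Set (Fin 3 → ℂ)) {z z' : Fin 3 → ℂ}
    (hz : z ≠ 0) (hz' : z' ≠ 0) (hX : z ∈ modification w X) (hX' : z' ∈ modification w X)
    (h : Projectivization.mk ℂ z hz = Projectivization.mk ℂ z' hz') :
    orbitProj w X ⟨powMap w z, hX, powMap_ne_zero w hz⟩ =
      orbitProj w X ⟨powMap w z', hX', powMap_ne_zero w hz'⟩ := by
  obtain ⟨a, ha⟩ := (Projectivization.mk_eq_mk_iff ℂ z' z hz' hz).1 h.symm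
  refine Quotient.sound (s := orbitSetoid w X) ⟨a, ?_⟩
  funext i
  have hi : z' i = (a : ℂ) * z i := by rw [← ha]; rfl
  show z' i ^ _ = (a : ℂ) ^ _ * z i ^ _
  rw [hi, mul_pow]

/-- The defining property `π ∘ φ (z) = ϕ [z]` for all `z ∈ X' - {0}`. -/
lemma cover_mk (w : Fin 3 → ℕ+) (X : Set (Fin 3 → ℂ)) {z : Fin 3 → ℂ} (hz : z ≠ 0)
    (hX : z ∈ modification w X) :
    cover w X ⟨Projectivization.mk ℂ z hz, z, hz, rfl, hX⟩ =
      orbitProj w X ⟨powMap w z, hX, powMap_ne_zero w hz⟩ :=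
  have H : ∃ (y : Fin 3 → ℂ) (hy : y ≠ 0),
      Projectivization.mk ℂ y hy = Projectivization.mk ℂ z hz ∧ y ∈ modification w X :=
    ⟨z, hz, rfl, hX⟩
  orbitProj_powMap_eq w X H.choose_spec.choose hz H.choose_spec.choose_spec.2 hX
    H.choose_spec.choose_spec.1

/-- The set `F = {[z] ∈ M' : z₁ z₂ z₃ = 0}`. -/
def branchSet (w : Fin 3 → ℕ+) (X : Set (Fin 3 → ℂ)) : Set (curve w X) :=
  {p | ∃ (z : Fin 3 → ℂ) (hz : z ≠ 0), Projectivization.mk ℂ z hz = p.1 ∧ z 0 * z 1 * z 2 = 0}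

/-- The set `ϕ(F) ⊆ M`. -/
def branchImage (w : Fin 3 → ℕ+) (X : Set (Fin 3 → ℂ)) : Set (OrbitSpace w X) :=
  cover w X '' branchSet w X

/-- The map `ϕ` sends `M' - F` into `M - ϕ(F)`. -/
lemma mapsTo_cover (w : Fin 3 → ℕ+) (X : Set (Fin 3 → ℂ)) :
    MapsTo (cover w X) (branchSet w X)ᶜ (branchImage w X)ᶜ := by
  rintro p hp ⟨q, ⟨z', hz', hq, h0⟩, hqp⟩
  apply hp
  obtain ⟨p, z, hz, rfl, hX⟩ := p
  refine ⟨z, hz, rfl, ?_⟩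
  obtain ⟨q, y, hy, rfl, hY⟩ := q
  rw [cover_mk w X hy hY, cover_mk w X hz hX] at hqp
  obtain ⟨t, ht⟩ := Quotient.exact hqp
  obtain ⟨a, ha⟩ := (Projectivization.mk_eq_mk_iff ℂ z' y hz' hy).1 hq
  have key : ∀ i, z' i = 0 → z i = 0 := by
    intro i hi
    have hyi : y i = 0 := by
      have : (a : ℂ) * y i = 0 := by rw [← hi, ← ha]; rfl
      simpa using this
    have h1 : z i ^ (w i : ℕ) = (t : ℂ) ^ (w i : ℕ) * y i ^ (w i : ℕ) := congrFun ht i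
    rw [hyi, zero_pow (w i).ne_zero, mul_zero] at h1
    exact (pow_eq_zero_iff (w i).ne_zero).1 h1
  rcases mul_eq_zero.1 h0 with h0 | h0
  · rcases mul_eq_zero.1 h0 with h0 | h0
    · simp [key 0 h0]
    · simp [key 1 h0]
  · simp [key 2 h0]

/-! ### Holomorphic structures -/

/-- `M' - F`. -/
abbrev RegularCurve (w : Fin 3 → ℕ+) (X : Set (Fin 3 → ℂ)) : Type :=
  ((branchSet w X)ᶜ : Set (curve w X))

/-- `M - ϕ(F)`. -/
abbrev RegularOrbits (w : Fin 3 → ℕ+) (X : Set (Fin 3 → ℂ)) : Type :=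
  ((branchImage w X)ᶜ : Set (OrbitSpace w X))

/-- The restriction `ϕ : M' - F → M - ϕ(F)`. -/
def regularCover (w : Fin 3 → ℕ+) (X : Set (Fin 3 → ℂ)) : RegularCurve w X → RegularOrbits w X :=
  (mapsTo_cover w X).restrict

/-- The affine coordinates `[z] ↦ (z₁ / z₃, z₂ / z₃)` of `ℂP²` on `M' - F`
(where `z₃` does not vanish). -/
def affineCoords (w : Fin 3 → ℕ+) (X : Set (Fin 3 → ℂ)) (p : RegularCurve w X) : ℂ × ℂ :=
  (p.1.1.rep 0 / p.1.1.rep 2, p.1.1.rep 1 / p.1.1.rep 2)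

/-- A complex structure on `M' - F` is the one of a complex submanifold of `ℂP²`: the inclusion,
read in the affine chart `z₃ ≠ 0` of `ℂP²`, is a holomorphic embedding. -/
def IsSubmanifoldStructure (w : Fin 3 → ℕ+) (X : Set (Fin 3 → ℂ))
    (C : ChartedSpace ℂ (RegularCurve w X)) : Prop :=
  letI := C
  IsManifold 𝓘(ℂ, ℂ) ω (RegularCurve w X) ∧
    Manifold.IsSmoothEmbedding 𝓘(ℂ, ℂ) 𝓘(ℂ, ℂ × ℂ) ω (affineCoords w X)

/-- A complex structure on `M - ϕ(F)` is the one induced by `ϕ`: the map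
`ϕ : M' - F → M - ϕ(F)` is locally biholomorphic, where `M' - F` is a complex submanifold of
`ℂP²`. -/
def IsInducedStructure (w : Fin 3 → ℕ+) (X : Set (Fin 3 → ℂ))
    (C : ChartedSpace ℂ (RegularOrbits w X)) : Prop :=
  letI := C
  IsManifold 𝓘(ℂ, ℂ) ω (RegularOrbits w X) ∧
    ∃ C' : ChartedSpace ℂ (RegularCurve w X), IsSubmanifoldStructure w X C' ∧
      IsLocalDiffeomorph 𝓘(ℂ, ℂ) 𝓘(ℂ, ℂ) ω (regularCover w X)

/-- A continuous self-map of a one-dimensional complex manifold is antiholomorphic if the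
conjugates of its expressions in charts are holomorphic. -/
def IsAntiholomorphic {S : Type*} [TopologicalSpace S] (C : ChartedSpace ℂ S) (j : S → S) : Prop :=
  letI := C
  Continuous j ∧ ∀ x, MDifferentiableAt 𝓘(ℂ, ℂ) 𝓘(ℂ, ℂ)
    (fun y => conj (chartAt ℂ (j x) (j y))) x

/-- The connected components of a subset `A` of a topological space. -/
def componentsOf {S : Type*} [TopologicalSpace S] (A : Set S) : Set (Set S) :=
  {B | ∃ x ∈ A, B = connectedComponentIn A x}

end WeightedSurface

end

/-! Conjugation normalises the weighted action: the conjugate of t·x is conj(t)·conj(x). It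
therefore descends to an involution j of M. If j fixes the orbit of x, then x = t·conj(x) with |t| =
1, and a square root of t rotates x to a real point of the same orbit; this determines the fixed
set.

Complex structure. Since the origin is an isolated singular point and the action contracts towards
it, X − {0} is smooth. Euler's relation makes X transversal to every slice {yᵢ = xᵢ} with xᵢ ≠ 0. In
the affine chart z₃ = 1 the curve M' − F is thus locally the graph of a holomorphic function, hence
a submanifold of ℂ². Points with the same image under ϕ differ by diagonal linear maps (a, b) ↦ (λa,
μb) that preserve the curve and ϕ, so the structure descends to M − ϕ(F). Upstairs j lifts to
conjugation of ℂ². A holomorphic function on the curve extends locally to some k on ℂ², and conj ∘ k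
∘ conj is again holomorphic; this gives antiholomorphy.

Components. Everything reduces to one claim: the complement Ω of the fixed set has no splitting into
two nonempty open pieces that are both j-stable (`eq_empty_of_invariant_splitting`). By pure
topology, Ω is then connected or consists of two components exchanged by j
(`components_of_no_invariant_splitting`). For the claim, a stable splitting is extended across the
fixed set to a splitting of M. Near the orbit of a real point x, a slice presents M as the image of
a disc on which j is conjugation (`exists_real_slice`). If the disc is centred at u ≠ 0, the fixed
points near the centre are exactly the real u; the two half discs are exchanged by j and so belong
to the same piece. If the centre is u = 0, where the isotropy may produce several fixed lines, every
other fixed point is of the former kind, and the punctured disc is connected.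

This contradicts the connectedness of M (`preconnectedSpace_orbitSpace`), which comes from that of
the plane curve M'. Suppose the cone over the curve split into two clopen cones. In suitable
coordinates its equation is monic in one variable and factors over every a in ℂ² − {0} into coprime
factors G and H, analytic in a because multiplication of coprime monic polynomials is a local
biholomorphism. Their resultant R has no zeros and is homogeneous of degree deg G · deg H > 0 on ℂ²
− {0}. Then 1/R(1, y) is entire and tends to 0 at infinity, so it vanishes by Liouville's theorem,
which is absurd. -/

noncomputable section

namespace Polynomial

/-! ### Analytic factorization of families of polynomials -/

/-- The polynomial `∑ uᵢ Tⁱ` of degree less than `m` with coefficients `u`. -/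
def ofCoeffs {m : ℕ} (u : Fin m → ℂ) : ℂ[X] := ∑ i, C (u i) * X ^ (i : ℕ)

/-- The monic polynomial `T ^ m + ∑ uᵢ Tⁱ` of degree `m` with lower coefficients `u`. -/
def monicOfCoeffs {m : ℕ} (u : Fin m → ℂ) : ℂ[X] := X ^ m + ofCoeffs u

lemma degree_ofCoeffs_lt {m : ℕ} (u : Fin m → ℂ) : (ofCoeffs u).degree < m := by
  refine (degree_sum_le _ _).trans_lt ?_
  refine (Finset.sup_lt_iff (WithBot.bot_lt_coe m)).2 fun i _ => ?_
  exact (degree_C_mul_X_pow_le _ _).trans_lt (Nat.cast_lt.2 i.2)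

lemma coeff_ofCoeffs {m : ℕ} (u : Fin m → ℂ) (k : ℕ) :
    (ofCoeffs u).coeff k = if h : k < m then u ⟨k, h⟩ else 0 := by
  split_ifs with h
  · rw [ofCoeffs, finsetSum_coeff, Finset.sum_eq_single ⟨k, h⟩]
    · simp
    · intro b _ hb
      rw [coeff_C_mul_X_pow, if_neg]
      rintro rfl
      exact hb rfl
    · simp
  · exact coeff_eq_zero_of_degree_lt ((degree_ofCoeffs_lt u).trans_le
      (by exact_mod_cast not_lt.1 h))

lemma ofCoeffs_eq_zero {m : ℕ} {u : Fin m → ℂ} (h : ofCoeffs u = 0) : u = 0 := by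
  funext i
  have := coeff_ofCoeffs u i
  rw [dif_pos i.2, h] at this
  simpa using this.symm

lemma ofCoeffs_add {m : ℕ} (u v : Fin m → ℂ) : ofCoeffs (u + v) = ofCoeffs u + ofCoeffs v := by
  simp [ofCoeffs, add_mul, Finset.sum_add_distrib]

lemma ofCoeffs_smul {m : ℕ} (c : ℂ) (u : Fin m → ℂ) : ofCoeffs (c • u) = C c * ofCoeffs u := by
  simp [ofCoeffs, mul_assoc, Finset.mul_sum]

lemma monic_monicOfCoeffs {m : ℕ} (u : Fin m → ℂ) : (monicOfCoeffs u).Monic :=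
  monic_X_pow_add (degree_ofCoeffs_lt u)

lemma natDegree_monicOfCoeffs {m : ℕ} (u : Fin m → ℂ) : (monicOfCoeffs u).natDegree = m := by
  apply natDegree_eq_of_degree_eq_some
  rw [monicOfCoeffs, degree_add_eq_left_of_degree_lt] <;> rw [degree_X_pow]
  exact degree_ofCoeffs_lt u

lemma monicOfCoeffs_coeff {m : ℕ} {p : ℂ[X]} (hp : p.Monic) (hm : p.natDegree = m) :
    monicOfCoeffs (fun i : Fin m => p.coeff i) = p := by
  subst hm
  conv_rhs => rw [hp.as_sum]
  rw [monicOfCoeffs, ofCoeffs, Finset.sum_range]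

lemma contDiff_coeff_ofCoeffs {m : ℕ} (k : ℕ) :
    ContDiff ℂ ω (fun u : Fin m → ℂ => (ofCoeffs u).coeff k) := by
  simp only [coeff_ofCoeffs]
  split_ifs with h
  · exact contDiff_apply ℂ ℂ _
  · exact contDiff_const

lemma contDiff_coeff_monicOfCoeffs {m : ℕ} (k : ℕ) :
    ContDiff ℂ ω (fun u : Fin m → ℂ => (monicOfCoeffs u).coeff k) := by
  simp only [monicOfCoeffs, coeff_add]
  exact contDiff_const.add (contDiff_coeff_ofCoeffs k)

lemma contDiffAt_coeff_mul {E : Type*} [NormedAddCommGroup E] [NormedSpace ℂ E]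
    {p q : E → ℂ[X]} {a : E} (hp : ∀ k, ContDiffAt ℂ ω (fun x => (p x).coeff k) a)
    (hq : ∀ k, ContDiffAt ℂ ω (fun x => (q x).coeff k) a) (k : ℕ) :
    ContDiffAt ℂ ω (fun x => (p x * q x).coeff k) a := by
  simp only [coeff_mul]
  exact ContDiffAt.sum fun i _ => (hp _).mul (hq _)

/-- Multiplication of monic polynomials in terms of their lower coefficients. -/
def mulCoeffs (m n : ℕ) (p : (Fin m → ℂ) × (Fin n → ℂ)) : Fin (m + n) → ℂ :=
  fun k => (monicOfCoeffs p.1 * monicOfCoeffs p.2).coeff k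

lemma contDiff_mulCoeffs (m n : ℕ) : ContDiff ℂ ω (mulCoeffs m n) := by
  rw [contDiff_pi]
  intro k
  refine contDiff_iff_contDiffAt.2 fun a => contDiffAt_coeff_mul (fun k => ?_) (fun k => ?_) k
  · exact ((contDiff_coeff_monicOfCoeffs k).comp contDiff_fst).contDiffAt
  · exact ((contDiff_coeff_monicOfCoeffs k).comp contDiff_snd).contDiffAt

/-- Along a line t ↦ p + t·d the product is a quadratic polynomial in t, so the derivative is its
linear coefficient. -/
lemma fderiv_mulCoeffs (m n : ℕ) (p d : (Fin m → ℂ) × (Fin n → ℂ)) (k : Fin (m + n)) :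
    fderiv ℂ (mulCoeffs m n) p d k =
      (ofCoeffs d.1 * monicOfCoeffs p.2 + monicOfCoeffs p.1 * ofCoeffs d.2).coeff k := by
  have h1 : HasFDerivAt (mulCoeffs m n) (fderiv ℂ (mulCoeffs m n) p) p :=
    ((contDiff_mulCoeffs m n).differentiable (by simp) p).hasFDerivAt
  have h2 : HasDerivAt (fun t : ℂ => mulCoeffs m n (p + t • d)) (fderiv ℂ (mulCoeffs m n) p d) 0 :=
    h1.hasLineDerivAt d
  have h3 := (hasDerivAt_pi.1 h2) k
  have h4 : (fun t : ℂ => mulCoeffs m n (p + t • d) k) = fun t =>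
      (monicOfCoeffs p.1 * monicOfCoeffs p.2).coeff k +
      t * (ofCoeffs d.1 * monicOfCoeffs p.2 + monicOfCoeffs p.1 * ofCoeffs d.2).coeff k +
      t ^ 2 * (ofCoeffs d.1 * ofCoeffs d.2).coeff k := by
    funext t
    simp only [mulCoeffs, ← coeff_C_mul, ← coeff_add]
    congr 1
    simp only [monicOfCoeffs, Prod.fst_add, Prod.snd_add, Prod.smul_fst, Prod.smul_snd,
      ofCoeffs_add, ofCoeffs_smul, C_pow]
    ring
  rw [h4] at h3
  refine h3.unique ?_
  have h5 := (((hasDerivAt_id (0 : ℂ)).mul_const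
    ((ofCoeffs d.1 * monicOfCoeffs p.2 + monicOfCoeffs p.1 * ofCoeffs d.2).coeff k)).const_add
      ((monicOfCoeffs p.1 * monicOfCoeffs p.2).coeff k)).fun_add
        (((hasDerivAt_id (0 : ℂ)).pow 2).mul_const ((ofCoeffs d.1 * ofCoeffs d.2).coeff k))
  simpa using h5

/-- A kernel element gives a·q + p·b = 0 with deg a < deg p. Coprimality forces p ∣ a, hence a = 0
and then b = 0. -/
lemma fderiv_mulCoeffs_injective {m n : ℕ} (p : (Fin m → ℂ) × (Fin n → ℂ))
    (hp : IsCoprime (monicOfCoeffs p.1) (monicOfCoeffs p.2)) :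
    Function.Injective (fderiv ℂ (mulCoeffs m n) p) := by
  rw [injective_iff_map_eq_zero]
  intro d hd
  have h : ofCoeffs d.1 * monicOfCoeffs p.2 + monicOfCoeffs p.1 * ofCoeffs d.2 = 0 := by
    have hdeg : (ofCoeffs d.1 * monicOfCoeffs p.2 + monicOfCoeffs p.1 * ofCoeffs d.2).degree
        < ((m + n : ℕ) : WithBot ℕ) := by
      refine (degree_add_le _ _).trans_lt (max_lt ?_ ?_)
      · rw [degree_mul, degree_eq_natDegree (monic_monicOfCoeffs p.2).ne_zero,
          natDegree_monicOfCoeffs, Nat.cast_add]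
        exact WithBot.add_lt_add_right (by simp) (degree_ofCoeffs_lt d.1)
      · rw [degree_mul, degree_eq_natDegree (monic_monicOfCoeffs p.1).ne_zero,
          natDegree_monicOfCoeffs, Nat.cast_add]
        exact WithBot.add_lt_add_left (by simp) (degree_ofCoeffs_lt d.2)
    ext k
    by_cases hk : k < m + n
    · have := fderiv_mulCoeffs m n p d ⟨k, hk⟩
      rw [hd] at this
      simpa using this.symm
    · rw [coeff_eq_zero_of_degree_lt (hdeg.trans_le (by exact_mod_cast not_lt.1 hk)), coeff_zero]
  have h1 : ofCoeffs d.1 = 0 := by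
    apply eq_zero_of_dvd_of_degree_lt (p := monicOfCoeffs p.1)
    · refine hp.dvd_of_dvd_mul_right ⟨-ofCoeffs d.2, ?_⟩
      linear_combination h
    · rw [degree_eq_natDegree (monic_monicOfCoeffs p.1).ne_zero, natDegree_monicOfCoeffs]
      exact degree_ofCoeffs_lt d.1
  have h2 : ofCoeffs d.2 = 0 := by
    rw [h1, zero_mul, zero_add] at h
    exact (mul_eq_zero.1 h).resolve_left (monic_monicOfCoeffs p.1).ne_zero
  exact Prod.ext (ofCoeffs_eq_zero h1) (ofCoeffs_eq_zero h2)

/-- A factorization into coprime monic factors extends analytically to nearby members of an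
analytic family of monic polynomials. -/
lemma exists_analytic_factorization {E : Type*} [NormedAddCommGroup E] [NormedSpace ℂ E]
    {P : E → ℂ[X]} {a : E} {g h : ℂ[X]} (hP : ∀ x, (P x).Monic)
    (hdeg : ∀ x, (P x).natDegree = g.natDegree + h.natDegree)
    (han : ∀ k, ContDiffAt ℂ ω (fun x => (P x).coeff k) a)
    (hg : g.Monic) (hh : h.Monic) (hc : IsCoprime g h) (hgh : P a = g * h) :
    ∃ G H : E → ℂ[X], G a = g ∧ H a = h ∧
      (∀ x, (G x).Monic ∧ (G x).natDegree = g.natDegree) ∧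
      (∀ x, (H x).Monic ∧ (H x).natDegree = h.natDegree) ∧
      (∀ k, ContDiffAt ℂ ω (fun x => (G x).coeff k) a) ∧
      (∀ k, ContDiffAt ℂ ω (fun x => (H x).coeff k) a) ∧
      ∀ᶠ x in 𝓝 a, P x = G x * H x := by
  set m := g.natDegree with hm
  set n := h.natDegree with hn
  set p : (Fin m → ℂ) × (Fin n → ℂ) := (fun i => g.coeff i, fun i => h.coeff i) with hp
  have hpg : monicOfCoeffs p.1 = g := monicOfCoeffs_coeff hg hm.symm
  have hph : monicOfCoeffs p.2 = h := monicOfCoeffs_coeff hh hn.symm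
  have hinj := fderiv_mulCoeffs_injective p (by rwa [hpg, hph])
  -- Source and target both have dimension m + n, so injectivity of the derivative suffices for the
  -- inverse function theorem.
  let L : ((Fin m → ℂ) × (Fin n → ℂ)) ≃L[ℂ] (Fin (m + n) → ℂ) :=
    (LinearEquiv.ofInjectiveOfFinrankEq (fderiv ℂ (mulCoeffs m n) p).toLinearMap hinj
      (by simp)).toContinuousLinearEquiv
  have hcd : ContDiffAt ℂ ω (mulCoeffs m n) p := (contDiff_mulCoeffs m n).contDiffAt
  have hd : HasFDerivAt (mulCoeffs m n) (L : _ →L[ℂ] (Fin (m + n) → ℂ)) p := by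
    have hL : (L : _ →L[ℂ] (Fin (m + n) → ℂ)) = fderiv ℂ (mulCoeffs m n) p :=
      ContinuousLinearMap.ext fun d => rfl
    rw [hL]
    exact (hcd.differentiableAt (by simp)).hasFDerivAt
  have hs := hcd.hasStrictFDerivAt' hd (by simp)
  let S := hcd.localInverse hd (by simp)
  have hS : ContDiffAt ℂ ω S (mulCoeffs m n p) := hcd.to_localInverse hd (by simp)
  have hSp : S (mulCoeffs m n p) = p := hs.localInverse_apply_image
  have hSr : ∀ᶠ y in 𝓝 (mulCoeffs m n p), mulCoeffs m n (S y) = y := hs.eventually_right_inverse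
  let c : E → Fin (m + n) → ℂ := fun x k => (P x).coeff k
  have hc1 : ContDiffAt ℂ ω c a := contDiffAt_pi.2 fun k => han k
  have hca : c a = mulCoeffs m n p := by
    funext k
    simp only [c, mulCoeffs, hpg, hph, hgh]
  have hSc : ContDiffAt ℂ ω (fun x => S (c x)) a := by
    rw [← hca] at hS
    exact hS.comp a hc1
  refine ⟨fun x => monicOfCoeffs (S (c x)).1, fun x => monicOfCoeffs (S (c x)).2, ?_, ?_,
    fun x => ⟨monic_monicOfCoeffs _, natDegree_monicOfCoeffs _⟩,
    fun x => ⟨monic_monicOfCoeffs _, natDegree_monicOfCoeffs _⟩, fun k => ?_, fun k => ?_, ?_⟩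
  · simp only [hca, hSp, hpg]
  · simp only [hca, hSp, hph]
  · exact (contDiff_coeff_monicOfCoeffs k).contDiffAt.comp a hSc.fst
  · exact (contDiff_coeff_monicOfCoeffs k).contDiffAt.comp a hSc.snd
  · have : Filter.Tendsto c (𝓝 a) (𝓝 (mulCoeffs m n p)) := hca ▸ hc1.continuousAt
    filter_upwards [this.eventually hSr] with x hx
    have hM := (monic_monicOfCoeffs (S (c x)).1).mul (monic_monicOfCoeffs (S (c x)).2)
    rw [← monicOfCoeffs_coeff (hP x) (hdeg x), ← monicOfCoeffs_coeff (m := m + n) hM (by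
      rw [(monic_monicOfCoeffs _).natDegree_mul (monic_monicOfCoeffs _),
        natDegree_monicOfCoeffs, natDegree_monicOfCoeffs])]
    congr 1
    exact hx.symm

end Polynomial

/-! ### Factors cut out by sets of roots, and their resultants -/

namespace Polynomial

open scoped Classical in
/-- The monic factor of `p` whose roots are the roots of `p` in `S`. -/
def rootFactor (p : ℂ[X]) (S : Set ℂ) : ℂ[X] :=
  ((p.roots.filter (· ∈ S)).map fun r => X - C r).prod

lemma monic_rootFactor (p : ℂ[X]) (S : Set ℂ) : (rootFactor p S).Monic :=
  monic_multiset_prod_of_monic _ _ fun r _ => monic_X_sub_C r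

open scoped Classical in
lemma roots_rootFactor (p : ℂ[X]) (S : Set ℂ) :
    (rootFactor p S).roots = p.roots.filter (· ∈ S) :=
  roots_multiset_prod_X_sub_C _

lemma isRoot_rootFactor {p : ℂ[X]} (hp : p ≠ 0) (S : Set ℂ) (r : ℂ) :
    (rootFactor p S).IsRoot r ↔ p.IsRoot r ∧ r ∈ S := by
  classical
  rw [← mem_roots (monic_rootFactor p S).ne_zero, roots_rootFactor, Multiset.mem_filter,
    mem_roots hp]

lemma rootFactor_mul_rootFactor_compl {p : ℂ[X]} (hp : p.Monic) (S : Set ℂ) :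
    rootFactor p S * rootFactor p Sᶜ = p := by
  classical
  conv_rhs => rw [(IsAlgClosed.splits p).eq_prod_roots_of_monic hp,
    ← Multiset.filter_add_not (· ∈ S) p.roots, Multiset.map_add, Multiset.prod_add]
  simp only [rootFactor, Set.mem_compl_iff]

lemma isCoprime_rootFactor_compl {p : ℂ[X]} (hp : p ≠ 0) (S : Set ℂ) :
    IsCoprime (rootFactor p S) (rootFactor p Sᶜ) := by
  rw [isCoprime_iff_aeval_ne_zero_of_isAlgClosed ℂ ℂ]
  intro a
  simp only [coe_aeval_eq_eval]
  by_contra! h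
  exact ((isRoot_rootFactor hp Sᶜ a).1 h.2).2 ((isRoot_rootFactor hp S a).1 h.1).2

/-- Serves to recognise the analytic factors supplied by the inverse function theorem as the factors
cut out by `S`. -/
lemma rootFactor_mul_eq_left {g h : ℂ[X]} (hg : g.Monic) (hh : h.Monic) {S : Set ℂ}
    (hgS : ∀ r, g.IsRoot r → r ∈ S) (hhS : ∀ r, h.IsRoot r → r ∉ S) :
    rootFactor (g * h) S = g := by
  classical
  rw [rootFactor, roots_mul (hg.mul hh).ne_zero, Multiset.filter_add,
    Multiset.filter_eq_self.2, Multiset.filter_eq_nil.2, add_zero]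
  · exact ((IsAlgClosed.splits g).eq_prod_roots_of_monic hg).symm
  · exact fun r hr => hhS r ((mem_roots hh.ne_zero).1 hr)
  · exact fun r hr => hgS r ((mem_roots hg.ne_zero).1 hr)

lemma rootFactor_of_roots_map {p q : ℂ[X]} {c : ℂ} (h : p.roots = q.roots.map (c * ·))
    {S T : Set ℂ} (hST : ∀ r, c * r ∈ S ↔ r ∈ T) :
    (rootFactor p S).roots = (rootFactor q T).roots.map (c * ·) := by
  classical
  rw [roots_rootFactor, roots_rootFactor, h, Multiset.filter_map]
  simp [hST]

/-- For monic polynomials the resultant is the product of all differences of roots, and each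
difference is scaled by `c`. This makes the resultant of the two factors homogeneous. -/
lemma resultant_smul_roots {f g f' g' : ℂ[X]} (hf : f.Monic) (hg : g.Monic) (hf' : f'.Monic)
    (hg' : g'.Monic) {c : ℂ} (h : f.roots = f'.roots.map (c * ·))
    (h' : g.roots = g'.roots.map (c * ·)) :
    resultant f g = c ^ (f'.natDegree * g'.natDegree) * resultant f' g' := by
  have key : ∀ s t : Multiset ℂ,
      ((s.map (c * ·) ×ˢ t.map (c * ·)).map fun ij => ij.1 - ij.2) =
        (s ×ˢ t).map fun ij => c * (ij.1 - ij.2) := by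
    intro s t
    induction s using Multiset.induction_on with
    | empty => simp
    | cons a s ih =>
      simp only [Multiset.map_cons, Multiset.cons_product, Multiset.map_add, ih, Multiset.map_map,
        Function.comp_def, mul_sub]
  rw [resultant_eq_prod_roots_sub f g hf hg (IsAlgClosed.splits f) (IsAlgClosed.splits g),
    resultant_eq_prod_roots_sub f' g' hf' hg' (IsAlgClosed.splits f') (IsAlgClosed.splits g'), h,
    h', key, Multiset.prod_map_mul, Multiset.map_const', Multiset.prod_replicate,
    Multiset.card_product, (IsAlgClosed.splits f').natDegree_eq_card_roots,
    (IsAlgClosed.splits g').natDegree_eq_card_roots]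

lemma continuousAt_eval {E : Type*} [TopologicalSpace E] {P : E → ℂ[X]} {d : ℕ} (hd : ∀ x, (P x).natDegree = d) {a : E}
    (han : ∀ k, ContinuousAt (fun x => (P x).coeff k) a) (r : ℂ) :
    ContinuousAt (fun p : E × ℂ => (P p.1).eval p.2) (a, r) := by
  have : (fun p : E × ℂ => (P p.1).eval p.2) =
      fun p => ∑ k ∈ Finset.range (d + 1), (P p.1).coeff k * p.2 ^ k := by
    funext p
    rw [eval_eq_sum_range, hd]
  rw [this]
  refine tendsto_finsetSum _ fun k _ => ?_
  have h1 : ContinuousAt (fun p : E × ℂ => (P p.1).coeff k) (a, r) :=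
    ContinuousAt.comp (f := Prod.fst) (x := (a, r)) (han k) continuousAt_fst
  exact h1.mul (continuousAt_snd.pow k)

/-- Cauchy's bound involves only the coefficients, which are locally bounded. Confining the roots
over a neighbourhood to one compact disc allows statements near each root to be made uniform. -/
lemma eventually_norm_root_le {E : Type*} [TopologicalSpace E] {P : E → ℂ[X]} {d : ℕ} (hP : ∀ x, (P x).Monic)
    (hd : ∀ x, (P x).natDegree = d) {a : E}
    (han : ∀ k, ContinuousAt (fun x => (P x).coeff k) a) :
    ∃ c, ∀ᶠ x in 𝓝 a, ∀ r, (P x).IsRoot r → ‖r‖ ≤ c := by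
  have h1 : ∀ k, ∀ᶠ x in 𝓝 a, ‖(P x).coeff k‖₊ ≤ ‖(P a).coeff k‖₊ + 1 := fun k =>
    ((han k).nnnorm.eventually_lt continuousAt_const (lt_add_one _)).mono fun x hx => hx.le
  refine ⟨((Finset.range d).sup (fun k => ‖(P a).coeff k‖₊ + 1) + 1 : NNReal), ?_⟩
  have h2 : ∀ᶠ x in 𝓝 a, ∀ k ∈ Finset.range d, ‖(P x).coeff k‖₊ ≤ ‖(P a).coeff k‖₊ + 1 :=
    (Filter.eventually_all_finset _).2 fun k _ => h1 k
  filter_upwards [h2] with x hx r hr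
  have h3 := (hr.norm_lt_cauchyBound (hP x).ne_zero).le
  have h4 : (P x).cauchyBound ≤ (Finset.range d).sup (fun k => ‖(P a).coeff k‖₊ + 1) + 1 := by
    rw [cauchyBound, (hP x).leadingCoeff, nnnorm_one, div_one, hd]
    exact add_le_add_left (Finset.sup_mono_fun hx) 1
  exact_mod_cast h3.trans h4

section Family

variable {E : Type*} [NormedAddCommGroup E] [NormedSpace ℂ E]

/-- If the set `A` is locally constant along the zero set of the family `P`, then the factors of
`P` cut out by `A` and its complement are analytic. -/
lemma rootFactor_eventually_analytic {P : E → ℂ[X]} {d : ℕ} (hP : ∀ x, (P x).Monic)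
    (hd : ∀ x, (P x).natDegree = d) {a : E}
    (han : ∀ k, ContDiffAt ℂ ω (fun x => (P x).coeff k) a) {A : Set (E × ℂ)}
    (hA : ∀ r, (P a).IsRoot r →
      ∀ᶠ p in 𝓝 (a, r), (P p.1).IsRoot p.2 → (p ∈ A ↔ (a, r) ∈ A)) :
    ∃ G H : E → ℂ[X],
      (∀ k, ContDiffAt ℂ ω (fun x => (G x).coeff k) a) ∧
      (∀ k, ContDiffAt ℂ ω (fun x => (H x).coeff k) a) ∧
      (∀ x, (G x).natDegree = (G a).natDegree) ∧ (∀ x, (H x).natDegree = (H a).natDegree) ∧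
      (∀ᶠ x in 𝓝 a, rootFactor (P x) (Prod.mk x ⁻¹' A) = G x) ∧
      ∀ᶠ x in 𝓝 a, rootFactor (P x) (Prod.mk x ⁻¹' A)ᶜ = H x := by
  set g := rootFactor (P a) (Prod.mk a ⁻¹' A) with hg
  set h := rootFactor (P a) (Prod.mk a ⁻¹' A)ᶜ with hh
  have hgm : g.Monic := monic_rootFactor _ _
  have hhm : h.Monic := monic_rootFactor _ _
  have hgh : g * h = P a := rootFactor_mul_rootFactor_compl (hP a) _
  obtain ⟨G, H, hGa, hHa, hG, hH, hGan, hHan, hGH⟩ := exists_analytic_factorization hP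
    (fun x => by rw [hd, ← hgm.natDegree_mul hhm, hgh, hd]) han hgm hhm
    (isCoprime_rootFactor_compl (hP a).ne_zero _) hgh.symm
  obtain ⟨c, hc⟩ := eventually_norm_root_le hP hd fun k => (han k).continuousAt
  -- Compactness argument: near a root of `Q a` the hypothesis on `S` applies, near any other point
  -- `Q x` stays nonzero, and finitely many such neighbourhoods cover the disc containing all roots.
  have main : ∀ (Q : E → ℂ[X]) (e : ℕ) (S : Set (E × ℂ)), (∀ x, (Q x).natDegree = e) →
      (∀ k, ContDiffAt ℂ ω (fun x => (Q x).coeff k) a) →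
      (∀ r, (P a).IsRoot r → ∀ᶠ p in 𝓝 (a, r), (P p.1).IsRoot p.2 → (p ∈ S ↔ (a, r) ∈ S)) →
      (∀ r, (Q a).IsRoot r → (P a).IsRoot r ∧ (a, r) ∈ S) →
      ∀ᶠ x in 𝓝 a, (Q x ∣ P x) → ∀ r, (Q x).IsRoot r → (x, r) ∈ S := by
    intro Q e S hQ hQan hS hQS
    have h1 : ∀ᶠ x in 𝓝 a, ∀ r ∈ Metric.closedBall (0 : ℂ) c,
        (Q x).IsRoot r → (P x).IsRoot r → (x, r) ∈ S := by
      refine (isCompact_closedBall (0 : ℂ) c).eventually_forall_of_forall_eventually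
        (P := fun x r => (Q x).IsRoot r → (P x).IsRoot r → (x, r) ∈ S) fun r _ => ?_
      by_cases hr : (Q a).IsRoot r
      · filter_upwards [hS r (hQS r hr).1] with p hp _ hPp
        exact (hp hPp).2 (hQS r hr).2
      · filter_upwards [(continuousAt_eval hQ (fun k => (hQan k).continuousAt) r).eventually_ne hr]
          with p hp hQp
        exact absurd hQp hp
    filter_upwards [h1, hc] with x hx hcx hdvd r hr
    have hPr : (P x).IsRoot r := hr.dvd hdvd
    exact hx r (by simpa using hcx r hPr) hr hPr
  have hG1 := main G g.natDegree A (fun x => (hG x).2) hGan hA fun r hr =>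
    (isRoot_rootFactor (hP a).ne_zero _ r).1 (hGa ▸ hr)
  have hH1 := main H h.natDegree Aᶜ (fun x => (hH x).2) hHan
    (fun r hr => (hA r hr).mono fun p hp hpr => not_congr (hp hpr)) fun r hr =>
    (isRoot_rootFactor (hP a).ne_zero _ r).1 (hHa ▸ hr)
  refine ⟨G, H, hGan, hHan, fun x => by rw [(hG x).2, hGa], fun x => by rw [(hH x).2, hHa], ?_, ?_⟩
  · filter_upwards [hG1, hH1, hGH] with x h1 h2 h3
    rw [h3]
    exact rootFactor_mul_eq_left (hG x).1 (hH x).1 (h1 ⟨_, h3⟩)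
      (h2 ⟨_, h3.trans (mul_comm _ _)⟩)
  · filter_upwards [hG1, hH1, hGH] with x h1 h2 h3
    rw [h3, mul_comm]
    exact rootFactor_mul_eq_left (hH x).1 (hG x).1 (h2 ⟨_, h3.trans (mul_comm _ _)⟩)
      (fun r hr => not_not.2 (h1 ⟨_, h3⟩ r hr))

/-- With the sizes `m` and `n` prescribed, the resultant is the determinant of a matrix whose
entries are coefficients or zero, whatever the actual degrees are. -/
lemma contDiffAt_resultant {G H : E → ℂ[X]} {a : E}
    (hG : ∀ k, ContDiffAt ℂ ω (fun x => (G x).coeff k) a)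
    (hH : ∀ k, ContDiffAt ℂ ω (fun x => (H x).coeff k) a) (m n : ℕ) :
    ContDiffAt ℂ ω (fun x => resultant (G x) (H x) m n) a := by
  have hs : ∀ i j, ContDiffAt ℂ ω (fun x => sylvester (G x) (H x) m n i j) a := by
    intro i j
    simp only [sylvester, Matrix.of_apply]
    refine Fin.addCases (fun j => ?_) (fun j => ?_) j
    · simp only [Fin.addCases_left]
      split_ifs
      · exact hH _
      · exact contDiffAt_const
    · simp only [Fin.addCases_right]
      split_ifs
      · exact hG _
      · exact contDiffAt_const
  simp only [resultant, Matrix.det_apply]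
  exact ContDiffAt.sum fun σ _ => (contDiffAt_prod fun i _ => hs _ _).const_smul _

end Family

end Polynomial

/-! ### Homogeneous families over the punctured plane do not split -/

namespace Polynomial

/-- The zero set of a homogeneous family of monic polynomials over `ℂ² - {0}` cannot be split
into two disjoint clopen cones. -/
lemma mem_cone_of_homogeneous_family {P : ℂ × ℂ → ℂ[X]} {d : ℕ} (hP : ∀ x, (P x).Monic)
    (hd : ∀ x, (P x).natDegree = d)
    (han : ∀ k, ContDiff ℂ ω (fun x => (P x).coeff k))
    (hhom : ∀ (c : ℂ), c ≠ 0 → ∀ a, (P (c • a)).roots = (P a).roots.map (c * ·))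
    {A : Set ((ℂ × ℂ) × ℂ)} (hAc : ∀ (c : ℂ), c ≠ 0 → ∀ p, c • p ∈ A ↔ p ∈ A)
    (hA : ∀ a, a ≠ 0 → ∀ r, (P a).IsRoot r →
      ∀ᶠ p in 𝓝 (a, r), (P p.1).IsRoot p.2 → (p ∈ A ↔ (a, r) ∈ A))
    {a a' : ℂ × ℂ} (ha : a ≠ 0) (ha' : a' ≠ 0) {r r' : ℂ} (hr : (P a).IsRoot r)
    (hr' : (P a').IsRoot r') (hrA : (a, r) ∈ A) : (a', r') ∈ A := by
  by_contra hrA'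
  set gA : ℂ × ℂ → ℂ[X] := fun x => rootFactor (P x) (Prod.mk x ⁻¹' A) with hgA
  set gB : ℂ × ℂ → ℂ[X] := fun x => rootFactor (P x) (Prod.mk x ⁻¹' A)ᶜ with hgB
  have loc := fun (x : ℂ × ℂ) (hx : x ≠ 0) =>
    rootFactor_eventually_analytic hP hd (fun k => (han k).contDiffAt) (hA x hx)
  -- The degrees of the two factors are locally constant, hence constant on ℂ² − {0}.
  have hconn : IsPreconnected ({0}ᶜ : Set (ℂ × ℂ)) := by
    refine (isConnected_compl_singleton_of_one_lt_rank ?_ 0).isPreconnected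
    rw [rank_prod', Complex.rank_real_complex]
    norm_num
  have hmA : ∀ x : ℂ × ℂ, x ≠ 0 → ∀ y : ℂ × ℂ, y ≠ 0 → (gA x).natDegree = (gA y).natDegree := by
    intro x hx y hy
    refine hconn.constant (f := fun x => (gA x).natDegree) (fun z hz => ?_) hx hy
    obtain ⟨G, H, -, -, hG, -, hGe, -⟩ := loc z hz
    refine ContinuousAt.continuousWithinAt ((continuousAt_const (y := (G z).natDegree)).congr ?_)
    filter_upwards [hGe] with w hw
    simp only [hgA, hw, hG w]
  have hmB : ∀ x : ℂ × ℂ, x ≠ 0 → ∀ y : ℂ × ℂ, y ≠ 0 → (gB x).natDegree = (gB y).natDegree := by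
    intro x hx y hy
    refine hconn.constant (f := fun x => (gB x).natDegree) (fun z hz => ?_) hx hy
    obtain ⟨G, H, -, -, -, hH, -, hHe⟩ := loc z hz
    refine ContinuousAt.continuousWithinAt ((continuousAt_const (y := (H z).natDegree)).congr ?_)
    filter_upwards [hHe] with w hw
    simp only [hgB, hw, hH w]
  -- Both factors have positive degree, since `r` is a root of one and `r'` of the other; hence the
  -- resultant has positive degree of homogeneity `m * n`.
  have hm : (gA a).natDegree ≠ 0 := by
    intro h0
    have h1 := (monic_rootFactor (P a) (Prod.mk a ⁻¹' A)).natDegree_eq_zero.1 h0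
    have h2 := (isRoot_rootFactor (hP a).ne_zero (Prod.mk a ⁻¹' A) r).2 ⟨hr, hrA⟩
    rw [h1] at h2
    simp at h2
  have hn : (gB a).natDegree ≠ 0 := by
    rw [hmB a ha a' ha']
    intro h0
    have h1 := (monic_rootFactor (P a') (Prod.mk a' ⁻¹' A)ᶜ).natDegree_eq_zero.1 h0
    have h2 := (isRoot_rootFactor (hP a').ne_zero (Prod.mk a' ⁻¹' A)ᶜ r').2 ⟨hr', hrA'⟩
    rw [h1] at h2
    simp at h2
  set m := (gA a).natDegree
  set n := (gB a).natDegree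
  set R : ℂ × ℂ → ℂ := fun x => resultant (gA x) (gB x) with hR
  have hR0 : ∀ x, R x ≠ 0 := fun x =>
    resultant_ne_zero _ _ (isCoprime_rootFactor_compl (hP x).ne_zero _)
  have hRd : ∀ x, x ≠ 0 → DifferentiableAt ℂ R x := by
    intro x hx
    obtain ⟨G, H, hG, hH, hGd, hHd, hGe, hHe⟩ := loc x hx
    have h1 := (contDiffAt_resultant hG hH (G x).natDegree (H x).natDegree).differentiableAt
      (by simp)
    refine h1.congr_of_eventuallyEq ?_
    filter_upwards [hGe, hHe] with y hy1 hy2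
    have e1 : gA y = G y := hy1
    have e2 : gB y = H y := hy2
    change resultant (gA y) (gB y) = _
    rw [e1, e2, hGd y, hHd y]
  have hRs : ∀ c : ℂ, c ≠ 0 → ∀ x : ℂ × ℂ, x ≠ 0 → R (c • x) = c ^ (m * n) * R x := by
    intro c hc x hx
    simp only [hR]
    rw [show m = (gA x).natDegree from hmA a ha x hx, show n = (gB x).natDegree from hmB a ha x hx]
    have hST : ∀ r, c * r ∈ Prod.mk (c • x) ⁻¹' A ↔ r ∈ Prod.mk x ⁻¹' A := fun r =>
      hAc c hc (x, r)
    exact resultant_smul_roots (monic_rootFactor _ _) (monic_rootFactor _ _)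
      (monic_rootFactor _ _) (monic_rootFactor _ _)
      (rootFactor_of_roots_map (hhom c hc x) hST)
      (rootFactor_of_roots_map (hhom c hc x) fun r => not_congr (hST r))
  -- The line (1, y) avoids the origin, where analyticity of `R` is not available.
  have hfd : Differentiable ℂ (fun y : ℂ => (R (1, y))⁻¹) := by
    intro y
    refine DifferentiableAt.inv ?_ (hR0 _)
    exact DifferentiableAt.comp (g := R) y (hRd (1, y) (by simp)) (by fun_prop)
  -- By homogeneity R(1, y) = y^(mn) · R(1/y, 1), and R(1/y, 1) tends to R(0, 1) ≠ 0.
  have hlim : Filter.Tendsto (fun y : ℂ => (R (1, y))⁻¹) (Filter.cocompact ℂ) (𝓝 0) := by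
    have h1 : Filter.Tendsto (fun y : ℂ => y⁻¹) (Filter.cocompact ℂ) (𝓝 0) := by
      rw [← Metric.cobounded_eq_cocompact]
      exact Filter.tendsto_inv₀_cobounded
    have h2 : Filter.Tendsto (fun y : ℂ => (R (y⁻¹, 1))⁻¹) (Filter.cocompact ℂ)
        (𝓝 (R (0, 1))⁻¹) := by
      refine Filter.Tendsto.inv₀ ?_ (hR0 _)
      exact (hRd (0, 1) (by simp)).continuousAt.tendsto.comp
        (h1.prodMk_nhds tendsto_const_nhds)
    have h3 := (h1.pow (m * n)).mul h2
    rw [zero_pow (mul_ne_zero hm hn), zero_mul] at h3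
    refine h3.congr' ?_
    have : ∀ᶠ y in Filter.cocompact ℂ, y ≠ (0 : ℂ) :=
      (isCompact_singleton (x := (0 : ℂ))).compl_mem_cocompact
    filter_upwards [this] with y hy
    have h4 := hRs y hy (y⁻¹, 1) (by simp)
    rw [Prod.smul_mk, smul_eq_mul, smul_eq_mul, mul_inv_cancel₀ hy, mul_one] at h4
    rw [h4, mul_inv, inv_pow]
  -- Liouville's theorem: an entire function with limit 0 at infinity is zero.
  have := hfd.apply_eq_of_tendsto_cocompact 0 hlim
  exact inv_ne_zero (hR0 _) this

end Polynomial

/-! ### Plane projective curves as homogeneous families of monic polynomials -/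

namespace MvPolynomial

/-- The restriction of `F` to the line through `T (a, 0)` in the direction `T (0, 1)`. -/
def linePoly (F : MvPolynomial (Fin 3) ℂ) (T : ((ℂ × ℂ) × ℂ) ≃ₗ[ℂ] (Fin 3 → ℂ)) (a : ℂ × ℂ) :
    Polynomial ℂ :=
  aeval (fun i => Polynomial.C (T (a, 0) i) + Polynomial.X * Polynomial.C (T (0, 1) i)) F

variable {F : MvPolynomial (Fin 3) ℂ} {T : ((ℂ × ℂ) × ℂ) ≃ₗ[ℂ] (Fin 3 → ℂ)} {d : ℕ}

lemma eval_linePoly (F : MvPolynomial (Fin 3) ℂ) (T : ((ℂ × ℂ) × ℂ) ≃ₗ[ℂ] (Fin 3 → ℂ))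
    (a : ℂ × ℂ) (r : ℂ) : (linePoly F T a).eval r = eval (T (a, r)) F := by
  have h : ∀ i, T (a, r) i = T (a, 0) i + r * T (0, 1) i := by
    intro i
    have : ((a, r) : (ℂ × ℂ) × ℂ) = (a, 0) + r • (0, 1) := by simp
    rw [this, map_add, map_smul]
    rfl
  rw [linePoly, ← Polynomial.coe_evalRingHom, ← coe_aeval_eq_eval]
  have := comp_aeval_apply (φ := Polynomial.aeval (R := ℂ) r)
    (fun i => Polynomial.C (T (a, 0) i) + Polynomial.X * Polynomial.C (T (0, 1) i)) F
  rw [Polynomial.coe_evalRingHom, ← Polynomial.coe_aeval_eq_eval, this]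
  simp only [map_add, map_mul, Polynomial.aeval_C, Polynomial.aeval_X, ← h,
    Algebra.algebraMap_self_apply]
  rfl

lemma contDiff_coeff_linePoly (F : MvPolynomial (Fin 3) ℂ)
    (T : ((ℂ × ℂ) × ℂ) ≃ₗ[ℂ] (Fin 3 → ℂ)) (k : ℕ) :
    ContDiff ℂ ω (fun a => (linePoly F T a).coeff k) := by
  refine contDiff_iff_contDiffAt.2 fun a => ?_
  induction F using MvPolynomial.induction_on generalizing k with
  | C c =>
    simp only [linePoly, algHom_C, Polynomial.algebraMap_eq]
    exact contDiffAt_const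
  | add p q hp hq =>
    simp only [linePoly, map_add, Polynomial.coeff_add] at hp hq ⊢
    exact (hp k).add (hq k)
  | mul_X p i hp =>
    simp only [linePoly, map_mul] at hp ⊢
    refine Polynomial.contDiffAt_coeff_mul hp (fun k => ?_) k
    simp only [aeval_X, Polynomial.coeff_add, Polynomial.coeff_C]
    refine ContDiffAt.add ?_ contDiffAt_const
    split_ifs
    · have h : ContDiff ℂ ω (fun a : ℂ × ℂ => T (a, 0)) :=
        T.toContinuousLinearEquiv.contDiff.comp (contDiff_id.prodMk contDiff_const)
      exact (contDiff_pi.1 h i).contDiffAt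
    · exact contDiffAt_const

/-- Every variable is replaced by a polynomial of degree at most 1 whose linear coefficient is a
coordinate of the direction. In a monomial of degree `d` the coefficient of degree `d` is therefore
the monomial evaluated at that direction. -/
lemma linePoly_degree (hF : F.IsHomogeneous d) (a : ℂ × ℂ) :
    (linePoly F T a).natDegree ≤ d ∧ (linePoly F T a).coeff d = eval (T (0, 1)) F := by
  set L : Fin 3 → Polynomial ℂ := fun i =>
    Polynomial.C (T (a, 0) i) + Polynomial.X * Polynomial.C (T (0, 1) i) with hL
  have hL1 : ∀ i, (L i).natDegree ≤ 1 := by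
    intro i
    refine Polynomial.natDegree_add_le_of_degree_le (by simp) ?_
    exact Polynomial.natDegree_mul_le_of_le (m := 1) (n := 0) Polynomial.natDegree_X_le (by simp)
  have hL2 : ∀ i, (L i).coeff 1 = T (0, 1) i := by
    intro i
    simp [hL, Polynomial.coeff_C]
  have hpow : ∀ i (k : ℕ), (L i ^ k).natDegree ≤ k ∧ (L i ^ k).coeff k = T (0, 1) i ^ k := by
    intro i k
    refine ⟨by simpa using Polynomial.natDegree_pow_le_of_le k (hL1 i), ?_⟩
    have := Polynomial.coeff_pow_of_natDegree_le (m := k) (hL1 i)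
    rwa [mul_one, hL2] at this
  have hprod : ∀ s : Fin 3 →₀ ℕ, (∏ i, L i ^ s i).natDegree ≤ ∑ i, s i ∧
      (∏ i, L i ^ s i).coeff (∑ i, s i) = ∏ i, T (0, 1) i ^ s i := by
    intro s
    simp only [Fin.prod_univ_three, Fin.sum_univ_three]
    have h01 : (L 0 ^ s 0 * L 1 ^ s 1).natDegree ≤ s 0 + s 1 :=
      Polynomial.natDegree_mul_le_of_le (hpow 0 _).1 (hpow 1 _).1
    refine ⟨Polynomial.natDegree_mul_le_of_le h01 (hpow 2 _).1, ?_⟩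
    rw [Polynomial.coeff_mul_add_eq_of_natDegree_le h01 (hpow 2 _).1,
      Polynomial.coeff_mul_add_eq_of_natDegree_le (hpow 0 _).1 (hpow 1 _).1, (hpow 0 _).2,
      (hpow 1 _).2, (hpow 2 _).2]
  have hdeg : ∀ s ∈ F.support, ∑ i, s i = d := by
    intro s hs
    have := hF (mem_support_iff.1 hs)
    rw [Finsupp.weight_apply, Finsupp.sum_fintype _ _ (by simp)] at this
    simpa using this
  have hsum : linePoly F T a = ∑ s ∈ F.support, Polynomial.C (coeff s F) * ∏ i, L i ^ s i := by
    rw [linePoly, aeval_def, eval₂_eq']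
    rfl
  rw [hsum]
  constructor
  · refine Polynomial.natDegree_sum_le_of_forall_le _ _ fun s hs => ?_
    refine (Polynomial.natDegree_C_mul_le _ _).trans ?_
    rw [← hdeg s hs]
    exact (hprod s).1
  · rw [Polynomial.finsetSum_coeff, eval_eq']
    refine Finset.sum_congr rfl fun s hs => ?_
    rw [Polynomial.coeff_C_mul, ← hdeg s hs, (hprod s).2]

lemma IsHomogeneous.eval_smul (hF : F.IsHomogeneous d) (c : ℂ) (x : Fin 3 → ℂ) :
    eval (c • x) F = c ^ d * eval x F := by
  rw [eval_eq', eval_eq', Finset.mul_sum]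
  refine Finset.sum_congr rfl fun s hs => ?_
  have := hF (mem_support_iff.1 hs)
  rw [Finsupp.weight_apply, Finsupp.sum_fintype _ _ (by simp)] at this
  have h : ∑ i, s i = d := by simpa using this
  simp only [Pi.smul_apply, smul_eq_mul, mul_pow, Finset.prod_mul_distrib,
    Finset.prod_pow_eq_pow_sum, h]
  ring

/-- The punctured cone over a plane projective curve cannot be split into two disjoint clopen
cones. -/
lemma IsHomogeneous.mem_cone (hF : F.IsHomogeneous d) (hF0 : F ≠ 0) (h00 : eval 0 F = 0)
    {A : Set (Fin 3 → ℂ)}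
    (hAc : ∀ (c : ℂ), c ≠ 0 → ∀ x, c • x ∈ A ↔ x ∈ A)
    (hA : ∀ x, x ≠ 0 → eval x F = 0 → ∀ᶠ y in 𝓝 x, eval y F = 0 → (y ∈ A ↔ x ∈ A))
    {x y : Fin 3 → ℂ} (hx : x ≠ 0) (hy : y ≠ 0) (hxF : eval x F = 0) (hyF : eval y F = 0)
    (hxA : x ∈ A) : y ∈ A := by
  obtain ⟨v, hv⟩ : ∃ v, eval v F ≠ 0 := by
    by_contra! h
    exact hF0 (MvPolynomial.funext fun x => by rw [h x, map_zero])
  wlog hv1 : eval v F = 1 generalizing F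
  · refine this (F := C (eval v F)⁻¹ * F) ?_ ?_ ?_ ?_ ?_ ?_ ?_ ?_
    · simpa using (isHomogeneous_C (Fin 3) ((eval v F)⁻¹)).mul hF
    · exact mul_ne_zero (by simpa using hv) hF0
    · rw [map_mul, h00, mul_zero]
    · intro x hx hxF
      simp only [map_mul, eval_C, mul_eq_zero, inv_eq_zero, hv, false_or] at hxF ⊢
      exact hA x hx hxF
    · simp [hxF]
    · simp [hyF]
    · simpa using hv
    · simp [hv]
  have hv0 : v ≠ 0 := by
    rintro rfl
    exact hv h00
  -- The last coordinate axis is placed along a vector off the curve, which makes `F` monic of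
  -- degree `d` in that coordinate.
  obtain ⟨T, hT⟩ : ∃ T : ((ℂ × ℂ) × ℂ) ≃ₗ[ℂ] (Fin 3 → ℂ), T (0, 1) = v := by
    let T₀ : ((ℂ × ℂ) × ℂ) ≃ₗ[ℂ] (Fin 3 → ℂ) := LinearEquiv.ofFinrankEq _ _ (by simp)
    have : T₀ (0, 1) ≠ 0 := by simp
    obtain ⟨S, hS⟩ := SeparatingDual.exists_continuousLinearEquiv_apply_eq (R := ℂ) this hv0
    exact ⟨T₀.trans S.toLinearEquiv, hS⟩
  have hdg := fun a => linePoly_degree (T := T) hF a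
  simp only [hT, hv1] at hdg
  have hP : ∀ a, (linePoly F T a).Monic := fun a =>
    Polynomial.monic_of_natDegree_le_of_coeff_eq_one d (hdg a).1 (hdg a).2
  have hd : ∀ a, (linePoly F T a).natDegree = d := fun a =>
    Polynomial.natDegree_eq_of_le_of_coeff_ne_zero (hdg a).1 (by simp [(hdg a).2])
  have hroot : ∀ a r, (linePoly F T a).IsRoot r ↔ eval (T (a, r)) F = 0 := fun a r => by
    rw [Polynomial.IsRoot, eval_linePoly]
  have hhom : ∀ (c : ℂ), c ≠ 0 → ∀ a,
      (linePoly F T (c • a)).roots = (linePoly F T a).roots.map (c * ·) := by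
    intro c hc a
    have h1 : linePoly F T (c • a) =
        (((linePoly F T a).roots.map (c * ·)).map fun r => Polynomial.X - Polynomial.C r).prod := by
      refine Polynomial.funext fun r => ?_
      have h2 : ((c • a, r) : (ℂ × ℂ) × ℂ) = c • (a, c⁻¹ * r) := by
        simp [mul_inv_cancel_left₀ hc]
      have h3 : (linePoly F T a).eval (c⁻¹ * r) =
          ((linePoly F T a).roots.map fun s => c⁻¹ * r - s).prod := by
        conv_lhs => rw [(IsAlgClosed.splits (linePoly F T a)).eq_prod_roots_of_monic (hP a),
          Polynomial.eval_multiset_prod]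
        simp
      rw [eval_linePoly, h2, map_smul, hF.eval_smul, ← eval_linePoly, h3,
        Polynomial.eval_multiset_prod, ← hd a,
        (IsAlgClosed.splits (linePoly F T a)).natDegree_eq_card_roots, ← Multiset.prod_replicate,
        ← Multiset.map_const', ← Multiset.prod_map_mul]
      simp [mul_sub, mul_inv_cancel_left₀ hc]
    rw [h1, Polynomial.roots_multiset_prod_X_sub_C]
  -- Projection from the point [v] is defined on the whole curve, because `F` does not vanish on the
  -- punctured axis through `v`.
  have hTne : ∀ {z : Fin 3 → ℂ}, z ≠ 0 → eval z F = 0 → (T.symm z).1 ≠ 0 := by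
    intro z hz hzF h0
    have h1 : T.symm z = (T.symm z).2 • ((0, 1) : (ℂ × ℂ) × ℂ) := by
      ext <;> simp [h0]
    have h2 : z = (T.symm z).2 • v := by
      rw [← hT, ← map_smul, ← h1, LinearEquiv.apply_symm_apply]
    have h3 : (T.symm z).2 ≠ 0 := fun h => hz (by rw [h2, h, zero_smul])
    rw [h2, hF.eval_smul, hv1, mul_one] at hzF
    exact pow_ne_zero d h3 hzF
  have hTc : Continuous T := T.toContinuousLinearEquiv.continuous
  have key := Polynomial.mem_cone_of_homogeneous_family hP hd (contDiff_coeff_linePoly F T) hhom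
    (A := T ⁻¹' A) (fun c hc p => by rw [mem_preimage, map_smul, hAc c hc]; rfl)
    (fun a ha r hr => by
      have h0 : T (a, r) ≠ 0 := by
        simp [ha]
      have := hTc.continuousAt.eventually (hA (T (a, r)) h0 ((hroot a r).1 hr))
      filter_upwards [this] with p hp hpr
      exact hp ((hroot _ _).1 hpr))
    (a := (T.symm x).1) (a' := (T.symm y).1) (r := (T.symm x).2) (r' := (T.symm y).2)
    (hTne hx hxF) (hTne hy hyF) ((hroot _ _).2 (by simpa using hxF))
    ((hroot _ _).2 (by simpa using hyF)) (by simpa using hxA)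
  simpa using key

end MvPolynomial

namespace WeightedSurface

/-! ### The weighted action and the topology of the orbit space -/

section Action

variable (w : Fin 3 → ℕ+) {X : Set (Fin 3 → ℂ)}

/-- A set is conical if it is stable under the weighted action. -/
def IsConical (w : Fin 3 → ℕ+) (X : Set (Fin 3 → ℂ)) : Prop :=
  ∀ (t : ℂˣ) (x : Fin 3 → ℂ), x ∈ X → weightedAction w t x ∈ X

lemma weightedAction_mul (s t : ℂˣ) (x : Fin 3 → ℂ) :
    weightedAction w s (weightedAction w t x) = weightedAction w (s * t) x := by
  funext i
  simp [weightedAction, mul_pow, mul_assoc]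

lemma weightedAction_one (x : Fin 3 → ℂ) : weightedAction w 1 x = x := by
  funext i
  simp [weightedAction]

lemma weightedAction_inv_self (t : ℂˣ) (x : Fin 3 → ℂ) :
    weightedAction w t⁻¹ (weightedAction w t x) = x := by
  rw [weightedAction_mul, inv_mul_cancel, weightedAction_one]

lemma weightedAction_self_inv (t : ℂˣ) (x : Fin 3 → ℂ) :
    weightedAction w t (weightedAction w t⁻¹ x) = x := by
  rw [weightedAction_mul, mul_inv_cancel, weightedAction_one]

lemma weightedAction_apply_eq_zero (t : ℂˣ) (x : Fin 3 → ℂ) (i : Fin 3) :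
    weightedAction w t x i = 0 ↔ x i = 0 := by
  simp [weightedAction]

lemma weightedAction_ne_zero (t : ℂˣ) {x : Fin 3 → ℂ} (hx : x ≠ 0) :
    weightedAction w t x ≠ 0 := by
  intro h
  apply hx
  funext i
  exact (weightedAction_apply_eq_zero w t x i).1 (congrFun h i)

lemma continuous_weightedAction (t : ℂˣ) : Continuous (weightedAction w t) := by
  unfold weightedAction
  fun_prop

lemma IsConical.mem_iff {w : Fin 3 → ℕ+} (hX : IsConical w X) (t : ℂˣ) (x : Fin 3 → ℂ) :
    weightedAction w t x ∈ X ↔ x ∈ X :=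
  ⟨fun h => by simpa [weightedAction_inv_self] using hX t⁻¹ _ h, hX t x⟩

variable {w}

/-- The action of `t` on `X - {0}`. -/
def IsConical.act (hX : IsConical w X) (t : ℂˣ) (x : Punctured X) : Punctured X :=
  ⟨weightedAction w t x.1, hX t _ x.2.1, weightedAction_ne_zero w t x.2.2⟩

lemma IsConical.continuous_act (hX : IsConical w X) (t : ℂˣ) : Continuous (hX.act t) :=
  ((continuous_weightedAction w t).comp continuous_subtype_val).subtype_mk _

lemma orbitProj_eq_iff {x y : Punctured X} :
    orbitProj w X x = orbitProj w X y ↔ ∃ t : ℂˣ, y.1 = weightedAction w t x.1 :=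
  Quotient.eq (r := orbitSetoid w X)

lemma IsConical.orbitProj_act (hX : IsConical w X) (t : ℂˣ) (x : Punctured X) :
    orbitProj w X (hX.act t x) = orbitProj w X x :=
  (orbitProj_eq_iff.2 ⟨t, rfl⟩).symm

lemma orbitProj_surjective : Function.Surjective (orbitProj w X) := Quotient.mk_surjective

lemma isQuotientMap_orbitProj : IsQuotientMap (orbitProj w X) := isQuotientMap_quotient_mk'

/-- The saturation of an open set is the union of its translates under the action. -/
lemma IsConical.isOpenMap_orbitProj (hX : IsConical w X) : IsOpenMap (orbitProj w X) := by
  intro U hU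
  rw [← isQuotientMap_orbitProj.isOpen_preimage]
  have : orbitProj w X ⁻¹' (orbitProj w X '' U) = ⋃ t : ℂˣ, hX.act t ⁻¹' U := by
    ext x
    simp only [mem_preimage, mem_image, mem_iUnion]
    constructor
    · rintro ⟨y, hy, hyx⟩
      obtain ⟨t, ht⟩ := orbitProj_eq_iff.1 hyx.symm
      refine ⟨t, ?_⟩
      rwa [show hX.act t x = y from Subtype.ext ht.symm]
    · rintro ⟨t, ht⟩
      exact ⟨_, ht, hX.orbitProj_act t x⟩
  rw [this]
  exact isOpen_iUnion fun t => hU.preimage (hX.continuous_act t)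

lemma exists_powMap_eq (w : Fin 3 → ℕ+) (y : Fin 3 → ℂ) : ∃ z, powMap w z = y := by
  choose z hz using fun i => IsAlgClosed.exists_pow_nat_eq (y i) (w i).pos
  exact ⟨z, funext hz⟩

lemma continuous_powMap (w : Fin 3 → ℕ+) : Continuous (powMap w) := by
  unfold powMap
  fun_prop

lemma powMap_smul (w : Fin 3 → ℕ+) (c : ℂˣ) (z : Fin 3 → ℂ) :
    powMap w ((c : ℂ) • z) = weightedAction w c (powMap w z) := by
  funext i
  simp [powMap, weightedAction, mul_pow]

end Action

/-! ### Connectedness of the orbit space -/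

section Surface

variable {w : Fin 3 → ℕ+} {f : MvPolynomial (Fin 3) ℝ} {d : ℕ}

lemma weight_eq {s : Fin 3 →₀ ℕ}
    (hf : IsWeightedHomogeneous (fun i => (w i : ℕ)) f d) (hs : s ∈ f.support) :
    ∑ i, (w i : ℕ) * s i = d := by
  have := hf (mem_support_iff.1 hs)
  rw [Finsupp.weight_apply, Finsupp.sum_fintype _ _ (by simp)] at this
  simpa [mul_comm] using this

lemma aeval_weightedAction (hf : IsWeightedHomogeneous (fun i => (w i : ℕ)) f d) (t : ℂˣ)
    (x : Fin 3 → ℂ) : aeval (weightedAction w t x) f = (t : ℂ) ^ d * aeval x f := by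
  rw [aeval_def, aeval_def, eval₂_eq', eval₂_eq', Finset.mul_sum]
  refine Finset.sum_congr rfl fun s hs => ?_
  simp only [weightedAction, mul_pow, ← pow_mul, Finset.prod_mul_distrib,
    Finset.prod_pow_eq_pow_sum, weight_eq hf hs]
  ring

lemma isConical_surface (hf : IsWeightedHomogeneous (fun i => (w i : ℕ)) f d) :
    IsConical w (surface f) := by
  intro t x hx
  change aeval _ f = 0
  rw [aeval_weightedAction hf, show aeval x f = 0 from hx, mul_zero]

/-- The homogeneous polynomial `f (z₁ ^ w₁, z₂ ^ w₂, z₃ ^ w₃)` defining `X'`. -/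
def modPoly (w : Fin 3 → ℕ+) (f : MvPolynomial (Fin 3) ℝ) : MvPolynomial (Fin 3) ℂ :=
  aeval (fun i => X i ^ (w i : ℕ)) f

lemma eval_modPoly (z : Fin 3 → ℂ) : eval z (modPoly w f) = aeval (powMap w z) f := by
  have := comp_aeval_apply (φ := ((aeval z : MvPolynomial (Fin 3) ℂ →ₐ[ℂ] ℂ).restrictScalars ℝ))
    (fun i => (X i : MvPolynomial (Fin 3) ℂ) ^ (w i : ℕ)) f
  simpa [modPoly, aeval_eq_eval, ← show powMap w z = fun i => z i ^ (w i : ℕ) from rfl] using this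

lemma isHomogeneous_modPoly (hf : IsWeightedHomogeneous (fun i => (w i : ℕ)) f d) :
    (modPoly w f).IsHomogeneous d := by
  rw [modPoly, aeval_def, eval₂_eq']
  refine IsHomogeneous.sum _ _ _ fun s hs => ?_
  have h1 : (∏ i, ((X i : MvPolynomial (Fin 3) ℂ) ^ (w i : ℕ)) ^ s i).IsHomogeneous d := by
    rw [← weight_eq hf hs]
    refine IsHomogeneous.prod _ _ _ fun i _ => ?_
    rw [← pow_mul]
    exact isHomogeneous_X_pow i _
  have h2 := (isHomogeneous_C (Fin 3) (algebraMap ℝ ℂ (coeff s f))).mul h1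
  rw [zero_add] at h2
  exact h2

lemma exists_aeval_ne_zero (hf₀ : f ≠ 0) : ∃ x : Fin 3 → ℂ, aeval x f ≠ 0 := by
  by_contra! h
  apply hf₀
  have h1 : map (algebraMap ℝ ℂ) f = 0 := by
    refine MvPolynomial.funext fun x => ?_
    rw [eval_map, ← aeval_def, h x, map_zero]
  exact map_injective _ (algebraMap ℝ ℂ).injective (by rw [h1, map_zero])

lemma modPoly_ne_zero (hf₀ : f ≠ 0) : modPoly w f ≠ 0 := by
  obtain ⟨x, hx⟩ := exists_aeval_ne_zero hf₀
  obtain ⟨z, rfl⟩ := exists_powMap_eq w x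
  intro h
  rw [← eval_modPoly, h, map_zero] at hx
  exact hx rfl

/-- The orbit space of a weighted homogeneous surface through the origin is connected. -/
lemma preconnectedSpace_orbitSpace (hf₀ : f ≠ 0)
    (hf : IsWeightedHomogeneous (fun i => (w i : ℕ)) f d) (h0 : (0 : Fin 3 → ℂ) ∈ surface f) :
    PreconnectedSpace (OrbitSpace w (surface f)) := by
  rw [preconnectedSpace_iff_clopen]
  intro S hS
  -- The clopen set is pulled back through π ∘ φ, where the weighted action becomes scalar
  -- multiplication and the result about cones applies.
  let A : Set (Fin 3 → ℂ) := {z | ∃ h, orbitProj w (surface f) ⟨powMap w z, h⟩ ∈ S}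
  have hAc : ∀ (c : ℂ), c ≠ 0 → ∀ x, c • x ∈ A ↔ x ∈ A := by
    have h1 : ∀ (c : ℂˣ) x, x ∈ A → (c : ℂ) • x ∈ A := by
      rintro c x ⟨h, hx⟩
      have e := (isConical_surface hf).orbitProj_act c ⟨powMap w x, h⟩
      rw [← e] at hx
      have h' : powMap w ((c : ℂ) • x) ∈ surface f ∧ powMap w ((c : ℂ) • x) ≠ 0 := by
        rw [powMap_smul]
        exact ((isConical_surface hf).act c ⟨powMap w x, h⟩).2
      refine ⟨h', ?_⟩
      convert hx using 2
      exact Subtype.ext (powMap_smul w c x)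
    intro c hc x
    refine ⟨fun h => ?_, h1 (Units.mk0 c hc) x⟩
    simpa [hc] using h1 (Units.mk0 c hc)⁻¹ _ h
  have hpt : ∀ z, z ≠ 0 → eval z (modPoly w f) = 0 →
      powMap w z ∈ surface f ∧ powMap w z ≠ 0 := fun z hz h =>
    ⟨by rw [eval_modPoly] at h; exact h, powMap_ne_zero w hz⟩
  have hA : ∀ x, x ≠ 0 → eval x (modPoly w f) = 0 →
      ∀ᶠ y in 𝓝 x, eval y (modPoly w f) = 0 → (y ∈ A ↔ x ∈ A) := by
    intro x hx hxF
    have hcont : ∀ S' : Set (OrbitSpace w (surface f)), IsOpen S' →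
        orbitProj w (surface f) ⟨powMap w x, hpt x hx hxF⟩ ∈ S' →
        ∀ᶠ y in 𝓝 x, ∀ h, orbitProj w (surface f) ⟨powMap w y, h⟩ ∈ S' := by
      intro S' hS' hxS
      obtain ⟨V, hV, hVe⟩ := isOpen_induced_iff.1 (hS'.preimage isQuotientMap_orbitProj.continuous)
      have hxV : powMap w x ∈ V := by
        have : (⟨powMap w x, hpt x hx hxF⟩ : Punctured (surface f)) ∈ Subtype.val ⁻¹' V := by
          rw [hVe]; exact hxS
        exact this
      filter_upwards [(continuous_powMap w).continuousAt.eventually (hV.mem_nhds hxV)] with y hy h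
      have : (⟨powMap w y, h⟩ : Punctured (surface f)) ∈ Subtype.val ⁻¹' V := hy
      rw [hVe] at this
      exact this
    by_cases hxS : orbitProj w (surface f) ⟨powMap w x, hpt x hx hxF⟩ ∈ S
    · filter_upwards [hcont S hS.isOpen hxS, eventually_ne_nhds hx] with y hy hy0 hyF
      exact iff_of_true ⟨_, hy (hpt y hy0 hyF)⟩ ⟨_, hxS⟩
    · filter_upwards [hcont Sᶜ hS.compl.isOpen hxS] with y hy hyF
      exact iff_of_false (fun ⟨h, h'⟩ => hy h h') (fun ⟨_, h'⟩ => hxS h')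
  by_contra! hcon
  obtain ⟨m, hm⟩ := hcon.1
  obtain ⟨m', hm'⟩ := (ne_univ_iff_exists_notMem S).1 hcon.2
  obtain ⟨⟨x, hx, hx0⟩, rfl⟩ := orbitProj_surjective m
  obtain ⟨⟨x', hx', hx0'⟩, rfl⟩ := orbitProj_surjective m'
  obtain ⟨z, rfl⟩ := exists_powMap_eq w x
  obtain ⟨z', rfl⟩ := exists_powMap_eq w x'
  have hne : ∀ z, powMap w z ≠ 0 → z ≠ 0 := by
    rintro z hz rfl
    apply hz
    funext i
    exact zero_pow (w i).ne_zero
  have h00 : eval 0 (modPoly w f) = 0 := by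
    rw [eval_modPoly, show powMap w 0 = 0 from funext fun i => zero_pow (w i).ne_zero]
    exact h0
  obtain ⟨_, h⟩ := (isHomogeneous_modPoly hf).mem_cone (modPoly_ne_zero hf₀) h00 hAc hA
    (hne z hx0) (hne z' hx0') (by rw [eval_modPoly]; exact hx) (by rw [eval_modPoly]; exact hx')
    ⟨⟨hx, hx0⟩, hm⟩
  exact hm' h

end Surface

end WeightedSurface

/-- The implicit function theorem for a set `Z` given near `p` by an analytic equation
`H (u, b) = 0` in two complex variables. -/
lemma exists_implicit_graph {H : ℂ × ℂ → ℂ} {p : ℂ × ℂ} (hH : ContDiff ℂ ω H) (hp : H p = 0)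
    {Z : Set (ℂ × ℂ)} (hZ : ∀ᶠ q in 𝓝 p, q ∈ Z ↔ H q = 0) (hd : fderiv ℂ H p (0, 1) ≠ 0) :
    ∃ (v : ℂ → ℂ) (ε δ : ℝ), 0 < ε ∧ 0 < δ ∧ v p.1 = p.2 ∧
      ContDiffOn ℂ ω v (Metric.ball p.1 ε) ∧
      (∀ u ∈ Metric.ball p.1 ε, v u ∈ Metric.ball p.2 δ) ∧
      (∀ u ∈ Metric.ball p.1 ε, ∀ b ∈ Metric.ball p.2 δ, (u, b) ∈ Z ↔ v u = b) ∧
      ∀ u ∈ Metric.ball p.1 ε, fderiv ℂ H (u, v u) (0, 1) ≠ 0 := by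
  have hi : (fderiv ℂ H p ∘L .inr ℂ ℂ ℂ).IsInvertible := by
    refine ⟨ContinuousLinearEquiv.unitsEquivAut ℂ (Units.mk0 _ hd), ?_⟩
    ext
    simp
  have hc : ContDiffAt ℂ ω H p := hH.contDiffAt
  set v := hc.implicitFunction (by simp) hi with hv
  have hv0 : v p.1 = p.2 := hc.implicitFunction_apply_self (by simp) hi
  have hvc : ContDiffAt ℂ ω v p.1 := hc.contDiffAt_implicitFunction (by simp) hi
  have h1 : ∀ᶠ q in 𝓝 p, q ∈ Z ↔ v q.1 = q.2 := by
    have := hc.eventually_apply_eq_iff_implicitFunction (by simp) hi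
    rw [hp] at this
    filter_upwards [hZ, this] with q h1 h2
    rw [h1, h2]
  obtain ⟨δ, hδ, hball⟩ := Metric.eventually_nhds_iff_ball.1 h1
  have h2 : ∀ᶠ u in 𝓝 p.1, v u ∈ Metric.ball p.2 δ :=
    hvc.continuousAt.eventually (by rw [hv0]; exact Metric.ball_mem_nhds _ hδ)
  have h3 : ∀ᶠ u in 𝓝 p.1, ContDiffAt ℂ ω v u := hvc.eventually (by simp)
  have h4 : ∀ᶠ u in 𝓝 p.1, fderiv ℂ H (u, v u) (0, 1) ≠ 0 := by
    have hcont : Continuous fun q => fderiv ℂ H q (0, 1) :=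
      (hH.continuous_fderiv (by simp)).clm_apply continuous_const
    have : ContinuousAt (fun u => fderiv ℂ H (u, v u) (0, 1)) p.1 :=
      hcont.continuousAt.comp (f := fun u => (u, v u)) (continuousAt_id.prodMk hvc.continuousAt)
    exact this.eventually_ne (by rw [hv0]; exact hd)
  obtain ⟨ε, hε, he⟩ := Metric.eventually_nhds_iff_ball.1 (h2.and (h3.and h4))
  refine ⟨v, min ε δ, δ, lt_min hε hδ, hδ, hv0, fun u hu => ?_, fun u hu => ?_, fun u hu b hb => ?_,
    fun u hu => ?_⟩
  · exact (he u (Metric.ball_subset_ball (min_le_left _ _) hu)).2.1.contDiffWithinAt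
  · exact (he u (Metric.ball_subset_ball (min_le_left _ _) hu)).1
  · refine hball (u, b) ?_
    rw [← ball_prod_same]
    exact ⟨Metric.ball_subset_ball (min_le_right _ _) hu, hb⟩
  · exact (he u (Metric.ball_subset_ball (min_le_left _ _) hu)).2.2

namespace MvPolynomial

lemma contDiff_eval (F : MvPolynomial (Fin 3) ℂ) : ContDiff ℂ ω fun x => eval x F :=
  (AnalyticOnNhd.eval_mvPolynomial F).contDiff

lemma fderiv_eval_single (F : MvPolynomial (Fin 3) ℂ) (x : Fin 3 → ℂ) (i : Fin 3) :
    fderiv ℂ (fun x => eval x F) x (Pi.single i 1) = eval x (pderiv i F) := by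
  have hd : ∀ G : MvPolynomial (Fin 3) ℂ, DifferentiableAt ℂ (fun x => eval x G) x := fun G =>
    ((contDiff_eval G).differentiable (by simp)) x
  induction F using MvPolynomial.induction_on with
  | C c => simp
  | add p q hp hq =>
    simp only [map_add]
    rw [fderiv_fun_add (hd p) (hd q), _root_.add_apply, hp, hq]
  | mul_X p j hp =>
    have h1 : (fun x => eval x (p * X j)) = fun x => eval x p * x j := by
      funext x
      simp
    have h2 : DifferentiableAt ℂ (fun x : Fin 3 → ℂ => x j) x := by fun_prop
    have h3 : fderiv ℂ (fun x : Fin 3 → ℂ => x j) x = ContinuousLinearMap.proj j :=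
      (ContinuousLinearMap.proj (R := ℂ) (φ := fun _ : Fin 3 => ℂ) j).fderiv
    rw [h1, fderiv_fun_mul (hd p) h2, h3]
    simp only [_root_.add_apply, _root_.smul_apply, hp,
      ContinuousLinearMap.proj_apply, Pi.single_apply, pderiv_mul, pderiv_X, map_add, map_mul,
      eval_X, smul_eq_mul]
    split_ifs <;> simp [mul_comm, add_comm]

end MvPolynomial

/-! ### Smoothness away from the origin and transversality of slices -/

namespace WeightedSurface

variable {w : Fin 3 → ℕ+} {X : Set (Fin 3 → ℂ)} {f : MvPolynomial (Fin 3) ℝ} {d : ℕ}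

/-- The reduced equation of the surface. -/
lemma exists_reduced_equation (hf₀ : f ≠ 0) :
    ∃ F : MvPolynomial (Fin 3) ℂ, (∀ x, eval x F = 0 ↔ x ∈ surface f) ∧
      ∀ g ∈ vanishingIdeal ℂ (surface f), F ∣ g := by
  set fC := map (algebraMap ℝ ℂ) f with hfC
  have hfC0 : fC ≠ 0 := (map_ne_zero_iff _ (map_injective _ (algebraMap ℝ ℂ).injective)).2 hf₀
  have hev : ∀ x, eval x fC = 0 ↔ x ∈ surface f := fun x => by
    rw [hfC, eval_map, ← aeval_def]
    rfl
  -- `f` need not be squarefree, whereas singular points refer to the reduced surface. By the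
  -- Nullstellensatz, a squarefree polynomial with the same zeros divides everything that vanishes
  -- on X.
  obtain ⟨F, n, hsq, h1, h2⟩ := exists_squarefree_dvd_pow_of_ne_zero hfC0
  refine ⟨F, fun x => ⟨fun h => ?_, fun h => ?_⟩, fun g hg => ?_⟩
  · obtain ⟨q, hq⟩ := h1
    rw [← hev, hq, map_mul, h, zero_mul]
  · obtain ⟨q, hq⟩ := h2
    have := congrArg (eval x) hq
    rw [map_pow, map_mul, (hev x).2 h, zero_mul] at this
    exact eq_zero_of_pow_eq_zero this
  · have hz : surface f = zeroLocus ℂ (Ideal.span {fC}) := by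
      rw [zeroLocus_span]
      ext x
      rw [← hev]
      simp
    rw [hz, vanishingIdeal_zeroLocus_eq_radical] at hg
    obtain ⟨m, hm⟩ := hg
    rw [Ideal.mem_span_singleton] at hm
    exact hsq.isRadical m g (h1.trans hm)

/-- `X` has a global analytic equation whose `l`-th partial derivative does not vanish at `x`. -/
def HasPartial (X : Set (Fin 3 → ℂ)) (x : Fin 3 → ℂ) (l : Fin 3) : Prop :=
  ∃ h : (Fin 3 → ℂ) → ℂ, ContDiff ℂ ω h ∧ (∀ y, h y = 0 ↔ y ∈ X) ∧
    fderiv ℂ h x (Pi.single l 1) ≠ 0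

/-- The weighted action of `t` as a linear map. -/
def actionCLM (w : Fin 3 → ℕ+) (t : ℂˣ) : (Fin 3 → ℂ) →L[ℂ] (Fin 3 → ℂ) :=
  ContinuousLinearMap.pi fun i => (t : ℂ) ^ (w i : ℕ) • ContinuousLinearMap.proj i

lemma actionCLM_apply (t : ℂˣ) (x : Fin 3 → ℂ) : actionCLM w t x = weightedAction w t x := rfl

/-- Composing an equation with the action of `t` gives another equation of X, and the chain rule
multiplies the `l`-th partial derivative by the nonzero scalar t^(w l). -/
lemma IsConical.hasPartial_comp (hX : IsConical w X) (t : ℂˣ) {x : Fin 3 → ℂ} {l : Fin 3}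
    (h : HasPartial X (weightedAction w t x) l) : HasPartial X x l := by
  obtain ⟨h, hc, h0, hl⟩ := h
  refine ⟨fun y => h (actionCLM w t y), hc.comp (actionCLM w t).contDiff, fun y => ?_, ?_⟩
  · rw [h0, actionCLM_apply, hX.mem_iff]
  · have h1 : fderiv ℂ (fun y => h (actionCLM w t y)) x =
        (fderiv ℂ h (weightedAction w t x)).comp (actionCLM w t) :=
      (((hc.differentiable (by simp)) _).hasFDerivAt.comp x
        (actionCLM w t).hasFDerivAt).fderiv
    have h2 : actionCLM w t (Pi.single l 1) = (t : ℂ) ^ (w l : ℕ) • Pi.single l (1 : ℂ) := by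
      funext j
      rw [actionCLM_apply]
      by_cases hj : j = l
      · subst hj
        simp [weightedAction]
      · simp [weightedAction, hj]
    rw [h1, ContinuousLinearMap.comp_apply, h2, map_smul, smul_eq_mul]
    exact mul_ne_zero (pow_ne_zero _ t.ne_zero) hl

lemma IsConical.hasPartial_weightedAction (hX : IsConical w X) (t : ℂˣ) {x : Fin 3 → ℂ}
    {l : Fin 3} (h : HasPartial X x l) : HasPartial X (weightedAction w t x) l :=
  hX.hasPartial_comp t⁻¹ (by rwa [weightedAction_inv_self])

/-- If the origin is an isolated singular point, then the surface has a nondegenerate equation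
at every other point. -/
lemma exists_hasPartial (hf₀ : f ≠ 0) (hf : IsWeightedHomogeneous (fun i => (w i : ℕ)) f d)
    (hsing : IsIsolatedSingularPoint (surface f) 0) {x : Fin 3 → ℂ} (hx : x ∈ surface f)
    (hx0 : x ≠ 0) : ∃ l, HasPartial (surface f) x l := by
  have hX := isConical_surface hf
  -- As t tends to 0 the point t·x tends to the origin, near which there are no other singular
  -- points.
  obtain ⟨t, ht⟩ : ∃ t : ℂˣ, ¬ IsSingularPoint (surface f) (weightedAction w t x) := by
    have h1 := eventually_nhdsWithin_iff.1 hsing.2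
    have h2 : Filter.Tendsto (fun t : ℂ => fun i => t ^ (w i : ℕ) * x i) (𝓝 0) (𝓝 0) := by
      have : Continuous (fun t : ℂ => fun i => t ^ (w i : ℕ) * x i) := by fun_prop
      have h3 := this.tendsto 0
      convert h3 using 2
      funext i
      simp
    have h3 : ∀ᶠ t : ℂ in 𝓝[≠] 0, t ≠ 0 := eventually_mem_nhdsWithin
    obtain ⟨t, ht, ht0⟩ := (((h2.eventually h1).filter_mono nhdsWithin_le_nhds).and h3).exists
    exact ⟨Units.mk0 t ht0, ht (weightedAction_ne_zero w (Units.mk0 t ht0) hx0)⟩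
  obtain ⟨F, hF, hdvd⟩ := exists_reduced_equation hf₀
  rw [IsSingularPoint, not_and] at ht
  have ht' := ht (hX t x hx)
  push Not at ht'
  obtain ⟨g, hg, i, hi⟩ := ht'
  obtain ⟨q, rfl⟩ := hdvd g hg
  refine ⟨i, hX.hasPartial_comp t ⟨fun y => eval y F, contDiff_eval F, hF, ?_⟩⟩
  rw [fderiv_eval_single]
  intro h0
  apply hi
  -- At a zero of `F`, a vanishing partial derivative of `F` forces that of the multiple `F * q` to
  -- vanish as well.
  rw [pderiv_mul, map_add, map_mul, map_mul, h0, (hF _).2 (hX t x hx), zero_mul, zero_mul,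
    add_zero]

/-- Transversality to the slice `y i = x i`, from Euler's relation. -/
lemma IsConical.exists_hasPartial_ne (hX : IsConical w X) {x : Fin 3 → ℂ} (hx : x ∈ X) {i : Fin 3}
    (hi : x i ≠ 0) (h : ∃ l, HasPartial X x l) : ∃ l, l ≠ i ∧ HasPartial X x l := by
  obtain ⟨l, h, hc, h0, hl⟩ := h
  by_contra! hcon
  have hz : ∀ j, j ≠ i → fderiv ℂ h x (Pi.single j 1) = 0 := by
    intro j hj
    by_contra hne
    exact hcon j hj ⟨h, hc, h0, hne⟩
  have hfd : HasFDerivAt h (fderiv ℂ h x) x := ((hc.differentiable (by simp)) x).hasFDerivAt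
  -- `h` is zero along the orbit curve, so its derivative kills the tangent vector (wⱼxⱼ). If only
  -- the `i`-th partial could be nonzero, this would read wᵢxᵢ∂ᵢh = 0.
  set γ : ℂ → Fin 3 → ℂ := fun s j => s ^ (w j : ℕ) * x j with hγ
  have hγ1 : γ 1 = x := by
    funext j
    simp [hγ]
  have hγd : HasDerivAt γ (fun j => (w j : ℂ) * x j) 1 := by
    rw [hasDerivAt_pi]
    intro j
    have := (hasDerivAt_pow (w j : ℕ) (1 : ℂ)).mul_const (x j)
    simpa using this
  have hcomp : HasDerivAt (h ∘ γ) (fderiv ℂ h x fun j => (w j : ℂ) * x j) 1 :=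
    HasFDerivAt.comp_hasDerivAt (1 : ℂ) (by rwa [hγ1]) hγd
  have hconst : h ∘ γ =ᶠ[𝓝 1] fun _ => 0 := by
    filter_upwards [isOpen_ne.mem_nhds (one_ne_zero : (1 : ℂ) ≠ 0)] with s hs
    exact (h0 _).2 (hX (Units.mk0 s hs) x hx)
  have hzero : (fderiv ℂ h x fun j => (w j : ℂ) * x j) = 0 :=
    (hcomp.congr_of_eventuallyEq hconst.symm).unique (hasDerivAt_const _ _)
  have hexp : ∀ v : Fin 3 → ℂ, fderiv ℂ h x v = v i * fderiv ℂ h x (Pi.single i 1) := by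
    intro v
    have hv : v = ∑ j, v j • Pi.single j (1 : ℂ) := by
      conv_lhs => rw [← Finset.univ_sum_single v]
      refine Finset.sum_congr rfl fun j _ => ?_
      rw [← Pi.single_smul, smul_eq_mul, mul_one]
    conv_lhs => rw [hv, map_sum]
    rw [Finset.sum_eq_single i]
    · rw [map_smul, smul_eq_mul]
    · intro j _ hj
      rw [map_smul, hz j hj, smul_zero]
    · simp
  rw [hexp] at hzero
  have hwi : ((w i : ℕ) : ℂ) ≠ 0 := Nat.cast_ne_zero.2 (w i).ne_zero
  have h1 : fderiv ℂ h x (Pi.single i 1) = 0 :=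
    (mul_eq_zero.1 hzero).resolve_left (mul_ne_zero hwi hi)
  exact hl (by rw [hexp, h1, mul_zero])

end WeightedSurface

namespace WeightedSurface

variable {w : Fin 3 → ℕ+} {f : MvPolynomial (Fin 3) ℝ} {d : ℕ}

/-! ### The involution induced by complex conjugation -/

lemma conj_weightedAction (t : ℂˣ) (x : Fin 3 → ℂ) :
    (fun i => conj (weightedAction w t x i)) =
      weightedAction w (Units.map (starRingEnd ℂ : ℂ →* ℂ) t) fun i => conj (x i) := by
  funext i
  simp [weightedAction]

/-- The involution of the orbit space induced by complex conjugation. -/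
def orbitConj (w : Fin 3 → ℕ+) (f : MvPolynomial (Fin 3) ℝ) :
    OrbitSpace w (surface f) → OrbitSpace w (surface f) :=
  Quotient.map' (s₁ := orbitSetoid w (surface f)) (s₂ := orbitSetoid w (surface f))
    (conjPunctured f) fun x y ⟨t, ht⟩ => ⟨Units.map (starRingEnd ℂ : ℂ →* ℂ) t, by
      change (fun i => conj (y.1 i)) = _
      rw [ht, conj_weightedAction]
      rfl⟩

lemma orbitConj_orbitProj (x : Punctured (surface f)) :
    orbitConj w f (orbitProj w (surface f) x) = orbitProj w (surface f) (conjPunctured f x) :=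
  rfl

lemma conjPunctured_conjPunctured (x : Punctured (surface f)) :
    conjPunctured f (conjPunctured f x) = x := by
  apply Subtype.ext
  funext i
  simp [conjPunctured]

lemma continuous_conjPunctured : Continuous (conjPunctured f) := by
  refine Continuous.subtype_mk (continuous_pi fun i => ?_) _
  exact Complex.continuous_conj.comp ((continuous_apply i).comp continuous_subtype_val)

lemma orbitConj_involutive : Function.Involutive (orbitConj w f) := by
  intro m
  obtain ⟨x, rfl⟩ := orbitProj_surjective m
  rw [orbitConj_orbitProj, orbitConj_orbitProj, conjPunctured_conjPunctured]

lemma continuous_orbitConj : Continuous (orbitConj w f) := by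
  rw [isQuotientMap_orbitProj.continuous_iff]
  exact isQuotientMap_orbitProj.continuous.comp continuous_conjPunctured

lemma mem_realOrbits_iff {m : OrbitSpace w (surface f)} :
    m ∈ realOrbits w f ↔
      ∃ x : Punctured (surface f), orbitProj w (surface f) x = m ∧ ∀ i, conj (x.1 i) = x.1 i := by
  constructor
  · rintro ⟨x, ⟨y, -, -, hxy⟩, rfl⟩
    refine ⟨x, rfl, fun i => ?_⟩
    rw [hxy]
    exact Complex.conj_ofReal _
  · rintro ⟨x, rfl, hx⟩
    have hxr : x.1 = fun i => ((x.1 i).re : ℂ) := by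
      funext i
      exact (Complex.conj_eq_iff_re.1 (hx i)).symm
    refine ⟨x, ⟨fun i => (x.1 i).re, ?_, ?_, hxr⟩, rfl⟩
    · have h1 : aeval x.1 f = 0 := x.2.1
      rw [hxr] at h1
      have h2 := aeval_algebraMap_apply (B := ℂ) (fun i => (x.1 i).re) f
      change eval _ f = 0
      have h3 : aeval (fun i => ((x.1 i).re : ℂ)) f = (algebraMap ℝ ℂ) (aeval (fun i => (x.1 i).re) f) :=
        h2
      rw [h1] at h3
      have h4 := (algebraMap ℝ ℂ).injective (h3.symm.trans (map_zero _).symm)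
      rwa [aeval_eq_eval] at h4
    · intro h0
      apply x.2.2
      rw [hxr]
      funext i
      simpa using congrFun h0 i

/-- The fixed points of the involution are the orbits of real points. -/
lemma orbitConj_eq_self_iff (hX : IsConical w (surface f)) {m : OrbitSpace w (surface f)} :
    orbitConj w f m = m ↔ m ∈ realOrbits w f := by
  rw [mem_realOrbits_iff]
  constructor
  · intro hm
    obtain ⟨x, rfl⟩ := orbitProj_surjective m
    rw [orbitConj_orbitProj] at hm
    obtain ⟨t, ht⟩ := orbitProj_eq_iff.1 hm
    have ht' : ∀ i, x.1 i = (t : ℂ) ^ (w i : ℕ) * conj (x.1 i) := fun i => congrFun ht i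
    obtain ⟨i, hi⟩ : ∃ i, x.1 i ≠ 0 := by
      by_contra! h
      exact x.2.2 (funext h)
    have hnorm : ‖(t : ℂ)‖ = 1 := by
      have h1 := congrArg norm (ht' i)
      rw [norm_mul, norm_pow, RCLike.norm_conj] at h1
      have h2 : ‖(t : ℂ)‖ ^ (w i : ℕ) = 1 := by
        have h3 : ‖x.1 i‖ ≠ 0 := norm_ne_zero_iff.2 hi
        exact mul_right_cancel₀ h3 (by rw [one_mul]; exact h1.symm)
      exact (pow_eq_one_iff_of_nonneg (norm_nonneg _) (w i).ne_zero).1 h2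
    -- With x = t·conj(x) and t = r², |r| = 1, the point r⁻¹·x = r·conj(x) equals its own conjugate;
    -- here r⁻¹ = conj(r).
    obtain ⟨r, hr⟩ := IsAlgClosed.exists_pow_nat_eq (t : ℂ) (n := 2) two_pos
    have hr0 : r ≠ 0 := by
      rintro rfl
      exact t.ne_zero (by rw [← hr]; simp)
    have hrn : ‖r‖ = 1 := by
      have : ‖r‖ ^ 2 = 1 := by rw [← norm_pow, hr, hnorm]
      exact (pow_eq_one_iff_of_nonneg (norm_nonneg _) two_ne_zero).1 this
    have hrr : conj r * r = 1 := by
      rw [Complex.conj_mul', hrn]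
      simp
    let s : ℂˣ := Units.mk0 (conj r) ((map_ne_zero _).2 hr0)
    refine ⟨hX.act s x, hX.orbitProj_act s x, fun i => ?_⟩
    change conj ((conj r) ^ (w i : ℕ) * x.1 i) = (conj r) ^ (w i : ℕ) * x.1 i
    rw [map_mul, map_pow, Complex.conj_conj]
    conv_rhs => rw [ht' i, ← hr, ← mul_assoc, ← mul_pow, pow_two, ← mul_assoc, hrr, one_mul]
  · rintro ⟨x, rfl, hx⟩
    rw [orbitConj_orbitProj]
    congr 1
    exact Subtype.ext (funext hx)

/-! ### Slices at real points -/

/-- The point with coordinates `a` at `i`, `u` at `k` and `b` at the remaining place. -/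
def slicePt (i k : Fin 3) (a u b : ℂ) : Fin 3 → ℂ :=
  fun j => if j = i then a else if j = k then u else b

lemma continuous_slicePt (i k : Fin 3) (a : ℂ) :
    Continuous fun p : ℂ × ℂ => slicePt i k a p.1 p.2 := by
  refine continuous_pi fun j => ?_
  unfold slicePt
  split_ifs <;> fun_prop

lemma contDiff_slicePt (i k : Fin 3) (a : ℂ) :
    ContDiff ℂ ω fun p : ℂ × ℂ => slicePt i k a p.1 p.2 := by
  refine contDiff_pi.2 fun j => ?_
  unfold slicePt
  split_ifs <;> fun_prop

lemma eq_slicePt {i k l : Fin 3} (hil : i ≠ l) (hkl : k ≠ l) (hik : i ≠ k) (y : Fin 3 → ℂ) :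
    y = slicePt i k (y i) (y k) (y l) := by
  funext j
  have : j = i ∨ j = k ∨ j = l := by
    revert i k l j
    decide
  unfold slicePt
  rcases this with rfl | rfl | rfl
  · simp
  · simp [hik.symm]
  · simp [hil.symm, hkl.symm]

lemma fderiv_comp_slicePt {h : (Fin 3 → ℂ) → ℂ} (hc : ContDiff ℂ ω h) {i k l : Fin 3}
    (hil : i ≠ l) (hkl : k ≠ l) (hik : i ≠ k) (a : ℂ) (p : ℂ × ℂ) :
    fderiv ℂ (fun p : ℂ × ℂ => h (slicePt i k a p.1 p.2)) p (0, 1) =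
      fderiv ℂ h (slicePt i k a p.1 p.2) (Pi.single l 1) := by
  have h1 : HasFDerivAt h (fderiv ℂ h (slicePt i k a p.1 p.2)) (slicePt i k a p.1 p.2) :=
    (hc.differentiable (by simp) _).hasFDerivAt
  have h2 : HasFDerivAt (fun p : ℂ × ℂ => h (slicePt i k a p.1 p.2)) (fderiv ℂ
      (fun p : ℂ × ℂ => h (slicePt i k a p.1 p.2)) p) (p.1, p.2) :=
    ((hc.comp (contDiff_slicePt i k a)).differentiable (by simp) p).hasFDerivAt
  have h3 : HasDerivAt (fun b : ℂ => (p.1, b)) ((0, 1) : ℂ × ℂ) p.2 :=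
    (hasDerivAt_const _ _).prodMk (hasDerivAt_id _)
  have h4 : HasDerivAt (fun b : ℂ => slicePt i k a p.1 b) (Pi.single l 1) p.2 := by
    rw [hasDerivAt_pi]
    intro j
    have : j = i ∨ j = k ∨ j = l := by
      clear h1 h2 h3
      revert i k l j
      decide
    unfold slicePt
    rcases this with rfl | rfl | rfl
    · simpa [Pi.single_apply, hil] using hasDerivAt_const p.2 a
    · simpa [Pi.single_apply, hkl, hik.symm] using hasDerivAt_const p.2 p.1
    · simpa [hil.symm, hkl.symm] using hasDerivAt_id' p.2
  exact (h2.comp_hasDerivAt p.2 h3).unique (h1.comp_hasDerivAt p.2 h4)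

/-- The orbits near the orbit of `x` meet the slice. -/
lemma eventually_exists_slice {X : Set (Fin 3 → ℂ)} (hX : IsConical w X) {x : Fin 3 → ℂ}
    {i k l : Fin 3} (hil : i ≠ l) (hkl : k ≠ l) (hik : i ≠ k) (hi : x i ≠ 0) {v : ℂ → ℂ} {ε δ : ℝ}
    (hε : 0 < ε) (hδ : 0 < δ) (hv : ∀ u ∈ Metric.ball (x k) ε, ∀ b ∈ Metric.ball (x l) δ,
      slicePt i k (x i) u b ∈ X → v u = b) :
    ∀ᶠ y in 𝓝 x, y ∈ X → ∃ (t : ℂˣ) (u : ℂ), u ∈ Metric.ball (x k) ε ∧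
      y = weightedAction w t (slicePt i k (x i) u (v u)) := by
  -- The branch of the `w i`-th root of yᵢ/xᵢ that is 1 at `x`. Acting by its inverse moves `y` into
  -- the slice, continuously at `x`.
  set τ : (Fin 3 → ℂ) → ℂ := fun y => (y i / x i) ^ (((w i : ℕ) : ℂ)⁻¹) with hτ
  have hτx : τ x = 1 := by simp [hτ, hi]
  have hτc : ContinuousAt τ x := by
    refine ContinuousAt.cpow ?_ continuousAt_const ?_
    · exact ((continuous_apply i).div_const _).continuousAt
    · rw [div_self hi]
      exact Complex.one_mem_slitPlane
  have hτp : ∀ y, τ y ^ (w i : ℕ) = y i / x i := fun y =>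
    Complex.cpow_nat_inv_pow _ (w i).ne_zero
  have hz : ∀ j, ContinuousAt (fun y => (τ y)⁻¹ ^ (w j : ℕ) * y j) x := fun j =>
    ((hτc.inv₀ (by rw [hτx]; exact one_ne_zero)).pow _).mul (continuous_apply j).continuousAt
  have hzx : ∀ j, (τ x)⁻¹ ^ (w j : ℕ) * x j = x j := fun j => by rw [hτx]; simp
  have h1 := (hz k).eventually (Metric.isOpen_ball.mem_nhds (by
    beta_reduce
    rw [hzx]
    exact Metric.mem_ball_self hε) : Metric.ball (x k) ε ∈ _)
  have h2 := (hz l).eventually (Metric.isOpen_ball.mem_nhds (by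
    beta_reduce
    rw [hzx]
    exact Metric.mem_ball_self hδ) : Metric.ball (x l) δ ∈ _)
  have h3 := hτc.eventually_ne (by rw [hτx]; exact one_ne_zero)
  filter_upwards [h1, h2, h3] with y hy1 hy2 hy3 hyX
  set t : ℂˣ := Units.mk0 (τ y) hy3 with ht
  have hzy : weightedAction w t⁻¹ y =
      slicePt i k (x i) ((τ y)⁻¹ ^ (w k : ℕ) * y k) ((τ y)⁻¹ ^ (w l : ℕ) * y l) := by
    conv_lhs => rw [eq_slicePt hil hkl hik (weightedAction w t⁻¹ y)]
    congr 1
    have h4 : (τ y)⁻¹ ^ (w i : ℕ) * y i = x i := by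
      have hyi : y i ≠ 0 := by
        intro h0
        have := hτp y
        rw [h0, zero_div] at this
        exact pow_ne_zero _ hy3 this
      rw [inv_pow, hτp]
      field_simp
    simpa [weightedAction, ht] using h4
  refine ⟨t, (τ y)⁻¹ ^ (w k : ℕ) * y k, hy1, ?_⟩
  have h5 := hX t⁻¹ y hyX
  rw [hzy] at h5
  rw [hv _ hy1 _ hy2 h5, ← hzy, weightedAction_self_inv]

end WeightedSurface

/-! ### Fixed points in slices and the extension of invariant splittings -/

namespace WeightedSurface

variable {w : Fin 3 → ℕ+} {f : MvPolynomial (Fin 3) ℝ} {d : ℕ}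

/-- The orbits of real points `x` at which a coordinate transversal to a slice `y i = x i` does
not vanish. -/
def IsTransversalOrbit (w : Fin 3 → ℕ+) (f : MvPolynomial (Fin 3) ℝ)
    (m : OrbitSpace w (surface f)) : Prop :=
  ∃ x : Punctured (surface f), orbitProj w (surface f) x = m ∧ (∀ i, conj (x.1 i) = x.1 i) ∧
    ∃ i k l : Fin 3, i ≠ l ∧ k ≠ l ∧ i ≠ k ∧ x.1 i ≠ 0 ∧ x.1 k ≠ 0 ∧ HasPartial (surface f) x.1 l

lemma conj_mem_ball {c u : ℂ} (hc : conj c = c) {ε : ℝ} (hu : u ∈ Metric.ball c ε) :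
    conj u ∈ Metric.ball c ε := by
  rw [Metric.mem_ball, Complex.dist_eq] at hu ⊢
  rwa [← hc, ← map_sub, RCLike.norm_conj]

/-- A neighbourhood of the orbit of a real point is parametrized by a disc, such that the
involution is complex conjugation on the disc. -/
lemma exists_real_slice (hX : IsConical w (surface f)) {x : Punctured (surface f)}
    (hx : ∀ i, conj (x.1 i) = x.1 i) {i k l : Fin 3} (hil : i ≠ l) (hkl : k ≠ l) (hik : i ≠ k)
    (hi : x.1 i ≠ 0) (hl : HasPartial (surface f) x.1 l) :
    ∃ (q : ℂ → OrbitSpace w (surface f)) (ε : ℝ), 0 < ε ∧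
      ContinuousOn q (Metric.ball (x.1 k) ε) ∧ q (x.1 k) = orbitProj w (surface f) x ∧
      (∀ ε', 0 < ε' → ε' ≤ ε →
        q '' Metric.ball (x.1 k) ε' ∈ 𝓝 (orbitProj w (surface f) x)) ∧
      (∀ u ∈ Metric.ball (x.1 k) ε, orbitConj w f (q u) = q (conj u)) ∧
      (x.1 k ≠ 0 → ∃ ε', 0 < ε' ∧ ε' ≤ ε ∧
        ∀ u ∈ Metric.ball (x.1 k) ε', orbitConj w f (q u) = q u → conj u = u) ∧
      ∀ u ∈ Metric.ball (x.1 k) ε, u ≠ 0 → orbitConj w f (q u) = q u →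
        IsTransversalOrbit w f (q u) := by
  classical
  obtain ⟨h, hc, h0, hld⟩ := hl
  have hxs : slicePt i k (x.1 i) (x.1 k) (x.1 l) = x.1 := (eq_slicePt hil hkl hik x.1).symm
  obtain ⟨v, ε, δ, hε, hδ, hv0, hvc, hvb, hveq, hvd⟩ := exists_implicit_graph
    (H := fun p : ℂ × ℂ => h (slicePt i k (x.1 i) p.1 p.2)) (p := (x.1 k, x.1 l))
    (hc.comp (contDiff_slicePt i k _)) (by simp only [hxs]; exact (h0 _).2 x.2.1)
    (Z := {p | slicePt i k (x.1 i) p.1 p.2 ∈ surface f})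
    (Filter.Eventually.of_forall fun q => (h0 _).symm)
    (by rw [fderiv_comp_slicePt hc hil hkl hik]; simp only [hxs]; exact hld)
  simp only [mem_ofPred_eq] at hveq hv0 hvb hvc hvd
  set s : ℂ → Fin 3 → ℂ := fun u => slicePt i k (x.1 i) u (v u) with hs
  have hsi : ∀ u, s u i = x.1 i := fun u => by simp [hs, slicePt]
  have hsk : ∀ u, s u k = u := fun u => by simp [hs, slicePt, hik.symm]
  have hs0 : ∀ u, s u ≠ 0 := fun u h => hi (by rw [← hsi u, h]; rfl)
  have hsX : ∀ u ∈ Metric.ball (x.1 k) ε, s u ∈ surface f := fun u hu =>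
    (hveq u hu _ (hvb u hu)).2 rfl
  have hsc : ContinuousOn s (Metric.ball (x.1 k) ε) :=
    (continuous_slicePt i k (x.1 i)).comp_continuousOn (continuousOn_id.prodMk hvc.continuousOn)
  -- The conjugate point lies on X, in the same slice and the same bidisc since `x` is real, so
  -- uniqueness of the graph identifies it.
  have hsconj : ∀ u ∈ Metric.ball (x.1 k) ε, (fun j => conj (s u j)) = s (conj u) := by
    intro u hu
    have hu' := conj_mem_ball (hx k) hu
    have e : (fun j => conj (s u j)) = slicePt i k (x.1 i) (conj u) (conj (v u)) := by
      funext j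
      simp only [hs, slicePt]
      split_ifs
      · exact hx i
      · rfl
      · rfl
    have hm : slicePt i k (x.1 i) (conj u) (conj (v u)) ∈ surface f := by
      rw [← e]
      exact (conjPunctured f ⟨s u, hsX u hu, hs0 u⟩).2.1
    rw [e, ← (hveq _ hu' _ (conj_mem_ball (hx l) (hvb u hu))).1 hm]
  -- The second branch is a junk value; on the disc `hsX` always selects the first.
  set q : ℂ → OrbitSpace w (surface f) := fun u =>
    if hu : s u ∈ surface f then orbitProj w (surface f) ⟨s u, hu, hs0 u⟩
    else orbitProj w (surface f) x with hq
  have hqe : ∀ u (hu : s u ∈ surface f), q u = orbitProj w (surface f) ⟨s u, hu, hs0 u⟩ :=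
    fun u hu => dif_pos hu
  have hqi : ∀ u (hu : s u ∈ surface f), orbitConj w f (q u) = q u →
      ∃ t : ℂˣ, (t : ℂ) ^ (w i : ℕ) = 1 ∧ (t : ℂ) ^ (w k : ℕ) * u = conj u := by
    intro u hu hfix
    rw [hqe u hu, orbitConj_orbitProj] at hfix
    obtain ⟨t, ht⟩ := orbitProj_eq_iff.1 hfix.symm
    refine ⟨t, ?_, ?_⟩
    · have h1 : conj (s u i) = (t : ℂ) ^ (w i : ℕ) * s u i := congrFun ht i
      rw [hsi, hx i] at h1
      exact mul_right_cancel₀ hi (by rw [one_mul]; exact h1.symm)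
    · have h1 : conj (s u k) = (t : ℂ) ^ (w k : ℕ) * s u k := congrFun ht k
      rw [hsk] at h1
      exact h1.symm
  refine ⟨q, ε, hε, ?_, ?_, fun ε' hε' hle => ?_, fun u hu => ?_, fun hk => ?_,
    fun u hu hu0 hfix => ?_⟩
  · rw [continuousOn_iff_continuous_domRestrict] at hsc ⊢
    have e : (Metric.ball (x.1 k) ε).domRestrict q = fun u : Metric.ball (x.1 k) ε =>
        orbitProj w (surface f) ⟨s u, hsX u u.2, hs0 u⟩ := by
      funext u
      exact hqe u (hsX u u.2)
    rw [e]
    exact isQuotientMap_orbitProj.continuous.comp (hsc.subtype_mk _)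
  · have : s (x.1 k) = x.1 := by
      simp only [hs, hv0]
      exact hxs
    rw [hqe _ (by rw [this]; exact x.2.1)]
    congr 1
    exact Subtype.ext this
  · have h1 := eventually_exists_slice hX hil hkl hik hi hε' hδ (v := v) fun u hu b hb =>
      (hveq u (Metric.ball_subset_ball hle hu) b hb).1
    have h2 : ∀ᶠ y : Punctured (surface f) in 𝓝 x,
        orbitProj w (surface f) y ∈ q '' Metric.ball (x.1 k) ε' := by
      filter_upwards [continuous_subtype_val.continuousAt.eventually h1] with y hy
      obtain ⟨t, u, hu, htu⟩ := hy y.2.1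
      refine ⟨u, hu, ?_⟩
      rw [hqe u (hsX u (Metric.ball_subset_ball hle hu))]
      exact orbitProj_eq_iff.2 ⟨t, htu⟩
    exact Filter.mem_of_superset (hX.isOpenMap_orbitProj.image_mem_nhds h2)
      (image_subset_iff.2 fun y hy => hy)
  · have hu' := conj_mem_ball (hx k) hu
    rw [hqe u (hsX u hu), orbitConj_orbitProj, hqe _ (hsX _ hu')]
    congr 1
    exact Subtype.ext (hsconj u hu)
  -- A fixed q(u) gives ζu = conj(u) with ζ = t^(w k) a `w i`-th root of unity. At the real nonzero
  -- centre this fails for each of the finitely many ζ ≠ 1, hence also nearby, leaving ζ = 1.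
  · set Z : Finset ℂ := (Polynomial.nthRoots (w i) (1 : ℂ)).toFinset.filter (· ≠ 1) with hZ
    have hev : ∀ᶠ u in 𝓝 (x.1 k), ∀ ζ ∈ Z, ζ * u ≠ conj u := by
      refine (Filter.eventually_all_finset _).2 fun ζ hζ => ?_
      have hc1 : ContinuousAt (fun u : ℂ => ζ * u - conj u) (x.1 k) :=
        ((continuous_const.mul continuous_id).sub Complex.continuous_conj).continuousAt
      have hne : ζ * x.1 k - conj (x.1 k) ≠ 0 := by
        rw [hx k]
        intro h1
        have h2 : (ζ - 1) * x.1 k = 0 := by linear_combination h1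
        rcases mul_eq_zero.1 h2 with h3 | h3
        · exact (Finset.mem_filter.1 hζ).2 (sub_eq_zero.1 h3)
        · exact hk h3
      filter_upwards [hc1.eventually_ne hne] with u hu h1
      exact hu (sub_eq_zero.2 h1)
    obtain ⟨ε₁, hε₁, hb⟩ := Metric.eventually_nhds_iff_ball.1 hev
    refine ⟨min ε ε₁, lt_min hε hε₁, min_le_left _ _, fun u hu hfix => ?_⟩
    obtain ⟨t, ht1, ht2⟩ := hqi u (hsX u (Metric.ball_subset_ball (min_le_left _ _) hu)) hfix
    by_cases hone : (t : ℂ) ^ (w k : ℕ) = 1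
    · rw [← ht2, hone, one_mul]
    · refine absurd ht2 (hb u (Metric.ball_subset_ball (min_le_right _ _) hu) _ ?_)
      rw [hZ, Finset.mem_filter, Multiset.mem_toFinset, Polynomial.mem_nthRoots (w i).pos,
        ← pow_mul, mul_comm, pow_mul, ht1, one_pow]
      exact ⟨rfl, hone⟩
  · have hfix' := (orbitConj_eq_self_iff hX).1 hfix
    -- The real representative may differ from the slice point by the action, but nonvanishing
    -- coordinates and partial derivatives are preserved along orbits.
    obtain ⟨y, hy, hyr⟩ := mem_realOrbits_iff.1 hfix'
    refine ⟨y, hy, hyr, i, k, l, hil, hkl, hik, ?_⟩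
    rw [hqe u (hsX u hu)] at hy
    obtain ⟨t, ht⟩ := orbitProj_eq_iff.1 hy.symm
    rw [ht]
    refine ⟨?_, ?_, hX.hasPartial_weightedAction t ⟨h, hc, h0, ?_⟩⟩
    · rw [Ne, weightedAction_apply_eq_zero]
      change ¬ s u i = 0
      rwa [hsi]
    · rw [Ne, weightedAction_apply_eq_zero]
      change ¬ s u k = 0
      rwa [hsk]
    · have := hvd u hu
      rwa [fderiv_comp_slicePt hc hil hkl hik] at this

/-- The exponential maps a half-plane, which is convex, onto the punctured disc. -/
lemma isPreconnected_ball_diff_zero (ε : ℝ) (hε : 0 < ε) :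
    IsPreconnected (Metric.ball (0 : ℂ) ε \ {0}) := by
  have e : Metric.ball (0 : ℂ) ε \ {0} = Complex.exp '' {z | z.re < Real.log ε} := by
    ext z
    simp only [mem_sdiff, Metric.mem_ball, dist_zero_right, mem_singleton_iff, mem_image,
      mem_ofPred_eq]
    constructor
    · rintro ⟨h1, h2⟩
      refine ⟨Complex.log z, ?_, Complex.exp_log h2⟩
      rw [Complex.log_re]
      exact Real.log_lt_log (norm_pos_iff.2 h2) h1
    · rintro ⟨y, hy, rfl⟩
      refine ⟨?_, Complex.exp_ne_zero y⟩
      rw [Complex.norm_exp]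
      exact (Real.lt_log_iff_exp_lt hε).1 hy
  rw [e]
  exact (convex_halfSpace_re_lt _).isPreconnected.image _ Complex.continuous_exp.continuousOn

/-- Euler's relation supplies a transversal slice at a nonzero coordinate; failure of
`IsTransversalOrbit` leaves only the possibility that its parameter vanishes at the centre. Away
from the centre every fixed point is transversal. -/
lemma exists_nontransversal_slice (hX : IsConical w (surface f))
    (hpart : ∀ x : Punctured (surface f), ∃ l, HasPartial (surface f) x.1 l)
    {m : OrbitSpace w (surface f)} (hm : orbitConj w f m = m)
    (hm' : ¬ IsTransversalOrbit w f m) :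
    ∃ (q : ℂ → OrbitSpace w (surface f)) (ε : ℝ), 0 < ε ∧ ContinuousOn q (Metric.ball 0 ε) ∧
      q 0 = m ∧ q '' Metric.ball 0 ε ∈ 𝓝 m ∧
      ∀ u ∈ Metric.ball 0 ε, u ≠ 0 → orbitConj w f (q u) = q u →
        IsTransversalOrbit w f (q u) := by
  obtain ⟨x, rfl, hx⟩ := mem_realOrbits_iff.1 ((orbitConj_eq_self_iff hX).1 hm)
  obtain ⟨i, hi⟩ : ∃ i, x.1 i ≠ 0 := by
    by_contra! h
    exact x.2.2 (funext h)
  obtain ⟨l, hli, hl⟩ := hX.exists_hasPartial_ne x.2.1 hi (hpart x)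
  obtain ⟨k, hki, hkl⟩ : ∃ k, k ≠ i ∧ k ≠ l := by
    clear hi hl
    revert i l
    decide
  have hk : x.1 k = 0 := by
    by_contra hk
    exact hm' ⟨x, rfl, hx, i, k, l, hli.symm, hkl, hki.symm, hi, hk, hl⟩
  obtain ⟨q, ε, hε, hqc, hq0, hqn, -, -, hqt⟩ := exists_real_slice hX hx hli.symm hkl hki.symm hi hl
  rw [hk] at hqc hq0 hqn hqt
  exact ⟨q, ε, hε, hqc, hq0, hqn ε hε le_rfl, hqt⟩

/-- Fixed points are limits of points that are not fixed. -/
lemma frequently_orbitConj_ne (hX : IsConical w (surface f))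
    (hpart : ∀ x : Punctured (surface f), ∃ l, HasPartial (surface f) x.1 l)
    (m : OrbitSpace w (surface f)) :
    ∃ᶠ y in 𝓝 m, orbitConj w f y ≠ y := by
  have main : ∀ m, IsTransversalOrbit w f m → ∃ᶠ y in 𝓝 m, orbitConj w f y ≠ y := by
    rintro m ⟨x, rfl, hx, i, k, l, hil, hkl, hik, hi, hk, hl⟩
    obtain ⟨q, ε, hε, hqc, hq0, -, -, hqk, -⟩ := exists_real_slice hX hx hil hkl hik hi hl
    obtain ⟨ε', hε', hle, hq⟩ := hqk hk
    rw [← hq0]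
    have hcont : ContinuousAt q (x.1 k) := hqc.continuousAt (Metric.ball_mem_nhds _ hε)
    refine hcont.tendsto.frequently ?_
    intro hev
    obtain ⟨ε₁, hε₁, hb⟩ := Metric.eventually_nhds_iff_ball.1
      (hev.and (Metric.ball_mem_nhds (x.1 k) hε'))
    -- Near a transversal centre the parameter of a fixed point is real, so an imaginary
    -- displacement leaves the fixed set.
    have hmem : x.1 k + ((ε₁ / 2 : ℝ) : ℂ) * Complex.I ∈ Metric.ball (x.1 k) ε₁ := by
      rw [Metric.mem_ball, dist_self_add_left, norm_mul, Complex.norm_I, mul_one,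
        Complex.norm_real, Real.norm_eq_abs, abs_of_pos (half_pos hε₁)]
      exact half_lt_self hε₁
    obtain ⟨h1, h2⟩ := hb _ hmem
    have h3 := hq _ h2 (not_not.1 h1)
    rw [Complex.conj_eq_iff_im] at h3
    have h4 : (x.1 k).im = 0 := Complex.conj_eq_iff_im.1 (hx k)
    simp [h4] at h3
    exact hε₁.ne' h3
  by_cases hm : orbitConj w f m = m
  · by_cases hm' : IsTransversalOrbit w f m
    · exact main m hm'
    · obtain ⟨q, ε, hε, hqc, hq0, -, hqt⟩ := exists_nontransversal_slice hX hpart hm hm'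
      rw [Filter.frequently_iff]
      intro U hU
      obtain ⟨V, hVU, hVo, hmV⟩ := mem_nhds_iff.1 hU
      have hcont : ContinuousAt q 0 := hqc.continuousAt (Metric.ball_mem_nhds _ hε)
      have hV : ∀ᶠ u in 𝓝 (0 : ℂ), q u ∈ V ∧ u ∈ Metric.ball (0 : ℂ) ε :=
        (hcont.eventually (by rw [hq0]; exact hVo.mem_nhds hmV)).and (Metric.ball_mem_nhds _ hε)
      obtain ⟨u, ⟨huV, hub⟩, hu0⟩ := ((hV.filter_mono nhdsWithin_le_nhds).and
        (eventually_mem_nhdsWithin (a := (0 : ℂ)) (s := {0}ᶜ))).exists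
      by_cases hfix : orbitConj w f (q u) = q u
      · obtain ⟨y, hyV, hy⟩ := ((main _ (hqt u hub hu0 hfix)).and_eventually
          (hVo.mem_nhds huV)).exists
        exact ⟨y, hVU hy, hyV⟩
      · exact ⟨q u, hVU huV, hfix⟩
  · exact Filter.frequently_iff.2 fun hU => ⟨m, mem_of_mem_nhds hU, hm⟩

/-- The complement of the fixed set cannot be split into two disjoint clopen sets that are both
stable under the involution. -/
lemma eq_empty_of_invariant_splitting (hX : IsConical w (surface f))
    (hpart : ∀ x : Punctured (surface f), ∃ l, HasPartial (surface f) x.1 l)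
    [PreconnectedSpace (OrbitSpace w (surface f))]
    {U V : Set (OrbitSpace w (surface f))} (hU : IsOpen U) (hV : IsOpen V)
    (hUV : {m | orbitConj w f m ≠ m} ⊆ U ∪ V)
    (hdisj : {m | orbitConj w f m ≠ m} ∩ (U ∩ V) = ∅)
    (hUi : ∀ m, orbitConj w f m ≠ m → m ∈ U → orbitConj w f m ∈ U)
    (hVi : ∀ m, orbitConj w f m ≠ m → m ∈ V → orbitConj w f m ∈ V) :
    {m | orbitConj w f m ≠ m} ∩ U = ∅ ∨ {m | orbitConj w f m ≠ m} ∩ V = ∅ := by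
  -- `Ext S` collects the points near which the non-fixed points all lie in `S`. It is open, and
  -- since non-fixed points are dense, `Ext U` and `Ext V` are disjoint; the task is to show that
  -- they cover M.
  set Ext : Set (OrbitSpace w (surface f)) → Set (OrbitSpace w (surface f)) := fun S =>
    {m | ∀ᶠ y in 𝓝 m, orbitConj w f y ≠ y → y ∈ S} with hExt
  have hExto : ∀ S, IsOpen (Ext S) := fun S =>
    isOpen_iff_mem_nhds.2 fun m hm => hm.eventually_nhds
  have hExts : ∀ S, IsOpen S → S ⊆ Ext S := fun S hS m hm =>
    Filter.mem_of_superset (hS.mem_nhds hm) fun y hy _ => hy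
  have hExtm : ∀ S m, m ∈ Ext S → orbitConj w f m ≠ m → m ∈ S := fun S m hm =>
    hm.self_of_nhds
  have hdis : ∀ m, m ∈ Ext U → m ∉ Ext V := by
    intro m h1 h2
    obtain ⟨y, hy, hyU, hyV⟩ :=
      ((frequently_orbitConj_ne hX hpart m).and_eventually (h1.and h2)).exists
    exact (hdisj ▸ (⟨hy, hyU hy, hyV hy⟩ : y ∈ {m | orbitConj w f m ≠ m} ∩ (U ∩ V)) :
      y ∈ (∅ : Set _))
  have hgood : ∀ m, IsTransversalOrbit w f m → m ∈ Ext U ∪ Ext V := by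
    rintro m ⟨x, rfl, hx, i, k, l, hil, hkl, hik, hi, hk, hl⟩
    obtain ⟨q, ε, hε, hqc, hq0, hqn, hqj, hqk, -⟩ := exists_real_slice hX hx hil hkl hik hi hl
    obtain ⟨ε', hε', hle, hq⟩ := hqk hk
    -- The upper half disc contains no fixed points and is convex, so its image lies in one piece.
    -- Stability under the involution carries this to the lower half, and real parameters give fixed
    -- points.
    set D := Metric.ball (x.1 k) ε' ∩ {u | 0 < u.im} with hD
    have hDc : IsPreconnected D :=
      ((convex_ball _ _).inter (convex_halfSpace_im_gt 0)).isPreconnected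
    have hDi : IsPreconnected (q '' D) :=
      hDc.image q (hqc.mono (inter_subset_left.trans (Metric.ball_subset_ball hle)))
    have hDsub : q '' D ⊆ {m | orbitConj w f m ≠ m} := by
      rintro _ ⟨u, hu, rfl⟩ hfix
      exact (ne_of_gt hu.2) (Complex.conj_eq_iff_im.1 (hq u hu.1 hfix))
    have key : ∀ S, (∀ m, orbitConj w f m ≠ m → m ∈ S → orbitConj w f m ∈ S) → q '' D ⊆ S →
        orbitProj w (surface f) x ∈ Ext S := by
      intro S hSi hS
      refine Filter.mem_of_superset (hqn ε' hε' hle) ?_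
      rintro _ ⟨u, hu, rfl⟩ hne
      have hu' := Metric.ball_subset_ball hle hu
      rcases lt_trichotomy u.im 0 with h | h | h
      · have hcD : conj u ∈ D := ⟨conj_mem_ball (hx k) hu, by
          change 0 < (conj u).im
          rw [Complex.conj_im]
          linarith⟩
        have h1 := hSi _ (hDsub ⟨_, hcD, rfl⟩) (hS ⟨_, hcD, rfl⟩)
        rw [hqj _ (Metric.ball_subset_ball hle hcD.1), Complex.conj_conj] at h1
        exact h1
      · refine absurd ?_ hne
        rw [hqj u hu', Complex.conj_eq_iff_im.2 h]
      · exact hS ⟨u, ⟨hu, h⟩, rfl⟩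
    have hsub := isPreconnected_iff_subset_of_disjoint.1 hDi U V hU hV (hDsub.trans hUV)
      (Set.eq_empty_of_subset_empty ((inter_subset_inter_left _ hDsub).trans hdisj.le))
    exact hsub.imp (key U hUi) (key V hVi)
  have hne : ∀ m, orbitConj w f m ≠ m → m ∈ Ext U ∪ Ext V := fun m hm =>
    (hUV hm).imp (fun h => hExts U hU h) fun h => hExts V hV h
  have hcov : ∀ m, m ∈ Ext U ∪ Ext V := by
    intro m
    by_cases hm : orbitConj w f m = m
    swap
    · exact hne m hm
    by_cases hm' : IsTransversalOrbit w f m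
    · exact hgood m hm'
    obtain ⟨q, ε, hε, hqc, hq0, hqn, hqt⟩ := exists_nontransversal_slice hX hpart hm hm'
    -- The punctured disc may still meet the fixed set, so it is split by the extended sets, which
    -- already cover it, rather than by `U` and `V`.
    have hpc : IsPreconnected (q '' (Metric.ball 0 ε \ {0})) :=
      (isPreconnected_ball_diff_zero ε hε).image q (hqc.mono sdiff_subset)
    have hsub : q '' (Metric.ball 0 ε \ {0}) ⊆ Ext U ∪ Ext V := by
      rintro _ ⟨u, ⟨hu, hu0⟩, rfl⟩
      by_cases hfix : orbitConj w f (q u) = q u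
      · exact hgood _ (hqt u hu hu0 hfix)
      · exact hne _ hfix
    have key : ∀ S, q '' (Metric.ball 0 ε \ {0}) ⊆ Ext S → m ∈ Ext S := by
      intro S hS
      refine Filter.mem_of_superset hqn ?_
      rintro _ ⟨u, hu, rfl⟩ hne'
      have hu0 : u ≠ 0 := by
        rintro rfl
        rw [hq0] at hne'
        exact hne' hm
      exact hExtm S _ (hS ⟨u, ⟨hu, hu0⟩, rfl⟩) hne'
    have := isPreconnected_iff_subset_of_disjoint.1 hpc _ _ (hExto U) (hExto V) hsub
      (Set.eq_empty_of_forall_notMem fun y hy => hdis y hy.2.1 hy.2.2)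
    exact this.imp (key U) (key V)
  have := isPreconnected_iff_subset_of_disjoint.1
    (isPreconnected_univ (α := OrbitSpace w (surface f))) _ _ (hExto U) (hExto V)
    (fun m _ => hcov m) (Set.eq_empty_of_forall_notMem fun y hy => hdis y hy.2.1 hy.2.2)
  rcases this with h | h
  · right
    refine Set.eq_empty_of_forall_notMem fun m hm => ?_
    exact hdis m (h (mem_univ m)) (hExts V hV hm.2)
  · left
    refine Set.eq_empty_of_forall_notMem fun m hm => ?_
    exact hdis m (hExts U hU hm.2) (h (mem_univ m))

end WeightedSurface

/-! ### Components exchanged by an involution -/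

lemma connectedComponentIn_eq_of_splitting {S : Type*} [TopologicalSpace S] {Ω U V : Set S}
    (hU : IsOpen U) (hV : IsOpen V) (hΩ : Ω ⊆ U ∪ V) (hdisj : Ω ∩ (U ∩ V) = ∅)
    (hc : IsPreconnected (Ω ∩ U)) {x : S} (hx : x ∈ Ω ∩ U) :
    connectedComponentIn Ω x = Ω ∩ U := by
  refine Subset.antisymm (subset_inter (connectedComponentIn_subset Ω x) ?_)
    (hc.subset_connectedComponentIn hx inter_subset_left)
  have hsub := connectedComponentIn_subset Ω x
  refine (isPreconnected_iff_subset_of_disjoint.1 isPreconnected_connectedComponentIn U V hU hV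
    (hsub.trans hΩ) (eq_empty_of_subset_empty ?_)).resolve_right fun h => ?_
  · exact (inter_subset_inter_left _ hsub).trans hdisj.le
  · have : x ∈ Ω ∩ (U ∩ V) := ⟨hx.1, hx.2, h (mem_connectedComponentIn hx.1)⟩
    rw [hdisj] at this
    exact this

/-- If an involution of `Ω` stabilizes no proper nonempty clopen subset, then `Ω` is connected or
has exactly two components, which are exchanged. -/
lemma components_of_no_invariant_splitting {S : Type*} [TopologicalSpace S] {Ω : Set S}
    {j : S → S} (hj : Function.Involutive j) (hjc : Continuous j) (hjΩ : ∀ m ∈ Ω, j m ∈ Ω)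
    (hinv : ∀ U V : Set S, IsOpen U → IsOpen V → Ω ⊆ U ∪ V → Ω ∩ (U ∩ V) = ∅ →
      (∀ m ∈ Ω, m ∈ U → j m ∈ U) → (∀ m ∈ Ω, m ∈ V → j m ∈ V) → Ω ∩ U = ∅ ∨ Ω ∩ V = ∅)
    (hΩ : ¬ IsPreconnected Ω) :
    ∃ M₁ M₂ : Set S, M₁ ≠ M₂ ∧ WeightedSurface.componentsOf Ω = {M₁, M₂} ∧
      M₁ = j '' M₂ ∧ M₂ = j '' M₁ := by
  simp only [isPreconnected_iff_subset_of_disjoint, not_forall, not_or] at hΩ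
  obtain ⟨U, V, hU, hV, hUV, hdisj, hnU, hnV⟩ := hΩ
  have hdis : ∀ m ∈ Ω, m ∈ U → m ∉ V := fun m hm h1 h2 =>
    (hdisj ▸ (⟨hm, h1, h2⟩ : m ∈ Ω ∩ (U ∩ V)) : m ∈ (∅ : Set S))
  have hneU : (Ω ∩ U).Nonempty := by
    obtain ⟨m, hm, hmV⟩ := not_subset.1 hnV
    exact ⟨m, hm, (hUV hm).resolve_right hmV⟩
  have hneV : (Ω ∩ V).Nonempty := by
    obtain ⟨m, hm, hmU⟩ := not_subset.1 hnU
    exact ⟨m, hm, (hUV hm).resolve_left hmU⟩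
  have hpre : ∀ {W : Set S}, IsOpen W → IsOpen (j ⁻¹' W) := fun hW => hW.preimage hjc
  have hVU : ∀ m ∈ Ω, m ∈ V → j m ∈ U := by
    intro m hm hmV
    by_contra hjm
    have hjmV := (hUV (hjΩ m hm)).resolve_left hjm
    -- If some point of `V` stays in `V`, this is a stable splitting with both pieces nonempty.
    have := hinv (U ∪ j ⁻¹' U) (V ∩ j ⁻¹' V) (hU.union (hpre hU)) (hV.inter (hpre hV))
      (fun y hy => by
        by_cases h1 : y ∈ U
        · exact Or.inl (Or.inl h1)
        · by_cases h2 : j y ∈ U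
          · exact Or.inl (Or.inr h2)
          · exact Or.inr ⟨(hUV hy).resolve_left h1, (hUV (hjΩ y hy)).resolve_left h2⟩)
      (eq_empty_of_forall_notMem fun y ⟨hy, h1, h2⟩ => h1.elim (fun h => hdis y hy h h2.1)
        fun h => hdis _ (hjΩ y hy) h h2.2)
      (fun y hy h => h.elim (fun h => Or.inr (by rwa [mem_preimage, hj])) fun h => Or.inl h)
      (fun y hy h => ⟨h.2, by rw [mem_preimage, hj]; exact h.1⟩)
    rcases this with h | h
    · obtain ⟨y, hy, hyU⟩ := hneU
      exact (h ▸ (⟨hy, Or.inl hyU⟩ : y ∈ Ω ∩ (U ∪ j ⁻¹' U)) : y ∈ (∅ : Set S))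
    · exact (h ▸ (⟨hm, hmV, hjmV⟩ : m ∈ Ω ∩ (V ∩ j ⁻¹' V)) : m ∈ (∅ : Set S))
  have hUV' : ∀ m ∈ Ω, m ∈ U → j m ∈ V := by
    intro m hm hmU
    by_contra hjm
    have hjmU := (hUV (hjΩ m hm)).resolve_right hjm
    have := hinv (V ∪ j ⁻¹' V) (U ∩ j ⁻¹' U) (hV.union (hpre hV)) (hU.inter (hpre hU))
      (fun y hy => by
        by_cases h1 : y ∈ V
        · exact Or.inl (Or.inl h1)
        · by_cases h2 : j y ∈ V
          · exact Or.inl (Or.inr h2)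
          · exact Or.inr ⟨(hUV hy).resolve_right h1, (hUV (hjΩ y hy)).resolve_right h2⟩)
      (eq_empty_of_forall_notMem fun y ⟨hy, h1, h2⟩ => h1.elim (fun h => hdis y hy h2.1 h)
        fun h => hdis _ (hjΩ y hy) h2.2 h)
      (fun y hy h => h.elim (fun h => Or.inr (by rwa [mem_preimage, hj])) fun h => Or.inl h)
      (fun y hy h => ⟨h.2, by rw [mem_preimage, hj]; exact h.1⟩)
    rcases this with h | h
    · obtain ⟨y, hy, hyV⟩ := hneV
      exact (h ▸ (⟨hy, Or.inl hyV⟩ : y ∈ Ω ∩ (V ∪ j ⁻¹' V)) : y ∈ (∅ : Set S))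
    · exact (h ▸ (⟨hm, hmU, hjmU⟩ : m ∈ Ω ∩ (U ∩ j ⁻¹' U)) : m ∈ (∅ : Set S))
  have himU : j '' (Ω ∩ U) = Ω ∩ V := by
    ext m
    constructor
    · rintro ⟨y, hy, rfl⟩
      exact ⟨hjΩ y hy.1, hUV' y hy.1 hy.2⟩
    · intro hm
      exact ⟨j m, ⟨hjΩ m hm.1, hVU m hm.1 hm.2⟩, hj m⟩
  have himV : j '' (Ω ∩ V) = Ω ∩ U := by
    rw [← himU, image_image]
    simp [hj _]
  have hpcU : IsPreconnected (Ω ∩ U) := by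
    rw [isPreconnected_iff_subset_of_disjoint]
    intro A B hA hB hAB hABd
    have hd : ∀ m, m ∈ Ω → m ∈ U → m ∈ A → m ∉ B := fun m h1 h2 h3 h4 =>
      (hABd ▸ (⟨⟨h1, h2⟩, h3, h4⟩ : m ∈ Ω ∩ U ∩ (A ∩ B)) : m ∈ (∅ : Set S))
    -- A splitting of Ω ∩ U by `A` and `B` is copied to Ω ∩ V by the involution, which makes it
    -- stable.
    have := hinv ((U ∩ A) ∪ j ⁻¹' (U ∩ A)) ((U ∩ B) ∪ j ⁻¹' (U ∩ B))
      ((hU.inter hA).union (hpre (hU.inter hA))) ((hU.inter hB).union (hpre (hU.inter hB)))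
      (fun y hy => by
        rcases hUV hy with h | h
        · exact (hAB ⟨hy, h⟩).imp (fun h' => Or.inl ⟨h, h'⟩) fun h' => Or.inl ⟨h, h'⟩
        · have h1 := hVU y hy h
          exact (hAB ⟨hjΩ y hy, h1⟩).imp (fun h' => Or.inr ⟨h1, h'⟩) fun h' => Or.inr ⟨h1, h'⟩)
      (eq_empty_of_forall_notMem fun y ⟨hy, h1, h2⟩ => by
        rcases h1 with h1 | h1 <;> rcases h2 with h2 | h2
        · exact hd y hy h1.1 h1.2 h2.2
        · exact hdis _ (hjΩ y hy) h2.1 (hUV' y hy h1.1)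
        · exact hdis _ (hjΩ y hy) h1.1 (hUV' y hy h2.1)
        · exact hd _ (hjΩ y hy) h1.1 h1.2 h2.2)
      (fun y hy h => h.elim (fun h => Or.inr (by rwa [mem_preimage, hj])) fun h => Or.inl h)
      (fun y hy h => h.elim (fun h => Or.inr (by rwa [mem_preimage, hj])) fun h => Or.inl h)
    rcases this with h | h
    · right
      intro m hm
      refine (hAB hm).resolve_left fun hmA => ?_
      exact (h ▸ (⟨hm.1, Or.inl ⟨hm.2, hmA⟩⟩ : m ∈ Ω ∩ _) : m ∈ (∅ : Set S))
    · left
      intro m hm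
      refine (hAB hm).resolve_right fun hmB => ?_
      exact (h ▸ (⟨hm.1, Or.inl ⟨hm.2, hmB⟩⟩ : m ∈ Ω ∩ _) : m ∈ (∅ : Set S))
  have hpcV : IsPreconnected (Ω ∩ V) := by
    rw [← himU]
    exact hpcU.image j hjc.continuousOn
  have hVUd : Ω ∩ (V ∩ U) = ∅ := by rwa [inter_comm V U]
  refine ⟨Ω ∩ U, Ω ∩ V, ?_, ?_, himV.symm, himU.symm⟩
  · intro h
    obtain ⟨y, hy, hyU⟩ := hneU
    exact hdis y hy hyU (h ▸ (⟨hy, hyU⟩ : y ∈ Ω ∩ U) : y ∈ Ω ∩ V).2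
  · ext B
    simp only [WeightedSurface.componentsOf, mem_ofPred_eq, mem_insert_iff, mem_singleton_iff]
    constructor
    · rintro ⟨x, hx, rfl⟩
      rcases hUV hx with h | h
      · exact Or.inl (connectedComponentIn_eq_of_splitting hU hV hUV hdisj hpcU ⟨hx, h⟩)
      · exact Or.inr (connectedComponentIn_eq_of_splitting hV hU (by rwa [union_comm]) hVUd hpcV
          ⟨hx, h⟩)
    · rintro (rfl | rfl)
      · obtain ⟨x, hx⟩ := hneU
        exact ⟨x, hx.1, (connectedComponentIn_eq_of_splitting hU hV hUV hdisj hpcU hx).symm⟩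
      · obtain ⟨x, hx⟩ := hneV
        exact ⟨x, hx.1, (connectedComponentIn_eq_of_splitting hV hU (by rwa [union_comm]) hVUd
          hpcV hx).symm⟩

/-- The open mapping theorem for a nonconstant entire function. -/
lemma Complex.isOpenMap_pow {n : ℕ} (hn : n ≠ 0) : IsOpenMap fun z : ℂ => z ^ n := by
  have h : AnalyticOnNhd ℂ (fun z : ℂ => z ^ n) univ := fun z _ => analyticAt_id.pow n
  rcases h.is_constant_or_isOpen isPreconnected_univ with ⟨c, hc⟩ | h
  · have h0 := hc 0 (mem_univ _)
    have h1 := hc 1 (mem_univ _)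
    simp only [zero_pow hn] at h0
    simp [← h0] at h1
  · exact fun U hU => h U (subset_univ _) hU

namespace WeightedSurface

variable {w : Fin 3 → ℕ+} {X : Set (Fin 3 → ℂ)}

lemma isOpenMap_powMap (w : Fin 3 → ℕ+) : IsOpenMap (powMap w) :=
  IsOpenMap.piMap (fun i => Complex.isOpenMap_pow (w i).ne_zero) (by simp)

/-! ### The affine model of the regular part of the curve -/

/-- The point `(a, b, 1)`. -/
def affinePt (q : ℂ × ℂ) : Fin 3 → ℂ := ![q.1, q.2, 1]

lemma affinePt_ne_zero (q : ℂ × ℂ) : affinePt q ≠ 0 := fun h => by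
  simpa [affinePt] using congrFun h 2

lemma continuous_affinePt : Continuous affinePt := by
  refine continuous_pi fun i => ?_
  fin_cases i <;> simp only [affinePt] <;> fun_prop

/-- The image of `M' - F` in the affine chart. -/
def affineCurve (w : Fin 3 → ℕ+) (X : Set (Fin 3 → ℂ)) : Set (ℂ × ℂ) :=
  {q | q.1 ≠ 0 ∧ q.2 ≠ 0 ∧ powMap w (affinePt q) ∈ X}

lemma IsConical.smul_mem_modification (hX : IsConical w X) {z : Fin 3 → ℂ}
    (hz : z ∈ modification w X) {c : ℂ} (hc : c ≠ 0) : c • z ∈ modification w X := by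
  have := hX (Units.mk0 c hc) _ hz
  rw [← powMap_smul] at this
  exact this

lemma IsConical.mem_modification_of_mk_mem_curve (hX : IsConical w X) {z : Fin 3 → ℂ} (hz : z ≠ 0)
    (h : Projectivization.mk ℂ z hz ∈ curve w X) : z ∈ modification w X := by
  obtain ⟨y, hy, hyz, hyX⟩ := h
  obtain ⟨a, ha⟩ := (Projectivization.mk_eq_mk_iff ℂ z y hz hy).1 hyz.symm
  rw [← ha]
  exact hX.smul_mem_modification hyX a.ne_zero

lemma mem_branchSet_iff {z : Fin 3 → ℂ} (hz : z ≠ 0) (h : Projectivization.mk ℂ z hz ∈ curve w X) :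
    (⟨Projectivization.mk ℂ z hz, h⟩ : curve w X) ∈ branchSet w X ↔ z 0 * z 1 * z 2 = 0 := by
  constructor
  · rintro ⟨y, hy, hyz, hy0⟩
    obtain ⟨a, ha⟩ := (Projectivization.mk_eq_mk_iff ℂ z y hz hy).1 hyz.symm
    have e : ∀ i, z i = (a : ℂ) * y i := fun i => by rw [← ha]; rfl
    rw [e, e, e]
    linear_combination (a : ℂ) ^ 3 * hy0
  · exact fun h0 => ⟨z, hz, rfl, h0⟩

/-- The affine coordinates on the projective plane. -/
def projCoords (p : CP2) : ℂ × ℂ := (p.rep 0 / p.rep 2, p.rep 1 / p.rep 2)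

lemma projCoords_mk {z : Fin 3 → ℂ} (hz : z ≠ 0) :
    projCoords (Projectivization.mk ℂ z hz) = (z 0 / z 2, z 1 / z 2) := by
  obtain ⟨a, ha⟩ := Projectivization.exists_smul_eq_mk_rep ℂ z hz
  have e : ∀ i, (Projectivization.mk ℂ z hz).rep i = (a : ℂ) * z i := fun i => by rw [← ha]; rfl
  simp only [projCoords, e]
  rw [mul_div_mul_left _ _ a.ne_zero, mul_div_mul_left _ _ a.ne_zero]

/-- The projection `ℂ³ - {0} → ℂP²`. -/
def projMk (z : {z : Fin 3 → ℂ // z ≠ 0}) : CP2 := Projectivization.mk ℂ z.1 z.2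

lemma continuous_projMk : Continuous projMk := continuous_quot_mk

lemma isOpenQuotientMap_projMk : IsOpenQuotientMap projMk := by
  refine ⟨fun p => ⟨⟨p.rep, p.rep_nonzero⟩, p.mk_rep⟩, continuous_projMk, fun U hU => ?_⟩
  have hq : IsQuotientMap projMk := isQuotientMap_quotient_mk'
  rw [← hq.isOpen_preimage]
  have e : projMk ⁻¹' (projMk '' U) = ⋃ a : ℂˣ,
      (fun z : {z : Fin 3 → ℂ // z ≠ 0} => (⟨a • z.1, (smul_ne_zero_iff_ne a).2 z.2⟩ :
        {z : Fin 3 → ℂ // z ≠ 0})) ⁻¹' U := by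
    ext z
    simp only [mem_preimage, mem_image, mem_iUnion]
    constructor
    · rintro ⟨y, hy, hyz⟩
      obtain ⟨a, ha⟩ := (Projectivization.mk_eq_mk_iff ℂ _ _ y.2 z.2).1 hyz
      refine ⟨a, ?_⟩
      convert hy
    · rintro ⟨a, ha⟩
      exact ⟨_, ha, (Projectivization.mk_eq_mk_iff ℂ _ _ _ z.2).2 ⟨a, rfl⟩⟩
  rw [e]
  refine isOpen_iUnion fun a => hU.preimage (Continuous.subtype_mk ?_ _)
  exact continuous_subtype_val.const_smul (a : ℂ)

lemma continuousAt_projCoords {z : Fin 3 → ℂ} (hz : z ≠ 0) (h2 : z 2 ≠ 0) :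
    ContinuousAt projCoords (Projectivization.mk ℂ z hz) := by
  have h := isOpenQuotientMap_projMk.continuousAt_comp_iff (g := projCoords) (x := ⟨z, hz⟩)
  refine h.1 ?_
  have e : projCoords ∘ projMk = fun y : {z : Fin 3 → ℂ // z ≠ 0} =>
      (y.1 0 / y.1 2, y.1 1 / y.1 2) := funext fun y => projCoords_mk y.2
  rw [e]
  have hc : ∀ i, ContinuousAt (fun y : {z : Fin 3 → ℂ // z ≠ 0} => y.1 i) ⟨z, hz⟩ := fun i =>
    ((continuous_apply i).comp continuous_subtype_val).continuousAt
  exact ((hc 0).div (hc 2) h2).prodMk ((hc 1).div (hc 2) h2)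

lemma affineCoords_eq (p : RegularCurve w X) : affineCoords w X p = projCoords p.1.1 := rfl

/-- The point of `M' - F` with affine coordinates `q`. -/
def ofAffine (w : Fin 3 → ℕ+) (X : Set (Fin 3 → ℂ)) (q : affineCurve w X) : RegularCurve w X :=
  ⟨⟨Projectivization.mk ℂ (affinePt q.1) (affinePt_ne_zero q.1), affinePt q.1,
    affinePt_ne_zero q.1, rfl, q.2.2.2⟩, fun h => by
    have := (mem_branchSet_iff _ _).1 h
    simp [affinePt, q.2.1, q.2.2.1] at this⟩

lemma affineCoords_ofAffine (q : affineCurve w X) : affineCoords w X (ofAffine w X q) = q.1 := by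
  rw [affineCoords_eq]
  change projCoords (Projectivization.mk ℂ (affinePt q.1) (affinePt_ne_zero q.1)) = q.1
  rw [projCoords_mk]
  simp [affinePt]

lemma IsConical.exists_ofAffine (hX : IsConical w X) (p : RegularCurve w X) :
    ∃ q, ofAffine w X q = p := by
  obtain ⟨⟨p, hp⟩, hpF⟩ := p
  induction p using Projectivization.ind with
  | h z hz =>
    have h0 : z 0 * z 1 * z 2 ≠ 0 := fun h => hpF ((mem_branchSet_iff hz hp).2 h)
    have h2 : z 2 ≠ 0 := right_ne_zero_of_mul h0
    have h1 : z 1 ≠ 0 := right_ne_zero_of_mul (left_ne_zero_of_mul h0)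
    have h0' : z 0 ≠ 0 := left_ne_zero_of_mul (left_ne_zero_of_mul h0)
    have e : affinePt (z 0 / z 2, z 1 / z 2) = (z 2)⁻¹ • z := by
      funext i
      fin_cases i <;> simp [affinePt, h2, div_eq_inv_mul]
    have hm : affinePt (z 0 / z 2, z 1 / z 2) ∈ modification w X := by
      rw [e]
      exact hX.smul_mem_modification (hX.mem_modification_of_mk_mem_curve hz hp) (inv_ne_zero h2)
    refine ⟨⟨(z 0 / z 2, z 1 / z 2), div_ne_zero h0' h2, div_ne_zero h1 h2, hm⟩, ?_⟩
    apply Subtype.ext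
    apply Subtype.ext
    exact (Projectivization.mk_eq_mk_iff ℂ _ _ _ _).2 ⟨(Units.mk0 _ h2)⁻¹, e.symm⟩

lemma IsConical.affineCoords_mem (hX : IsConical w X) (p : RegularCurve w X) :
    affineCoords w X p ∈ affineCurve w X := by
  obtain ⟨q, rfl⟩ := hX.exists_ofAffine p
  rw [affineCoords_ofAffine]
  exact q.2

/-- `M' - F` is homeomorphic to its image in the affine chart. -/
def IsConical.affineHomeo (hX : IsConical w X) : RegularCurve w X ≃ₜ affineCurve w X where
  toFun p := ⟨affineCoords w X p, hX.affineCoords_mem p⟩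
  invFun := ofAffine w X
  left_inv p := by
    obtain ⟨q, rfl⟩ := hX.exists_ofAffine p
    congr 1
    exact Subtype.ext (affineCoords_ofAffine q)
  right_inv q := Subtype.ext (affineCoords_ofAffine q)
  continuous_toFun := by
    refine Continuous.subtype_mk (continuous_iff_continuousAt.2 fun p => ?_) _
    obtain ⟨q, rfl⟩ := hX.exists_ofAffine p
    have h1 : ContinuousAt projCoords (ofAffine w X q).1.1 :=
      continuousAt_projCoords (affinePt_ne_zero q.1) (by simp [affinePt])
    exact ContinuousAt.comp (f := fun p : RegularCurve w X => p.1.1) h1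
      (continuous_subtype_val.comp continuous_subtype_val).continuousAt
  continuous_invFun := by
    refine Continuous.subtype_mk (Continuous.subtype_mk ?_ _) _
    exact continuous_projMk.comp
      (f := fun q : affineCurve w X => ⟨affinePt q.1, affinePt_ne_zero q.1⟩)
      (Continuous.subtype_mk (continuous_affinePt.comp continuous_subtype_val) _)

lemma IsConical.isEmbedding_affineCoords (hX : IsConical w X) :
    IsEmbedding (affineCoords w X) :=
  IsEmbedding.subtypeVal.comp hX.affineHomeo.isEmbedding

lemma IsConical.range_affineCoords (hX : IsConical w X) :
    range (affineCoords w X) = affineCurve w X := by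
  ext q
  constructor
  · rintro ⟨p, rfl⟩
    exact hX.affineCoords_mem p
  · exact fun hq => ⟨ofAffine w X ⟨q, hq⟩, affineCoords_ofAffine _⟩

/-- The point `φ (a, b, 1)` of `X - {0}`. -/
def affineLift (w : Fin 3 → ℕ+) (X : Set (Fin 3 → ℂ)) (q : affineCurve w X) : Punctured X :=
  ⟨powMap w (affinePt q.1), q.2.2.2, powMap_ne_zero w (affinePt_ne_zero q.1)⟩

lemma regularCover_ofAffine (q : affineCurve w X) :
    (regularCover w X (ofAffine w X q)).1 = orbitProj w X (affineLift w X q) :=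
  cover_mk w X (affinePt_ne_zero q.1) q.2.2.2

/-- The regular part of the orbit space consists of the orbits off the coordinate planes. -/
lemma mem_branchImage_iff (x : Punctured X) :
    orbitProj w X x ∈ branchImage w X ↔ x.1 0 * x.1 1 * x.1 2 = 0 := by
  constructor
  · rintro ⟨⟨p, hp⟩, hpF, hpx⟩
    obtain ⟨z, hz, rfl, hzX⟩ := hp
    rw [cover_mk w X hz hzX] at hpx
    obtain ⟨t, ht⟩ := orbitProj_eq_iff.1 hpx
    have h0 := (mem_branchSet_iff hz _).1 hpF
    have e : ∀ i, x.1 i = (t : ℂ) ^ (w i : ℕ) * z i ^ (w i : ℕ) := fun i => congrFun ht i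
    rw [e, e, e]
    rcases mul_eq_zero.1 h0 with h0 | h0
    · rcases mul_eq_zero.1 h0 with h0 | h0 <;> simp [h0]
    · simp [h0]
  · intro h0
    obtain ⟨z, hz⟩ := exists_powMap_eq w x.1
    have hz0 : z ≠ 0 := by
      rintro rfl
      exact x.2.2 (by rw [← hz]; funext i; exact zero_pow (w i).ne_zero)
    have hzX : z ∈ modification w X := by
      change powMap w z ∈ X
      rw [hz]
      exact x.2.1
    refine ⟨⟨Projectivization.mk ℂ z hz0, z, hz0, rfl, hzX⟩, ?_, ?_⟩
    · refine (mem_branchSet_iff hz0 _).2 ?_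
      have e : ∀ i, x.1 i = z i ^ (w i : ℕ) := fun i => by rw [← hz]; rfl
      rw [e, e, e] at h0
      simpa using h0
    · rw [cover_mk w X hz0 hzX]
      congr 1
      exact Subtype.ext hz

lemma regularCover_surjective :
    Function.Surjective (regularCover w X) := by
  rintro ⟨m, hm⟩
  obtain ⟨x, rfl⟩ := orbitProj_surjective m
  obtain ⟨z, hz⟩ := exists_powMap_eq w x.1
  have hz0 : z ≠ 0 := by
    rintro rfl
    exact x.2.2 (by rw [← hz]; funext i; exact zero_pow (w i).ne_zero)
  have hzX : z ∈ modification w X := by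
    change powMap w z ∈ X
    rw [hz]
    exact x.2.1
  have e : cover w X ⟨Projectivization.mk ℂ z hz0, z, hz0, rfl, hzX⟩ = orbitProj w X x := by
    rw [cover_mk w X hz0 hzX]
    congr 1
    exact Subtype.ext hz
  exact ⟨⟨⟨Projectivization.mk ℂ z hz0, z, hz0, rfl, hzX⟩, fun h => hm ⟨_, h, e⟩⟩, Subtype.ext e⟩

lemma continuous_regularCover (hX : IsConical w X) : Continuous (regularCover w X) := by
  rw [← hX.affineHomeo.symm.comp_continuous_iff']
  refine continuous_induced_rng.2 ?_
  have e : Subtype.val ∘ regularCover w X ∘ hX.affineHomeo.symm =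
      fun q => orbitProj w X (affineLift w X q) := funext regularCover_ofAffine
  rw [e]
  exact isQuotientMap_orbitProj.continuous.comp (Continuous.subtype_mk
    ((continuous_powMap w).comp (continuous_affinePt.comp continuous_subtype_val)) _)

/-- An open set of M' − F is the trace of an open cone in ℂ³, whose image under the open maps φ and
π cuts out the image in M − ϕ(F). -/
lemma isOpenMap_regularCover (hX : IsConical w X) : IsOpenMap (regularCover w X) := by
  intro U hU
  obtain ⟨O, hO, hOU⟩ := hX.isEmbedding_affineCoords.isInducing.isOpen_iff.1 hU
  set A : Set (Fin 3 → ℂ) := {z | z 0 ≠ 0 ∧ z 1 ≠ 0 ∧ z 2 ≠ 0 ∧ (z 0 / z 2, z 1 / z 2) ∈ O} with hA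
  have hAo : IsOpen A := by
    rw [isOpen_iff_mem_nhds]
    rintro z ⟨h0, h1, h2, hz⟩
    have hc : ∀ i, ContinuousAt (fun y : Fin 3 → ℂ => y i) z := fun i =>
      (continuous_apply i).continuousAt
    have h3 := (((hc 0).div (hc 2) h2).prodMk ((hc 1).div (hc 2) h2)).eventually (hO.mem_nhds hz)
    filter_upwards [(hc 0).eventually_ne h0, (hc 1).eventually_ne h1, (hc 2).eventually_ne h2, h3]
      with y h0 h1 h2 h3
    exact ⟨h0, h1, h2, h3⟩
  have hB : IsOpen (orbitProj w X '' (Subtype.val ⁻¹' (powMap w '' A))) :=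
    hX.isOpenMap_orbitProj _ ((isOpenMap_powMap w A hAo).preimage continuous_subtype_val)
  have e : regularCover w X '' U =
      Subtype.val ⁻¹' (orbitProj w X '' (Subtype.val ⁻¹' (powMap w '' A))) := by
    ext m
    constructor
    · rintro ⟨p, hp, rfl⟩
      obtain ⟨q, rfl⟩ := hX.exists_ofAffine p
      rw [← hOU, mem_preimage, affineCoords_ofAffine] at hp
      refine ⟨affineLift w X q, ⟨affinePt q.1, ⟨?_, ?_, ?_, ?_⟩, rfl⟩, (regularCover_ofAffine q).symm⟩
      · simpa [affinePt] using q.2.1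
      · simpa [affinePt] using q.2.2.1
      · simp [affinePt]
      · simpa [affinePt] using hp
    · rintro ⟨x, ⟨z, ⟨h0, h1, h2, hz⟩, hzx⟩, hxm⟩
      have hz0 : z ≠ 0 := fun h => h0 (by rw [h]; rfl)
      have hzX : z ∈ modification w X := by
        change powMap w z ∈ X
        rw [hzx]
        exact x.2.1
      have hb : (⟨Projectivization.mk ℂ z hz0, z, hz0, rfl, hzX⟩ : curve w X) ∉ branchSet w X := by
        exact fun h => mul_ne_zero (mul_ne_zero h0 h1) h2 ((mem_branchSet_iff hz0 _).1 h)
      refine ⟨⟨_, hb⟩, ?_, Subtype.ext ?_⟩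
      · rw [← hOU, mem_preimage, affineCoords_eq, projCoords_mk]
        exact hz
      · rw [← hxm]
        refine (cover_mk w X hz0 hzX).trans ?_
        congr 1
        exact Subtype.ext hzx
  rw [e]
  exact hB.preimage continuous_subtype_val

/-- Two points of `M' - F` have the same image if and only if their coordinates differ by a deck
transformation. -/
lemma regularCover_ofAffine_eq_iff {q q' : affineCurve w X} :
    regularCover w X (ofAffine w X q) = regularCover w X (ofAffine w X q') ↔
      ∃ t : ℂ, t ^ (w 2 : ℕ) = 1 ∧ q'.1.1 ^ (w 0 : ℕ) = t ^ (w 0 : ℕ) * q.1.1 ^ (w 0 : ℕ) ∧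
        q'.1.2 ^ (w 1 : ℕ) = t ^ (w 1 : ℕ) * q.1.2 ^ (w 1 : ℕ) := by
  rw [Subtype.ext_iff, regularCover_ofAffine, regularCover_ofAffine, orbitProj_eq_iff]
  constructor
  · rintro ⟨t, ht⟩
    refine ⟨t, ?_, ?_, ?_⟩
    · have := congrFun ht 2
      simpa [affineLift, powMap, weightedAction, affinePt] using this.symm
    · have := congrFun ht 0
      simpa [affineLift, powMap, weightedAction, affinePt] using this
    · have := congrFun ht 1
      simpa [affineLift, powMap, weightedAction, affinePt] using this
  · rintro ⟨t, h2, h0, h1⟩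
    have ht : t ≠ 0 := by
      rintro rfl
      rw [zero_pow (w 2).ne_zero] at h2
      exact zero_ne_one h2
    refine ⟨Units.mk0 t ht, ?_⟩
    funext i
    fin_cases i
    · simpa [affineLift, powMap, weightedAction, affinePt] using h0
    · simpa [affineLift, powMap, weightedAction, affinePt] using h1
    · simpa [affineLift, powMap, weightedAction, affinePt] using h2.symm

/-- Equal powers mean that the quotient is a root of unity; near (a, a) with a ≠ 0 it cannot be one
of the finitely many roots other than 1. -/
lemma eventually_eq_of_pow_eq {n : ℕ} (hn : 0 < n) {a : ℂ} (ha : a ≠ 0) :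
    ∀ᶠ p : ℂ × ℂ in 𝓝 (a, a), p.2 ^ n = p.1 ^ n → p.2 = p.1 := by
  classical
  have hZ : ∀ᶠ p : ℂ × ℂ in 𝓝 (a, a),
      ∀ ζ ∈ (Polynomial.nthRoots n (1 : ℂ)).toFinset.filter (· ≠ 1), p.2 ≠ ζ * p.1 := by
    refine (Filter.eventually_all_finset _).2 fun ζ hζ => ?_
    have hc : ContinuousAt (fun p : ℂ × ℂ => p.2 - ζ * p.1) (a, a) := by fun_prop
    have hne : a - ζ * a ≠ 0 := by
      intro h
      have h2 : (1 - ζ) * a = 0 := by linear_combination h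
      exact (Finset.mem_filter.1 hζ).2 (sub_eq_zero.1 ((mul_eq_zero.1 h2).resolve_right ha)).symm
    filter_upwards [hc.eventually_ne hne] with p hp h
    exact hp (sub_eq_zero.2 h)
  have h0 : ∀ᶠ p : ℂ × ℂ in 𝓝 (a, a), p.1 ≠ 0 := continuousAt_fst.eventually_ne ha
  filter_upwards [hZ, h0] with p hp hp0 hpn
  by_contra hne
  refine hp (p.2 / p.1) ?_ (by field_simp)
  rw [Finset.mem_filter, Multiset.mem_toFinset, Polynomial.mem_nthRoots hn, div_pow, hpn,
    div_self (pow_ne_zero _ hp0)]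
  refine ⟨rfl, fun h => hne ?_⟩
  rwa [div_eq_one_iff_eq hp0] at h

/-- The map is continuous and open, so local injectivity is what matters: two points with the same
image have coordinates whose powers of exponent w₁w₃ and w₂w₃ agree, and nearby nonzero numbers with
equal powers are equal. -/
lemma isLocalHomeomorph_regularCover (hX : IsConical w X) :
    IsLocalHomeomorph (regularCover w X) := by
  rw [isLocalHomeomorph_iff_isOpenEmbedding_restrict]
  intro p
  obtain ⟨q, rfl⟩ := hX.exists_ofAffine p
  have hc := hX.isEmbedding_affineCoords.continuous
  have h0 := eventually_eq_of_pow_eq (Nat.mul_pos (w 0).pos (w 2).pos) q.2.1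
  have h1 := eventually_eq_of_pow_eq (Nat.mul_pos (w 1).pos (w 2).pos) q.2.2.1
  have hc0 : Filter.Tendsto (fun p : RegularCurve w X × RegularCurve w X =>
      ((affineCoords w X p.1).1, (affineCoords w X p.2).1))
      (𝓝 (ofAffine w X q) ×ˢ 𝓝 (ofAffine w X q)) (𝓝 (q.1.1, q.1.1)) := by
    have : Continuous (fun p : RegularCurve w X × RegularCurve w X =>
      ((affineCoords w X p.1).1, (affineCoords w X p.2).1)) :=
      (continuous_fst.comp (hc.comp continuous_fst)).prodMk (continuous_fst.comp (hc.comp continuous_snd))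
    have h2 := this.tendsto (ofAffine w X q, ofAffine w X q)
    rwa [nhds_prod_eq, affineCoords_ofAffine] at h2
  have hc1 : Filter.Tendsto (fun p : RegularCurve w X × RegularCurve w X =>
      ((affineCoords w X p.1).2, (affineCoords w X p.2).2))
      (𝓝 (ofAffine w X q) ×ˢ 𝓝 (ofAffine w X q)) (𝓝 (q.1.2, q.1.2)) := by
    have : Continuous (fun p : RegularCurve w X × RegularCurve w X =>
      ((affineCoords w X p.1).2, (affineCoords w X p.2).2)) :=
      (continuous_snd.comp (hc.comp continuous_fst)).prodMk (continuous_snd.comp (hc.comp continuous_snd))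
    have h2 := this.tendsto (ofAffine w X q, ofAffine w X q)
    rwa [nhds_prod_eq, affineCoords_ofAffine] at h2
  obtain ⟨U, hU, hUe⟩ := Filter.mem_prod_self_iff.1
    ((hc0.eventually h0).and (hc1.eventually h1))
  obtain ⟨V, hVU, hVo, hqV⟩ := mem_nhds_iff.1 hU
  refine ⟨V, hVo.mem_nhds hqV, IsOpenEmbedding.of_continuous_injective_isOpenMap
    ((continuous_regularCover hX).comp continuous_subtype_val) ?_
    ((isOpenMap_regularCover hX).comp hVo.isOpenMap_subtype_val)⟩
  rintro ⟨p, hp⟩ ⟨p', hp'⟩ hpp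
  have hpp' : regularCover w X p = regularCover w X p' := hpp
  have huse := hUe (mk_mem_prod (hVU hp) (hVU hp'))
  obtain ⟨q, rfl⟩ := hX.exists_ofAffine p
  obtain ⟨q', rfl⟩ := hX.exists_ofAffine p'
  obtain ⟨t, ht2, ht0, ht1⟩ := regularCover_ofAffine_eq_iff.1 hpp'
  simp only [mem_ofPred_eq, affineCoords_ofAffine] at huse
  -- The factor `t` disappears after raising to the power `w 2`, as t^(w 2) = 1.
  have e0 : q'.1.1 = q.1.1 := huse.1 (by
    rw [pow_mul, ht0, mul_pow, ← pow_mul, mul_comm (w 0 : ℕ), pow_mul, ht2, one_pow, one_mul,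
      mul_comm (w 2 : ℕ), pow_mul])
  have e1 : q'.1.2 = q.1.2 := huse.2 (by
    rw [pow_mul, ht1, mul_pow, ← pow_mul, mul_comm (w 1 : ℕ), pow_mul, ht2, one_pow, one_mul,
      mul_comm (w 2 : ℕ), pow_mul])
  have : q = q' := Subtype.ext (Prod.ext e0.symm e1.symm)
  subst this
  rfl

end WeightedSurface

/-! ### One-dimensional complex submanifolds of `ℂ²` -/

section GraphChart

variable {S : Type*} [TopologicalSpace S] {ι : S → ℂ × ℂ}

/-- A chart of a subspace of `ℂ²` that describes it as the graph of a holomorphic function in some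
linear coordinates. -/
def IsGraphChart (ι : S → ℂ × ℂ) (e : OpenPartialHomeomorph S ℂ) : Prop :=
  ∃ (L : (ℂ × ℂ) ≃L[ℂ] (ℂ × ℂ)) (v : ℂ → ℂ), ContDiffOn ℂ ω v e.target ∧
    (∀ y ∈ e.source, e y = (L (ι y)).1) ∧ ∀ u ∈ e.target, ι (e.symm u) = L.symm (u, v u)

/-- Projection of the graph to its first coordinate is the chart. Its inverse, u ↦ (u, v u) read
back through the embedding, is continuous because the topology is induced from ℂ². -/
lemma Topology.IsEmbedding.exists_isGraphChart (hι : IsEmbedding ι) (s : S)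
    (L : (ℂ × ℂ) ≃L[ℂ] (ℂ × ℂ)) (v : ℂ → ℂ) {A B : Set ℂ} (hA : IsOpen A) (hB : IsOpen B)
    (hsA : (L (ι s)).1 ∈ A) (hsB : (L (ι s)).2 ∈ B) (hv : ContDiffOn ℂ ω v A) (hvB : MapsTo v A B)
    (h : ∀ u ∈ A, ∀ b ∈ B, L.symm (u, b) ∈ range ι ↔ v u = b) :
    ∃ e : OpenPartialHomeomorph S ℂ, s ∈ e.source ∧ IsGraphChart ι e := by
  have hr : ∀ u ∈ A, L.symm (u, v u) ∈ range ι := fun u hu => (h u hu _ (hvB hu)).2 rfl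
  have hex : ∀ u, ∃ y, u ∈ A → ι y = L.symm (u, v u) := fun u => by
    by_cases hu : u ∈ A
    · obtain ⟨y, hy⟩ := hr u hu
      exact ⟨y, fun _ => hy⟩
    · exact ⟨s, fun h => absurd h hu⟩
  choose g hg using hex
  have hgs : ∀ y, (L (ι y)).1 ∈ A → (L (ι y)).2 ∈ B → g (L (ι y)).1 = y := fun y hyA hyB => by
    apply hι.injective
    rw [hg _ hyA, (h _ hyA _ hyB).1 (by simp)]
    simp
  have hLι : Continuous fun y => L (ι y) := L.continuous.comp hι.continuous
  refine ⟨{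
    toFun y := (L (ι y)).1
    invFun := g
    source := {y | (L (ι y)).1 ∈ A ∧ (L (ι y)).2 ∈ B}
    target := A
    map_source' := fun y hy => hy.1
    map_target' := fun u hu => by
      simp only [mem_ofPred_eq, hg u hu, ContinuousLinearEquiv.apply_symm_apply]
      exact ⟨hu, hvB hu⟩
    left_inv' := fun y hy => hgs y hy.1 hy.2
    right_inv' := fun u hu => by simp [hg u hu]
    open_source := (hA.preimage (continuous_fst.comp hLι)).inter
      (hB.preimage (continuous_snd.comp hLι))
    open_target := hA
    continuousOn_toFun := (continuous_fst.comp hLι).continuousOn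
    continuousOn_invFun := by
      rw [hι.isInducing.continuousOn_iff]
      exact (L.symm.continuous.comp_continuousOn (continuousOn_id.prodMk hv.continuousOn)).congr
        fun u hu => hg u hu }, ⟨hsA, hsB⟩, L, v, hv, fun y _ => rfl, fun u hu => hg u hu⟩

/-- The holomorphic change of coordinates of `ℂ²` that straightens a graph. -/
def graphStraightening (L : (ℂ × ℂ) ≃L[ℂ] (ℂ × ℂ)) {v : ℂ → ℂ} {A : Set ℂ} (hA : IsOpen A)
    (hv : ContDiffOn ℂ ω v A) : OpenPartialHomeomorph (ℂ × ℂ) (ℂ × ℂ) where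
  toFun q := ((L q).1, (L q).2 - v (L q).1)
  invFun p := L.symm (p.1, p.2 + v p.1)
  source := {q | (L q).1 ∈ A}
  target := {p | p.1 ∈ A}
  map_source' q hq := hq
  map_target' p hp := by simpa using hp
  left_inv' q hq := by simp
  right_inv' p hp := by simp
  open_source := hA.preimage (continuous_fst.comp L.continuous)
  open_target := hA.preimage continuous_fst
  continuousOn_toFun := by
    have h1 : ContinuousOn (fun q => (L q).1) {q | (L q).1 ∈ A} := by fun_prop
    have h2 : ContinuousOn (fun q => (L q).2) {q | (L q).1 ∈ A} := by fun_prop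
    exact h1.prodMk (h2.sub (hv.continuousOn.comp h1 fun q hq => hq))
  continuousOn_invFun :=
    L.symm.continuous.comp_continuousOn (continuousOn_fst.prodMk
      (continuousOn_snd.add (hv.continuousOn.comp continuousOn_fst fun q hq => hq)))

lemma graphStraightening_mem_maximalAtlas (L : (ℂ × ℂ) ≃L[ℂ] (ℂ × ℂ)) {v : ℂ → ℂ} {A : Set ℂ}
    (hA : IsOpen A) (hv : ContDiffOn ℂ ω v A) :
    graphStraightening L hA hv ∈ IsManifold.maximalAtlas 𝓘(ℂ, ℂ × ℂ) ω (ℂ × ℂ) := by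
  refine StructureGroupoid.mem_maximalAtlas_of_mem_groupoid _ ?_
  have h0 : ∀ s, ContDiffOn ℂ ω (fun q : ℂ × ℂ => (L q).1) s := fun s =>
    (contDiff_fst.comp L.contDiff).contDiffOn
  have h1 : ∀ s, ContDiffOn ℂ ω (fun q : ℂ × ℂ => (L q).2) s := fun s =>
    (contDiff_snd.comp L.contDiff).contDiffOn
  refine mem_groupoid_of_pregroupoid.2 ⟨?_, ?_⟩
  · change ContDiffOn ℂ ω (fun q => ((L q).1, (L q).2 - v (L q).1)) ({q | (L q).1 ∈ A} ∩ range id)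
    rw [range_id, inter_univ]
    exact (h0 _).prodMk ((h1 _).sub (hv.comp (h0 _) fun q hq => hq))
  · change ContDiffOn ℂ ω (fun p : ℂ × ℂ => L.symm (p.1, p.2 + v p.1)) ({p | p.1 ∈ A} ∩ range id)
    rw [range_id, inter_univ]
    exact L.symm.contDiff.comp_contDiffOn (contDiffOn_fst.prodMk
      (contDiffOn_snd.add (hv.comp contDiffOn_fst fun q hq => hq)))

/-- A subspace of `ℂ²` that is locally the graph of a holomorphic function is a complex
submanifold. -/
theorem exists_chartedSpace_isSmoothEmbedding (hι : IsEmbedding ι)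
    (h : ∀ s, ∃ e : OpenPartialHomeomorph S ℂ, s ∈ e.source ∧ IsGraphChart ι e) :
    ∃ C : ChartedSpace ℂ S, letI := C
      IsManifold 𝓘(ℂ, ℂ) ω S ∧ Manifold.IsSmoothEmbedding 𝓘(ℂ, ℂ) 𝓘(ℂ, ℂ × ℂ) ω ι := by
  choose c hc hcg using h
  let C : ChartedSpace ℂ S :=
    { atlas := {e | IsGraphChart ι e}
      chartAt := c
      mem_chart_source := hc
      chart_mem_atlas := hcg }
  have hM : IsManifold 𝓘(ℂ, ℂ) ω S := by
    refine isManifold_of_contDiffOn _ _ _ ?_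
    rintro e e' ⟨L, v, hv, he, hes⟩ ⟨L', v', hv', he', hes'⟩
    have h1 : ContDiffOn ℂ ω (fun u => (L' (L.symm (u, v u))).1) e.target :=
      contDiff_fst.comp_contDiffOn (L'.contDiff.comp_contDiffOn
        (L.symm.contDiff.comp_contDiffOn (contDiffOn_id.prodMk hv)))
    refine (h1.mono ?_).congr ?_
    · intro u hu
      exact hu.1.1
    · intro u hu
      change e' (e.symm u) = _
      have h2 : e.symm u ∈ e'.source := hu.1.2
      have h3 : u ∈ e.target := hu.1.1
      rw [he' _ h2, hes _ h3]
  refine ⟨C, hM, ⟨?_, hι⟩⟩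
  have himm : Manifold.IsImmersionOfComplement ℂ 𝓘(ℂ, ℂ) 𝓘(ℂ, ℂ × ℂ) ω ι := by
    intro s
    obtain ⟨L, v, hv, he, hes⟩ := hcg s
    refine Manifold.IsImmersionAtOfComplement.mk_of_continuousAt hι.continuous.continuousAt
      (ContinuousLinearEquiv.refl ℂ (ℂ × ℂ)) (c s) (graphStraightening L (c s).open_target hv)
      (hc s) ?_ (IsManifold.subset_maximalAtlas (hcg s))
      (graphStraightening_mem_maximalAtlas L _ hv) ?_
    · change (L (ι s)).1 ∈ (c s).target
      rw [← he s (hc s)]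
      exact (c s).map_source (hc s)
    · intro u hu
      have hu' : u ∈ (c s).target := by simpa using hu
      change ((L (ι ((c s).symm u))).1, (L (ι ((c s).symm u))).2 - v (L (ι ((c s).symm u))).1) = (u, 0)
      rw [hes u hu']
      simp
  exact himm.isImmersion

end GraphChart

/-! ### The regular curve as a complex submanifold -/

namespace WeightedSurface

variable {w : Fin 3 → ℕ+} {X : Set (Fin 3 → ℂ)}

lemma affinePt_contDiff : ContDiff ℂ ω affinePt := by
  refine contDiff_pi.2 fun i => ?_
  fin_cases i
  · exact contDiff_fst
  · exact contDiff_snd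
  · exact contDiff_const

lemma contDiff_powMap (w : Fin 3 → ℕ+) : ContDiff ℂ ω (powMap w) :=
  contDiff_pi.2 fun i => (contDiff_apply ℂ ℂ i).pow _

lemma fderiv_comp_powMap_affinePt {h : (Fin 3 → ℂ) → ℂ} (hc : ContDiff ℂ ω h) (q d : ℂ × ℂ) :
    fderiv ℂ (fun p => h (powMap w (affinePt p))) q d =
      fderiv ℂ h (powMap w (affinePt q))
        ![(w 0 : ℕ) * q.1 ^ ((w 0 : ℕ) - 1) * d.1, (w 1 : ℕ) * q.2 ^ ((w 1 : ℕ) - 1) * d.2, 0] := by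
  have h1 : HasFDerivAt (fun p : ℂ × ℂ => powMap w (affinePt p)) (ContinuousLinearMap.pi
      ![((w 0 : ℕ) * q.1 ^ ((w 0 : ℕ) - 1)) • ContinuousLinearMap.fst ℂ ℂ ℂ,
        ((w 1 : ℕ) * q.2 ^ ((w 1 : ℕ) - 1)) • ContinuousLinearMap.snd ℂ ℂ ℂ, 0]) q := by
    refine hasFDerivAt_pi.2 fun i => ?_
    fin_cases i
    · exact (hasDerivAt_pow (w 0 : ℕ) q.1).comp_hasFDerivAt q hasFDerivAt_fst
    · exact (hasDerivAt_pow (w 1 : ℕ) q.2).comp_hasFDerivAt q hasFDerivAt_snd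
    · simpa [powMap, affinePt] using hasFDerivAt_const (1 : ℂ) q
  have h2 := ((hc.differentiable (by simp)) (powMap w (affinePt q))).hasFDerivAt.comp q h1
  have h3 : fderiv ℂ (fun p => h (powMap w (affinePt p))) q = _ := h2.fderiv
  rw [h3, ContinuousLinearMap.comp_apply]
  congr 1
  funext i
  fin_cases i <;> simp

/-- Near a point of the affine curve where some partial derivative of a defining function does not
vanish, the curve is the graph of a holomorphic function. -/
lemma IsConical.exists_isGraphChart (hX : IsConical w X)
    (hpart : ∀ x : Punctured X, ∃ l, HasPartial X x.1 l) (p : RegularCurve w X) :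
    ∃ e : OpenPartialHomeomorph (RegularCurve w X) ℂ,
      p ∈ e.source ∧ IsGraphChart (affineCoords w X) e := by
  obtain ⟨q, rfl⟩ := hX.exists_ofAffine p
  have hx2 : (affineLift w X q).1 2 ≠ 0 := by simp [affineLift, powMap, affinePt]
  -- Transversality to the slice of constant third coordinate gives a nonzero partial derivative in
  -- one of the other two, as needed in the chart z₃ = 1.
  obtain ⟨l, hl2, h, hc, hX0, hd⟩ := hX.exists_hasPartial_ne (affineLift w X q).2.1 hx2 (hpart _)
  have hopen : ∀ᶠ p in 𝓝 q.1, p ∈ affineCurve w X ↔ h (powMap w (affinePt p)) = 0 := by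
    filter_upwards [continuousAt_fst.eventually_ne q.2.1, continuousAt_snd.eventually_ne q.2.2.1]
      with p h1 h2
    rw [hX0]
    exact ⟨fun hp => hp.2.2, fun hp => ⟨h1, h2, hp⟩⟩
  have hH : ContDiff ℂ ω fun p => h (powMap w (affinePt p)) :=
    hc.comp ((contDiff_powMap w).comp affinePt_contDiff)
  -- The affine coordinates are swapped if necessary, so that the equation can be solved for the
  -- second one. The powers introduced by φ contribute the factor w·a^(w−1), nonzero because a ≠ 0.
  have key : ∃ L : (ℂ × ℂ) ≃L[ℂ] (ℂ × ℂ),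
      fderiv ℂ (fun p => h (powMap w (affinePt p))) q.1 (L.symm (0, 1)) ≠ 0 := by
    have hcoef : ∀ (i : Fin 3) (a : ℂ), a ≠ 0 → ((w i : ℕ) : ℂ) * a ^ ((w i : ℕ) - 1) ≠ 0 :=
      fun i a ha => mul_ne_zero (Nat.cast_ne_zero.2 (w i).ne_zero) (pow_ne_zero _ ha)
    fin_cases l
    · refine ⟨ContinuousLinearEquiv.prodComm ℂ ℂ ℂ, ?_⟩
      rw [fderiv_comp_powMap_affinePt hc]
      have e : (![(w 0 : ℕ) * q.1.1 ^ ((w 0 : ℕ) - 1) * (1 : ℂ),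
          (w 1 : ℕ) * q.1.2 ^ ((w 1 : ℕ) - 1) * 0, 0] : Fin 3 → ℂ) =
          ((w 0 : ℕ) * q.1.1 ^ ((w 0 : ℕ) - 1)) • Pi.single 0 1 := by
        funext i
        fin_cases i <;> simp
      change fderiv ℂ h _ (![_ * _ * (1 : ℂ), _ * _ * (0 : ℂ), 0]) ≠ 0
      rw [e, map_smul]
      exact smul_ne_zero (hcoef 0 _ q.2.1) hd
    · refine ⟨ContinuousLinearEquiv.refl ℂ _, ?_⟩
      rw [fderiv_comp_powMap_affinePt hc]
      have e : (![(w 0 : ℕ) * q.1.1 ^ ((w 0 : ℕ) - 1) * (0 : ℂ),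
          (w 1 : ℕ) * q.1.2 ^ ((w 1 : ℕ) - 1) * 1, 0] : Fin 3 → ℂ) =
          ((w 1 : ℕ) * q.1.2 ^ ((w 1 : ℕ) - 1)) • Pi.single 1 1 := by
        funext i
        fin_cases i <;> simp
      change fderiv ℂ h _ (![_ * _ * (0 : ℂ), _ * _ * (1 : ℂ), 0]) ≠ 0
      rw [e, map_smul]
      exact smul_ne_zero (hcoef 1 _ q.2.2.1) hd
    · exact absurd rfl hl2
  obtain ⟨L, hL⟩ := key
  have hq : h (powMap w (affinePt q.1)) = 0 := (hX0 _).2 q.2.2.2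
  have hLq : L.symm (L q.1) = q.1 := L.symm_apply_apply _
  obtain ⟨v, ε, δ, hε, hδ, hvq, hv, hvB, hgr, -⟩ := exists_implicit_graph
    (H := fun p => h (powMap w (affinePt (L.symm p)))) (p := L q.1)
    (hH.comp L.symm.contDiff) (by rw [hLq]; exact hq) (Z := {p | L.symm p ∈ affineCurve w X})
    (by
      have ht : Filter.Tendsto L.symm (𝓝 (L q.1)) (𝓝 q.1) := by
        have := L.symm.continuous.tendsto (L q.1)
        rwa [hLq] at this
      exact ht.eventually hopen)
    (by
      have h1 : HasFDerivAt (fun p => h (powMap w (affinePt p)))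
          (fderiv ℂ (fun p => h (powMap w (affinePt p))) q.1) (L.symm (L q.1)) := by
        rw [hLq]
        exact (hH.differentiable (by simp) _).hasFDerivAt
      have h2 : fderiv ℂ (fun p => h (powMap w (affinePt (L.symm p)))) (L q.1) = _ :=
        (h1.comp (L q.1) L.symm.hasFDerivAt).fderiv
      rw [h2]
      exact hL)
  have hιq := affineCoords_ofAffine q
  refine hX.isEmbedding_affineCoords.exists_isGraphChart _ L v Metric.isOpen_ball
    Metric.isOpen_ball (A := Metric.ball (L q.1).1 ε) (B := Metric.ball (L q.1).2 δ) ?_ ?_ hv hvB ?_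
  · rw [hιq]
    exact Metric.mem_ball_self hε
  · rw [hιq]
    exact Metric.mem_ball_self hδ
  · intro u hu b hb
    rw [hX.range_affineCoords]
    exact hgr u hu b hb

lemma IsConical.exists_isSubmanifoldStructure (hX : IsConical w X)
    (hpart : ∀ x : Punctured X, ∃ l, HasPartial X x.1 l) :
    ∃ C, IsSubmanifoldStructure w X C :=
  exists_chartedSpace_isSmoothEmbedding hX.isEmbedding_affineCoords (hX.exists_isGraphChart hpart)

end WeightedSurface

/-! ### Quotients of complex curves by local biholomorphisms -/

section PushForward

variable {S T : Type*} [TopologicalSpace S] [TopologicalSpace T] {p : S → T}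

/-- Both sides are continuous local sections of `p` with the same value at `t`; near `t` they stay
in the source of `h'`, where `p` is injective. -/
lemma eventually_symm_eq_comp_symm {h h' : OpenPartialHomeomorph S T} (hh : p = h) (hh' : p = h')
    {t : T} (ht : t ∈ h.target) (ht' : t ∈ h'.target) {σ : S → S} (hσ : Continuous σ)
    (hσt : σ (h.symm t) = h'.symm t) (hpσ : ∀ x, p (σ x) = p x) :
    ∀ᶠ t' in 𝓝 t, h'.symm t' = σ (h.symm t') := by
  have hc : ContinuousAt (fun t' => σ (h.symm t')) t :=
    hσ.continuousAt.comp (h.continuousAt_symm ht)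
  have hm : σ (h.symm t) ∈ h'.source := by
    rw [hσt]
    exact h'.map_target ht'
  filter_upwards [h.open_target.mem_nhds ht, hc.eventually_mem (h'.open_source.mem_nhds hm)]
    with t' h1 h2
  have h3 : h' (σ (h.symm t')) = t' := by
    rw [← hh', hpσ, hh, h.right_inv h1]
  rw [← h'.left_inv h2, h3]

/-- If the fibres of a surjective local homeomorphism are the orbits of holomorphic deck
transformations, then the complex structure descends. -/
theorem exists_chartedSpace_isLocalDiffeomorph [ChartedSpace ℂ S] [IsManifold 𝓘(ℂ, ℂ) ω S]
    (hp : IsLocalHomeomorph p) (hs : Function.Surjective p)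
    (hdeck : ∀ x y, p x = p y →
      ∃ σ : S → S, ContMDiff 𝓘(ℂ, ℂ) 𝓘(ℂ, ℂ) ω σ ∧ σ x = y ∧ ∀ z, p (σ z) = p z) :
    ∃ C : ChartedSpace ℂ T, letI := C
      IsManifold 𝓘(ℂ, ℂ) ω T ∧ IsLocalDiffeomorph 𝓘(ℂ, ℂ) 𝓘(ℂ, ℂ) ω p := by
  have hsec : ∀ (h h' : OpenPartialHomeomorph S T), p = h → p = h' → ∀ t ∈ h.target, t ∈ h'.target →
      ∃ σ : S → S, ContMDiff 𝓘(ℂ, ℂ) 𝓘(ℂ, ℂ) ω σ ∧ σ (h.symm t) = h'.symm t ∧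
        ∀ᶠ t' in 𝓝 t, h'.symm t' = σ (h.symm t') := by
    intro h h' hh hh' t ht ht'
    have e1 : p (h.symm t) = t := by rw [hh, h.right_inv ht]
    have e2 : p (h'.symm t) = t := by rw [hh', h'.right_inv ht']
    obtain ⟨σ, hσ, hσt, hpσ⟩ := hdeck (h.symm t) (h'.symm t) (e1.trans e2.symm)
    exact ⟨σ, hσ, hσt, eventually_symm_eq_comp_symm hh hh' ht ht' hσ.continuous hσt hpσ⟩
  have hch : ∀ t, ∃ e : OpenPartialHomeomorph T ℂ, t ∈ e.source ∧ ∃ h : OpenPartialHomeomorph S T,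
      p = h ∧ ∃ c ∈ atlas ℂ S, e = h.symm.trans c := by
    intro t
    obtain ⟨x, rfl⟩ := hs t
    obtain ⟨h, hx, hh⟩ := hp x
    refine ⟨h.symm.trans (chartAt ℂ x), ?_, h, hh, _, chart_mem_atlas ℂ x, rfl⟩
    rw [hh]
    refine ⟨h.map_source hx, ?_⟩
    change h.symm (h x) ∈ (chartAt ℂ x).source
    rw [h.left_inv hx]
    exact mem_chart_source ℂ x
  choose c hc hcp using hch
  let C : ChartedSpace ℂ T :=
    { atlas := {e | ∃ h : OpenPartialHomeomorph S T, p = h ∧ ∃ c ∈ atlas ℂ S, e = h.symm.trans c}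
      chartAt := c
      mem_chart_source := hc
      chart_mem_atlas := hcp }
  have hon : ∀ e ∈ atlas ℂ S, ContMDiffOn 𝓘(ℂ, ℂ) 𝓘(ℂ, ℂ) ω e e.source := fun e he =>
    contMDiffOn_of_mem_maximalAtlas (IsManifold.subset_maximalAtlas he)
  have hson : ∀ e ∈ atlas ℂ S, ContMDiffOn 𝓘(ℂ, ℂ) 𝓘(ℂ, ℂ) ω e.symm e.target := fun e he =>
    contMDiffOn_symm_of_mem_maximalAtlas (IsManifold.subset_maximalAtlas he)
  have hM : IsManifold 𝓘(ℂ, ℂ) ω T := by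
    refine isManifold_of_contDiffOn _ _ _ ?_
    rintro e e' ⟨h, hh, k, hk, rfl⟩ ⟨h', hh', k', hk', rfl⟩ u hu
    refine ContDiffAt.contDiffWithinAt ?_
    have hu1 : u ∈ k.target := hu.1.1.1
    have hu2 : k.symm u ∈ h.source := hu.1.1.2
    have hu3 : h (k.symm u) ∈ h'.target := hu.1.2.1
    have hu4 : h'.symm (h (k.symm u)) ∈ k'.source := hu.1.2.2
    -- Two local sections differ by a deck transformation, so the transition map is locally k' ∘ σ ∘
    -- k⁻¹.
    obtain ⟨σ, hσ, hσt, hσe⟩ := hsec h h' hh hh' _ (h.map_source hu2) hu3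
    rw [h.left_inv hu2] at hσt
    have h1 : ContMDiffAt 𝓘(ℂ, ℂ) 𝓘(ℂ, ℂ) ω (fun u => k' (σ (k.symm u))) u := by
      have a1 := (hson k hk).contMDiffAt (k.open_target.mem_nhds hu1)
      have a2 : ContMDiffAt 𝓘(ℂ, ℂ) 𝓘(ℂ, ℂ) ω k' (σ (k.symm u)) := by
        rw [hσt]
        exact (hon k' hk').contMDiffAt (k'.open_source.mem_nhds hu4)
      exact ContMDiffAt.comp u (f := fun u => σ (k.symm u)) a2
        (ContMDiffAt.comp u (f := k.symm) hσ.contMDiffAt a1)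
    refine (contMDiffAt_iff_contDiffAt.1 h1).congr_of_eventuallyEq ?_
    have hks : ContinuousAt k.symm u := k.continuousAt_symm hu1
    have ht : Filter.Tendsto (fun u => h (k.symm u)) (𝓝 u) (𝓝 (h (k.symm u))) :=
      (h.continuousAt hu2).comp hks
    filter_upwards [ht.eventually hσe, hks.eventually_mem (h.open_source.mem_nhds hu2)] with u' h1 h2
    change k' (h'.symm (h (k.symm u'))) = _
    rw [h1, h.left_inv h2]
  refine ⟨C, hM, fun x => ?_⟩
  have hTon : ∀ t, ContMDiffAt 𝓘(ℂ, ℂ) 𝓘(ℂ, ℂ) ω (c t) t := fun t =>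
    (contMDiffOn_of_mem_maximalAtlas (IsManifold.subset_maximalAtlas (hcp t))).contMDiffAt
      ((c t).open_source.mem_nhds (hc t))
  have hTson : ∀ t, ContMDiffAt 𝓘(ℂ, ℂ) 𝓘(ℂ, ℂ) ω (c t).symm (c t t) := fun t =>
    (contMDiffOn_symm_of_mem_maximalAtlas (IsManifold.subset_maximalAtlas (hcp t))).contMDiffAt
      ((c t).open_target.mem_nhds ((c t).map_source (hc t)))
  obtain ⟨h, hx, hh⟩ := hp x
  refine ⟨{ toPartialEquiv := h.toPartialEquiv
            open_source := h.open_source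
            open_target := h.open_target
            contMDiffOn_toFun := ?_
            contMDiffOn_invFun := ?_ }, hx, fun y _ => congrFun hh y⟩
  · intro z hz
    refine ContMDiffAt.contMDiffWithinAt ?_
    change ContMDiffAt 𝓘(ℂ, ℂ) 𝓘(ℂ, ℂ) ω h z
    obtain ⟨h', hh', k, hk, hck⟩ := hcp (h z)
    have hcs := hc (h z)
    rw [hck] at hcs
    have hz' : h z ∈ h'.target := hcs.1
    have hzk : h'.symm (h z) ∈ k.source := hcs.2
    obtain ⟨σ, hσ, hσt, hσe⟩ := hsec h h' hh hh' _ (h.map_source hz) hz'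
    rw [h.left_inv hz] at hσt
    have a1 : ContMDiffAt 𝓘(ℂ, ℂ) 𝓘(ℂ, ℂ) ω (fun y => k (σ y)) z := by
      refine ContMDiffAt.comp z (f := σ) ?_ hσ.contMDiffAt
      rw [hσt]
      exact (hon k hk).contMDiffAt (k.open_source.mem_nhds hzk)
    have a2 : ContMDiffAt 𝓘(ℂ, ℂ) 𝓘(ℂ, ℂ) ω (fun y => (c (h z)).symm (k (σ y))) z := by
      refine ContMDiffAt.comp z (f := fun y => k (σ y)) ?_ a1
      have e : k (σ z) = c (h z) (h z) := by
        rw [hσt, hck]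
        rfl
      rw [e]
      exact hTson _
    refine a2.congr_of_eventuallyEq ?_
    have hhc := h.continuousAt hz
    filter_upwards [hhc.eventually hσe, h.open_source.mem_nhds hz,
      hhc.eventually_mem ((c (h z)).open_source.mem_nhds (hc (h z)))] with y h1 h2 h3
    rw [h.left_inv h2] at h1
    have e : k (σ y) = c (h z) (h y) := by
      rw [← h1, hck]
      rfl
    rw [e, (c (h z)).left_inv h3]
  · intro t ht
    refine ContMDiffAt.contMDiffWithinAt ?_
    change ContMDiffAt 𝓘(ℂ, ℂ) 𝓘(ℂ, ℂ) ω h.symm t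
    obtain ⟨h', hh', k, hk, hck⟩ := hcp t
    have hcs := hc t
    rw [hck] at hcs
    have ht' : t ∈ h'.target := hcs.1
    have htk : h'.symm t ∈ k.source := hcs.2
    obtain ⟨σ, hσ, hσt, hσe⟩ := hsec h' h hh' hh t ht' ht
    have e : ∀ t', c t t' = k (h'.symm t') := fun t' => by
      rw [hck]
      rfl
    have a1 : ContMDiffAt 𝓘(ℂ, ℂ) 𝓘(ℂ, ℂ) ω (fun t' => σ (k.symm (c t t'))) t := by
      refine ContMDiffAt.comp t (f := fun t' => k.symm (c t t')) hσ.contMDiffAt ?_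
      refine ContMDiffAt.comp t (f := c t) ?_ (hTon t)
      refine (hson k hk).contMDiffAt (k.open_target.mem_nhds ?_)
      rw [e]
      exact k.map_source htk
    refine a1.congr_of_eventuallyEq ?_
    filter_upwards [hσe, (h'.continuousAt_symm ht').eventually_mem (k.open_source.mem_nhds htk)]
      with t' h1 h2
    rw [h1, e, k.left_inv h2]

end PushForward

/-! ### Deck transformations and the induced structure -/

namespace WeightedSurface

variable {w : Fin 3 → ℕ+} {X : Set (Fin 3 → ℂ)}

/-- The transformation `(a, b) ↦ (λ a, μ b)` of the affine curve, where
`λ ^ w₁ = t ^ w₁`, `μ ^ w₂ = t ^ w₂` for some `t` with `t ^ w₃ = 1`. -/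
def affineDeck (hX : IsConical w X) {l m t : ℂ} (ht : t ^ (w 2 : ℕ) = 1)
    (hl : l ^ (w 0 : ℕ) = t ^ (w 0 : ℕ)) (hm : m ^ (w 1 : ℕ) = t ^ (w 1 : ℕ)) (q : affineCurve w X) :
    affineCurve w X :=
  have ht0 : t ≠ 0 := by
    rintro rfl
    rw [zero_pow (w 2).ne_zero] at ht
    exact zero_ne_one ht
  ⟨(l * q.1.1, m * q.1.2),
    mul_ne_zero (fun h => by
      rw [h, zero_pow (w 0).ne_zero] at hl
      exact pow_ne_zero _ ht0 hl.symm) q.2.1,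
    mul_ne_zero (fun h => by
      rw [h, zero_pow (w 1).ne_zero] at hm
      exact pow_ne_zero _ ht0 hm.symm) q.2.2.1, by
    have h := hX (Units.mk0 t ht0) _ q.2.2.2
    convert h using 1
    funext i
    fin_cases i
    · simp [powMap, weightedAction, affinePt, mul_pow, hl]
    · simp [powMap, weightedAction, affinePt, mul_pow, hm]
    · simp [powMap, weightedAction, affinePt, ht]⟩

/-- The ratios of the coordinates of the two points serve as λ and μ. The resulting map is the
restriction of a linear map of ℂ², hence holomorphic on the submanifold. -/
lemma exists_deck (hX : IsConical w X) {C : ChartedSpace ℂ (RegularCurve w X)}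
    (hC : IsSubmanifoldStructure w X C) (x y : RegularCurve w X)
    (hxy : regularCover w X x = regularCover w X y) :
    ∃ σ : RegularCurve w X → RegularCurve w X, ContMDiff 𝓘(ℂ, ℂ) 𝓘(ℂ, ℂ) ω σ ∧ σ x = y ∧
      ∀ z, regularCover w X (σ z) = regularCover w X z := by
  obtain ⟨q, rfl⟩ := hX.exists_ofAffine x
  obtain ⟨q', rfl⟩ := hX.exists_ofAffine y
  obtain ⟨t, ht2, ht0, ht1⟩ := regularCover_ofAffine_eq_iff.1 hxy
  have hl : (q'.1.1 / q.1.1) ^ (w 0 : ℕ) = t ^ (w 0 : ℕ) := by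
    rw [div_pow, ht0, mul_div_cancel_right₀ _ (pow_ne_zero _ q.2.1)]
  have hm : (q'.1.2 / q.1.2) ^ (w 1 : ℕ) = t ^ (w 1 : ℕ) := by
    rw [div_pow, ht1, mul_div_cancel_right₀ _ (pow_ne_zero _ q.2.2.1)]
  set σ : RegularCurve w X → RegularCurve w X := fun z =>
    ofAffine w X (affineDeck hX ht2 hl hm (hX.affineHomeo z)) with hσ
  have hcoe : ∀ z, affineCoords w X (σ z) = ((q'.1.1 / q.1.1) * (affineCoords w X z).1,
      (q'.1.2 / q.1.2) * (affineCoords w X z).2) := fun z => affineCoords_ofAffine _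
  have hm' : ContDiff ℂ ω fun p : ℂ × ℂ => ((q'.1.1 / q.1.1) * p.1, (q'.1.2 / q.1.2) * p.2) :=
    (contDiff_const.mul contDiff_fst).prodMk (contDiff_const.mul contDiff_snd)
  have hcont : Continuous σ := by
    rw [hX.isEmbedding_affineCoords.continuous_iff]
    exact (hm'.continuous.comp hX.isEmbedding_affineCoords.continuous).congr fun z => (hcoe z).symm
  refine ⟨σ, fun z => ?_, ?_, fun z => ?_⟩
  -- Holomorphy of a continuous map into the submanifold can be tested after the immersion into ℂ².
  · rw [ContMDiffAt.iff_comp_isImmersionAt (hC.2.isImmersion.isImmersionAt (σ z))]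
    refine ⟨hcont.continuousAt, ?_⟩
    exact ((hm'.contMDiff.comp hC.2.contMDiff).contMDiffAt).congr_of_eventuallyEq
      (Filter.Eventually.of_forall hcoe)
  · apply hX.isEmbedding_affineCoords.injective
    rw [hcoe, affineCoords_ofAffine, affineCoords_ofAffine, div_mul_cancel₀ _ q.2.1,
      div_mul_cancel₀ _ q.2.2.1]
  · obtain ⟨r, rfl⟩ := hX.exists_ofAffine z
    refine (regularCover_ofAffine_eq_iff.2 ⟨t, ht2, ?_, ?_⟩).symm
    · change ((q'.1.1 / q.1.1) * (affineCoords w X (ofAffine w X r)).1) ^ _ = _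
      rw [affineCoords_ofAffine, mul_pow, hl]
    · change ((q'.1.2 / q.1.2) * (affineCoords w X (ofAffine w X r)).2) ^ _ = _
      rw [affineCoords_ofAffine, mul_pow, hm]

theorem IsConical.exists_isInducedStructure (hX : IsConical w X)
    (hpart : ∀ x : Punctured X, ∃ l, HasPartial X x.1 l) :
    ∃ C : ChartedSpace ℂ (RegularOrbits w X), IsInducedStructure w X C := by
  obtain ⟨C', hC'⟩ := hX.exists_isSubmanifoldStructure hpart
  have := hC'.1
  obtain ⟨C, hM, hd⟩ := exists_chartedSpace_isLocalDiffeomorph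
    (isLocalHomeomorph_regularCover hX) regularCover_surjective (exists_deck hX hC')
  exact ⟨C, hM, C', hC', hd⟩

end WeightedSurface

/-- A holomorphic function on a complex submanifold extends locally to the ambient space. -/
lemma Manifold.IsImmersionAt.exists_eventuallyEq_comp {S : Type*} [TopologicalSpace S]
    [ChartedSpace ℂ S] [IsManifold 𝓘(ℂ, ℂ) ω S] {ι : S → ℂ × ℂ} {s : S}
    (hι : Manifold.IsImmersionAt 𝓘(ℂ, ℂ) 𝓘(ℂ, ℂ × ℂ) ω ι s) {ψ : S → ℂ}
    (hψ : MDifferentiableAt 𝓘(ℂ, ℂ) 𝓘(ℂ, ℂ) ψ s) :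
    ∃ k : ℂ × ℂ → ℂ, DifferentiableAt ℂ k (ι s) ∧ ∀ᶠ z in 𝓝 s, ψ z = k (ι z) := by
  set e := hι.domChart with he
  set c := hι.codChart with hc
  have hs : s ∈ e.source := hι.mem_domChart_source
  have hcs : ι s ∈ c.source := hι.mem_codChart_source
  -- In adapted charts the immersion is u ↦ (u, 0), so the first ambient coordinate gives a local
  -- holomorphic retraction onto the submanifold. The extension is ψ composed with it.
  have key : ∀ z ∈ e.source, (hι.equiv.symm (c (ι z))).1 = e z := by
    intro z hz
    have hz' : e z ∈ (e.extend 𝓘(ℂ, ℂ)).target := by simpa using e.map_source hz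
    have h1 := hι.writtenInCharts hz'
    have h2 : c (ι (e.symm (e z))) = hι.equiv (e z, 0) := h1
    rw [e.left_inv hz] at h2
    rw [h2, ContinuousLinearEquiv.symm_apply_apply]
  have h1 : MDifferentiableAt 𝓘(ℂ, ℂ × ℂ) 𝓘(ℂ, ℂ × ℂ) c (ι s) :=
    ((contMDiffOn_of_mem_maximalAtlas hι.codChart_mem_maximalAtlas).contMDiffAt
      (c.open_source.mem_nhds hcs)).mdifferentiableAt (by simp)
  have h2 : MDifferentiableAt 𝓘(ℂ, ℂ × ℂ) 𝓘(ℂ, ℂ)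
      (fun q => (hι.equiv.symm (c q)).1) (ι s) := by
    have hd := h1.differentiableAt
    exact (differentiableAt_fst.comp _
      (hι.equiv.symm.differentiableAt.comp (ι s) hd)).mdifferentiableAt
  have h3 : MDifferentiableAt 𝓘(ℂ, ℂ) 𝓘(ℂ, ℂ) e.symm (e s) :=
    ((contMDiffOn_symm_of_mem_maximalAtlas hι.domChart_mem_maximalAtlas).contMDiffAt
      (e.open_target.mem_nhds (e.map_source hs))).mdifferentiableAt (by simp)
  refine ⟨fun q => ψ (e.symm (hι.equiv.symm (c q)).1), ?_, ?_⟩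
  · apply MDifferentiableAt.differentiableAt
    refine MDifferentiableAt.comp (ι s) (I' := 𝓘(ℂ, ℂ))
      (f := fun q => e.symm (hι.equiv.symm (c q)).1) (g := ψ) ?_ ?_
    · rw [key s hs, e.left_inv hs]
      exact hψ
    · refine MDifferentiableAt.comp (ι s) (I' := 𝓘(ℂ, ℂ))
        (f := fun q => (hι.equiv.symm (c q)).1) (g := e.symm) ?_ h2
      rw [key s hs]
      exact h3
  · filter_upwards [e.open_source.mem_nhds hs] with z hz
    rw [key z hz, e.left_inv hz]

namespace WeightedSurface

variable {w : Fin 3 → ℕ+} {f : MvPolynomial (Fin 3) ℝ} {d : ℕ}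

/-! ### The involution is antiholomorphic -/

lemma mapsTo_orbitConj :
    MapsTo (orbitConj w f) (branchImage w (surface f))ᶜ (branchImage w (surface f))ᶜ := by
  intro m hm h
  obtain ⟨x, rfl⟩ := orbitProj_surjective m
  rw [orbitConj_orbitProj, mem_branchImage_iff] at h
  refine hm ((mem_branchImage_iff _).2 ?_)
  simpa [conjPunctured] using h

/-- Complex conjugation on the affine curve. -/
def conjAffine (q : affineCurve w (surface f)) : affineCurve w (surface f) :=
  ⟨star q.1, star_ne_zero.2 q.2.1, star_ne_zero.2 q.2.2.1, by
    have h := (conjPunctured f (affineLift w (surface f) q)).2.1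
    convert h using 1
    funext i
    fin_cases i <;> simp [conjPunctured, affineLift, powMap, affinePt]⟩

lemma regularCover_conjAffine (q : affineCurve w (surface f)) :
    regularCover w (surface f) (ofAffine w (surface f) (conjAffine q)) =
      MapsTo.restrict (orbitConj w f) (branchImage w (surface f))ᶜ (branchImage w (surface f))ᶜ
        mapsTo_orbitConj (regularCover w (surface f) (ofAffine w (surface f) q)) := by
  apply Subtype.ext
  rw [regularCover_ofAffine]
  change _ = orbitConj w f (regularCover w (surface f) (ofAffine w (surface f) q)).1
  rw [regularCover_ofAffine, orbitConj_orbitProj]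
  congr 1
  apply Subtype.ext
  funext i
  fin_cases i <;> simp [conjAffine, conjPunctured, affineLift, powMap, affinePt]

/-- The involution is antiholomorphic on the regular part of the orbit space. -/
theorem isAntiholomorphic_orbitConj (hX : IsConical w (surface f))
    {C : ChartedSpace ℂ (RegularOrbits w (surface f))} (hC : IsInducedStructure w (surface f) C) :
    IsAntiholomorphic C (mapsTo_orbitConj (w := w) (f := f)).restrict := by
  obtain ⟨hM, C', ⟨hM', hι⟩, hp⟩ := hC
  refine ⟨(continuous_orbitConj.comp continuous_subtype_val).subtype_mk _, fun t => ?_⟩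
  obtain ⟨x, rfl⟩ := regularCover_surjective t
  set p := regularCover w (surface f)
  set J := (mapsTo_orbitConj (w := w) (f := f)).restrict
  set j : RegularCurve w (surface f) → RegularCurve w (surface f) := fun z =>
    ofAffine w (surface f) (conjAffine (hX.affineHomeo z)) with hj
  have hpj : ∀ z, p (j z) = J (p z) := fun z => by
    obtain ⟨q, rfl⟩ := hX.exists_ofAffine z
    have : hX.affineHomeo (ofAffine w (surface f) q) = q :=
      hX.affineHomeo.apply_symm_apply q
    rw [hj]
    simp only [this]
    exact regularCover_conjAffine q
  have hcoe : ∀ z, affineCoords w (surface f) (j z) = star (affineCoords w (surface f) z) :=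
    fun z => affineCoords_ofAffine _
  have hjc : Continuous j := by
    rw [hX.isEmbedding_affineCoords.continuous_iff]
    exact (continuous_star.comp hX.isEmbedding_affineCoords.continuous).congr
      fun z => (hcoe z).symm
  -- The chart is pulled back to the curve at `j x`, since p ∘ j = J ∘ p turns the expression of `J`
  -- near `p x` into this function evaluated along `j`.
  have hψ : MDifferentiableAt 𝓘(ℂ, ℂ) 𝓘(ℂ, ℂ) (fun z => chartAt ℂ (J (p x)) (p z)) (j x) := by
    refine MDifferentiableAt.comp (j x) (I' := 𝓘(ℂ, ℂ)) (f := p) (g := chartAt ℂ (J (p x))) ?_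
      ((hp (j x)).mdifferentiableAt (by simp))
    rw [hpj]
    exact mdifferentiableAt_atlas (chart_mem_atlas ℂ _) (mem_chart_source ℂ _)
  obtain ⟨k, hk, hke⟩ := (hι.isImmersion.isImmersionAt (j x)).exists_eventuallyEq_comp hψ
  -- One conjugation comes from `j` in affine coordinates and the other from the definition of
  -- antiholomorphy; together they preserve holomorphy.
  have hk' : DifferentiableAt ℂ (star ∘ k ∘ star) (affineCoords w (surface f) x) := by
    have := hk.star_star
    rwa [hcoe, star_star] at this
  have hg := (hp x).localInverse_mdifferentiableAt (by simp)
  have hgx : (hp x).localInverse (p x) = x :=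
    (hp x).localInverse_left_inv (hp x).localInverse_mem_target
  have hιx : MDifferentiableAt 𝓘(ℂ, ℂ) 𝓘(ℂ, ℂ × ℂ) (affineCoords w (surface f)) x :=
    (hι.contMDiff x).mdifferentiableAt (by simp)
  have hcomp : MDifferentiableAt 𝓘(ℂ, ℂ) 𝓘(ℂ, ℂ)
      (fun t => star (k (star (affineCoords w (surface f) ((hp x).localInverse t))))) (p x) := by
    refine MDifferentiableAt.comp (p x) (I' := 𝓘(ℂ, ℂ × ℂ)) (g := star ∘ k ∘ star)
      (f := fun t => affineCoords w (surface f) ((hp x).localInverse t)) ?_ ?_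
    · rw [hgx]
      exact hk'.mdifferentiableAt
    · refine MDifferentiableAt.comp (p x) (I' := 𝓘(ℂ, ℂ)) (g := affineCoords w (surface f)) ?_ hg
      rw [hgx]
      exact hιx
  refine hcomp.congr_of_eventuallyEq ?_
  have ht : Filter.Tendsto (fun t => j ((hp x).localInverse t)) (𝓝 (p x)) (𝓝 (j x)) := by
    have := hjc.continuousAt.comp hg.continuousAt
    have h2 : Filter.Tendsto (fun t => j ((hp x).localInverse t)) (𝓝 (p x))
      (𝓝 (j ((hp x).localInverse (p x)))) := this
    rwa [hgx] at h2
  filter_upwards [ht.eventually hke, (hp x).localInverse_eventuallyEq_right] with t h1 h2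
  have h3 : p ((hp x).localInverse t) = t := h2
  rw [hpj, h3, hcoe] at h1
  rw [h1]
  rfl

end WeightedSurface

/-! ### Fixed set and components: conclusion -/

namespace WeightedSurface

variable {w : Fin 3 → ℕ+} {f : MvPolynomial (Fin 3) ℝ} {d : ℕ}

lemma setOf_orbitConj_eq_self (hX : IsConical w (surface f)) :
    {m | orbitConj w f m = m} = realOrbits w f :=
  Set.ext fun _ => orbitConj_eq_self_iff hX

lemma realOrbits_subset_compl_branchImage (h : ∀ x ∈ realSurface f, x 0 * x 1 * x 2 = 0 → x = 0) :
    realOrbits w f ⊆ (branchImage w (surface f))ᶜ := by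
  rintro m ⟨x, ⟨y, hy, hy0, hxy⟩, rfl⟩ hm
  rw [mem_branchImage_iff, hxy] at hm
  change (y 0 : ℂ) * y 1 * y 2 = 0 at hm
  exact hy0 (h y hy (by exact_mod_cast hm))

/-- If the complement of the real orbits is disconnected, then it has exactly two components, and
they are exchanged by the involution. -/
theorem exists_components_compl_realOrbits (hf₀ : f ≠ 0)
    (hf : IsWeightedHomogeneous (fun i => (w i : ℕ)) f d)
    (hsing : IsIsolatedSingularPoint (surface f) 0) (h : ¬ IsPreconnected (realOrbits w f)ᶜ) :
    ∃ M₁ M₂ : Set (OrbitSpace w (surface f)), M₁ ≠ M₂ ∧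
      componentsOf (realOrbits w f)ᶜ = {M₁, M₂} ∧ M₁ = orbitConj w f '' M₂ ∧
        M₂ = orbitConj w f '' M₁ := by
  have hX := isConical_surface hf
  have := preconnectedSpace_orbitSpace hf₀ hf hsing.1.1
  have hΩ : (realOrbits w f)ᶜ = {m | orbitConj w f m ≠ m} := by
    rw [← setOf_orbitConj_eq_self hX]
    rfl
  rw [hΩ] at h ⊢
  refine components_of_no_invariant_splitting orbitConj_involutive continuous_orbitConj
    (fun m hm h => hm ?_) (fun U V hU hV hUV hd hUi hVi => ?_) h
  · rw [orbitConj_involutive] at h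
    exact h.symm
  · exact eq_empty_of_invariant_splitting hX
      (fun x => exists_hasPartial hf₀ hf hsing x.2.1 x.2.2) hU hV hUV hd hUi hVi

end WeightedSurface

end

open WeightedSurface in
theorem mainTheorem6 (w : Fin 3 → ℕ+) (hw : Finset.univ.gcd (fun i => (w i : ℕ)) = 1)
    (f : MvPolynomial (Fin 3) ℝ) (hf₀ : f ≠ 0) (d : ℕ)
    (hf : IsWeightedHomogeneous (fun i => (w i : ℕ)) f d)
    (hsing : IsIsolatedSingularPoint (surface f) 0) :
    -- the holomorphic structure on `M - ϕ(F)` exists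
    (∃ C : ChartedSpace ℂ (RegularOrbits w (surface f)), IsInducedStructure w (surface f) C) ∧
    -- and there is an involution `j` of `M`, induced by complex conjugation, such that
    ∃ j : OrbitSpace w (surface f) → OrbitSpace w (surface f),
      (∀ x, j (orbitProj w (surface f) x) = orbitProj w (surface f) (conjPunctured f x)) ∧
      Function.Involutive j ∧
      -- it restricts to an antiholomorphic involution of `M - ϕ(F)`
      (∃ hj : MapsTo j (branchImage w (surface f))ᶜ (branchImage w (surface f))ᶜ,
        ∀ C : ChartedSpace ℂ (RegularOrbits w (surface f)), IsInducedStructure w (surface f) C →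
          IsAntiholomorphic C hj.restrict) ∧
      -- its fixed set is `π(X(ℝ) - {0})`
      {m | j m = m} = realOrbits w f ∧
      ((∀ x ∈ realSurface f, x 0 * x 1 * x 2 = 0 → x = 0) →
        {m | m ∈ (branchImage w (surface f))ᶜ ∧ j m = m} = realOrbits w f) ∧
      -- if the complement is disconnected, it has exactly two components, exchanged by `j`
      (¬ IsPreconnected (realOrbits w f)ᶜ →
        ∃ M₁ M₂ : Set (OrbitSpace w (surface f)), M₁ ≠ M₂ ∧
          componentsOf (realOrbits w f)ᶜ = {M₁, M₂} ∧ M₁ = j '' M₂ ∧ M₂ = j '' M₁) := by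
  have hX := isConical_surface hf
  refine ⟨hX.exists_isInducedStructure fun x => exists_hasPartial hf₀ hf hsing x.2.1 x.2.2,
    orbitConj w f, orbitConj_orbitProj, orbitConj_involutive,
    ⟨mapsTo_orbitConj, fun C hC => isAntiholomorphic_orbitConj hX hC⟩,
    setOf_orbitConj_eq_self hX, fun h => ?_, exists_components_compl_realOrbits hf₀ hf hsing⟩
  rw [← setOf_orbitConj_eq_self hX]
  refine Subset.antisymm (fun m hm => hm.2) fun m hm => ⟨?_, hm⟩
  exact realOrbits_subset_compl_branchImage h ((orbitConj_eq_self_iff hX).1 hm)
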